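/- Let $k\ge 1$ be an integer and let $q_0=\{q_{0,n}\}_{n\in\mathbb Z}$ be a complex sequence with $q_0\in l^{2,k}$, i.e. $\sum_{n\in\mathbb Z}(1+n^2)^k|q_{0,n}|^2<\infty$, and $\|q_0\|_\infty<1$. For a sequence $q$ with $\|q\|_\infty<1$ and $z=e^{i\theta}$, consider the spectral problem $X(n+1)=\begin{pmatrix} z& q_n\\ \overline{q_n}& z^{-1}\end{pmatrix}X(n)$, with Jost solutions $X^{(\pm)}$ normalized by $z^{-n\sigma_3}X^{(\pm)}(n)\to I$ as $n\to\pm\infty$, $\sigma_3=\mathrm{diag}(1,-1)$, and the scattering matrix $S$ with $X^{(-)}=X^{(+)}S$. If $(a,b)^T$ is the first column of $S$, the reflection coefficient of $q$ is $r(\theta)=b(\theta)/a(\theta)$. Let $H^k_\theta$ be the space of $2\pi$-periodic functions in $L^2(-\pi,\pi)$ whose (periodic) weak derivatives of order $1,\dots,k$ are in $L^2(-\pi,\pi)$. Then the reflection coefficient $r(\cdot,0)$ of $q_0$ exists and is unique (in particular the Jost solutions exist and $a\neq0$ on the unit circle), and the defocusing Ablowitz–Ladik equation $$ i\,\partial_t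 q_n = q_{n+1}-2q_n+q_{n-1}-|q_n|^2(q_{n+1}+q_{n-1}),\qquad n\in\mathbb Z,\ t\in\mathbb R,\qquad q(0)=q_0, $$ has exactly one solution $q:\mathbb R\to\mathbb C^{\mathbb Z}$ for which $\sup_{|t|\le T}\|q(t)\|_\infty<\infty$ for every $T$. For every $t\in\mathbb R$: 1. the reflection coefficient of $q(t)$ exists, is unique, and equals $r(\theta,t)=r(\theta,0)\,e^{2i(\cos 2\theta-1)t}$; 2. $r(\cdot,t)\in H^k_\theta$ and $\|r(\cdot,t)\|_\infty<1$; 3. $q(t)$ is recovered from $r(\cdot,t)$ by inverse scattering: for every $n\in\mathbb Z$ there is exactly one $2\times2$ matrix function $M(z)=M(z,n+1)$, holomorphic on $\{|z|\ne1\}$, with $M(z)=I+O(z^{-1})$ as $z\to\infty$, having at every point $z=e^{i\theta}$ of the unit circle boundary values $M_+$ from $\{|z|>1\}$ and $M_-$ from $\{|z|<1\}$ (unrestricted limits) with $$M_+=M_-\,z^{(n+1)\sigma_3}\begin{pmatrix}1-|r(\theta,t)|^2&-\overline{r(\theta,t)}\\ r(\theta,t)&1\end{pmatrix}z^{-(n+1)\sigma_3},$$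 and $q_n(t)=\lim_{z\to0}M_{12}(z,n+1)/z$; 4. $q(t)\in l^{2,k}$ and $\|q(t)\|_\infty<1$. -/

import Mathlib

open Complex Filter Topology MeasureTheory
open scoped Matrix ContDiff

namespace AblowitzLadik

/-- The weighted space `l^{2,k}` of bilateral sequences. -/
def MemL2k (k : ℕ) (q : ℤ → ℂ) : Prop :=
  Summable fun n : ℤ => (1 + (n : ℝ) ^ 2) ^ k * ‖q n‖ ^ 2

/-- `‖f‖_∞ < 1`, for a function that is defined everywhere. -/
def SupNormLtOne {ι : Type*} (f : ι → ℂ) : Prop :=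
  ∃ ρ : ℝ, ρ < 1 ∧ ∀ i, ‖f i‖ ≤ ρ

/-- The Sobolev space `H^k` of the unit circle, in the angular variable: `f` is
`2π`-periodic and square integrable over a period, and so are its weak derivatives of order
at most `k`, which are tested against smooth `2π`-periodic functions. -/
def MemHTheta (k : ℕ) (f : ℝ → ℂ) : Prop :=
  Function.Periodic f (2 * Real.pi) ∧
  MemLp f 2 (volume.restrict (Set.Ioc (-Real.pi) Real.pi)) ∧
  ∀ α : ℕ, 1 ≤ α → α ≤ k → ∃ g : ℝ → ℂ,
    MemLp g 2 (volume.restrict (Set.Ioc (-Real.pi) Real.pi)) ∧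
    ∀ φ : ℝ → ℂ, ContDiff ℝ ∞ φ → Function.Periodic φ (2 * Real.pi) →
      ∫ θ in (-Real.pi)..Real.pi, f θ * iteratedDeriv α φ θ =
        (-1) ^ α * ∫ θ in (-Real.pi)..Real.pi, g θ * φ θ

/-- The point `z = e^{iθ}` of the unit circle. -/
noncomputable def circlePt (θ : ℝ) : ℂ := exp (θ * I)

/-- The matrix `z^{nσ₃}`. -/
noncomputable def zPow (z : ℂ) (n : ℤ) : Matrix (Fin 2) (Fin 2) ℂ :=
  !![z ^ n, 0; 0, z ^ (-n)]

/-- The matrix `z^{σ₃} + Q` with potential value `c`. -/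
noncomputable def laxMatrix (c z : ℂ) : Matrix (Fin 2) (Fin 2) ℂ :=
  !![z, c; (starRingEnd ℂ) c, z⁻¹]

/-- `X` is a matrix solution of the spectral problem `X(n+1) = (z^{σ₃} + Q_n) X(n)`, normalized
by `X(n) ∼ z^{nσ₃}` along `l`. -/
def IsJost (q : ℤ → ℂ) (z : ℂ) (l : Filter ℤ) (X : ℤ → Matrix (Fin 2) (Fin 2) ℂ) : Prop :=
  (∀ n, X (n + 1) = laxMatrix (q n) z * X n) ∧
  Tendsto (fun n => zPow z (-n) * X n) l (𝓝 1)

/-- `S` is the scattering matrix at `z`: the Jost solutions normalized at `+∞` and at `-∞`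
exist and are related by `X⁻ = X⁺ S`. -/
def IsScatteringMatrix (q : ℤ → ℂ) (z : ℂ) (S : Matrix (Fin 2) (Fin 2) ℂ) : Prop :=
  ∃ Xp Xm : ℤ → Matrix (Fin 2) (Fin 2) ℂ,
    IsJost q z atTop Xp ∧ IsJost q z atBot Xm ∧ ∀ n, Xm n = Xp n * S

/-- `r` is the reflection coefficient of `q` as a function of the angle: `r = b / a`, where
`a` and `b` form the first column of the scattering matrix. -/
def IsReflectionCoeff (q : ℤ → ℂ) (r : ℝ → ℂ) : Prop :=
  ∀ θ : ℝ, ∃ S, IsScatteringMatrix q (circlePt θ) S ∧ S 0 0 ≠ 0 ∧ r θ = S 1 0 / S 0 0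

/-- The evolution `r(θ) ↦ r(θ) e^{2i(cos 2θ - 1)t}`. -/
noncomputable def evolve (r : ℝ → ℂ) (t : ℝ) : ℝ → ℂ :=
  fun θ => r θ * exp (2 * I * ((Real.cos (2 * θ) - 1 : ℝ) : ℂ) * (t : ℂ))

/-- `q` solves the defocusing Ablowitz–Ladik equation for all times with initial value `q₀`,
and is bounded on every bounded time interval. -/
def IsSolution (q₀ : ℤ → ℂ) (q : ℝ → ℤ → ℂ) : Prop :=
  q 0 = q₀ ∧
  (∀ t n, DifferentiableAt ℝ (fun s => q s n) t ∧
    I * deriv (fun s => q s n) t =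
      q t (n + 1) - 2 * q t n + q t (n - 1)
        - ((‖q t n‖ ^ 2 : ℝ) : ℂ) * (q t (n + 1) + q t (n - 1))) ∧
  ∀ T : ℝ, ∃ C : ℝ, ∀ t, |t| ≤ T → ∀ n, ‖q t n‖ ≤ C

/-- The jump matrix `z^{nσ₃} V z^{-nσ₃}` at `z = e^{iθ}`. -/
noncomputable def jumpMatrix (r : ℝ → ℂ) (n : ℤ) (θ : ℝ) : Matrix (Fin 2) (Fin 2) ℂ :=
  zPow (circlePt θ) n *
    !![1 - ((‖r θ‖ ^ 2 : ℝ) : ℂ), -(starRingEnd ℂ) (r θ); r θ, 1] *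
    zPow (circlePt θ) (-n)

/-- `M` solves the Riemann–Hilbert problem with data `r` and `n`: it is holomorphic off the unit
circle, `M = I + O(1/z)` at infinity, and its boundary values `Mp` from outside and `Mm` from
inside exist at every point of the circle and satisfy `Mp = Mm z^{nσ₃} V z^{-nσ₃}`. The values
of `M` on the circle itself are irrelevant. -/
def IsRHSolution (r : ℝ → ℂ) (n : ℤ) (M : ℂ → Matrix (Fin 2) (Fin 2) ℂ) : Prop :=
  (∀ i j, DifferentiableOn ℂ (fun z => M z i j) {z | ‖z‖ ≠ 1}) ∧
  (∀ i j, (fun z => M z i j - (1 : Matrix (Fin 2) (Fin 2) ℂ) i j)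
    =O[Bornology.cobounded ℂ] fun z => z⁻¹) ∧
  ∀ θ : ℝ, ∃ Mp Mm : Matrix (Fin 2) (Fin 2) ℂ,
    Tendsto M (𝓝[{w | 1 < ‖w‖}] circlePt θ) (𝓝 Mp) ∧
    Tendsto M (𝓝[{w | ‖w‖ < 1}] circlePt θ) (𝓝 Mm) ∧
    Mp = Mm * jumpMatrix r n θ

end AblowitzLadik

/-! The equation reads `q_n' = 2i q_n - i(1 - |q_n|²)(q_{n+1} + q_{n-1})`. The linear term only
rotates `q_n`, and the coupling carries the factor `1 - |q_n|²`, so `1 - |q_n|²` solves a scalar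
equation for which zero is a barrier and the unit disc is invariant at every site. Truncating the
nonlinearity outside the disc makes the field globally Lipschitz on weighted `l²`. Its global flow
therefore stays in `l^{2,k}`, never leaves the disc and solves the true equation
(`exists_solution`). Uniqueness needs only bounded solutions, since the right-hand side is Lipschitz
in the sup norm on bounded sets (`IsSolution.unique`).

After removal of the free evolution `z^{nσ₃}`, a scattering matrix is necessarily the limit of the
finite products `fullTransfer` (`IsScatteringMatrix.tendsto`). Properties of the finite products
thus pass to the limit. The identity `|a_N|² - |b_N|² = ∏(1 - |q_j|²)` gives `‖r‖_∞ < 1`. The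
zero-curvature equation telescopes along the product, so the time derivative of a finite product
involves the time part of the Lax pair only at the two ends. There that part tends to `-i(cos 2θ -
1)σ₃`, hence `a` is conserved and `b` acquires the stated phase (`scattering_evolution`).

Existence of the Jost solutions comes from convergent products in `w = 1/z` on the closed unit disc.
A hyperbolic identity shows that one component of each Jost vector strictly dominates the other.
Therefore `a`, a pairing of the left and right vectors, has no zero on the closed disc
(`discA_ne_zero`). There is no discrete spectrum, and the Jost vectors themselves, divided by `a`
where required, solve the Riemann–Hilbert problem (`exists_isRHSolution`). A Liouville argument for
functions without jump on the circle gives uniqueness (`eq_of_no_jump`, `IsRHSolution.eqOn`), and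
the expansion at `z = 0` returns the potential.

For `r ∈ H^k` it suffices to bound the quotients `b_N / a_N` in `H^k` uniformly in `N` and to take
weak limits of their derivatives. The entries of the products are trigonometric polynomials
dominated, coefficient by coefficient, by the scalar product `Q = ∏(1 + 2|q_j| cos((2j+1)θ))`. Its
derivative is dominated by `S Q`, where `S` is linear in `|q_j|` and has weights `|2j+1|`. By
Parseval `S` is bounded in `H^{k-1}` when `q ∈ l^{2,k}`, and `Q' ≪ S Q` bootstraps `Q` up to `H^k`
(`bddH_majProd`). -/

namespace AblowitzLadik

/-! ### Global flows of Lipschitz vector fields. -/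

section GlobalODE

open scoped NNReal BoundedContinuousFunction

variable {E : Type*} [NormedAddCommGroup E] [NormedSpace ℝ E]

/-- Integrating an exponential gains a factor `1 / l`. In the norm weighted by `exp (-l|t|)` this
makes the Picard map contracting on the whole time line at once. -/
theorem norm_integral_le_of_norm_le_exp {f : ℝ → E} {C l : ℝ} (hl : 0 < l) (hC : 0 ≤ C)
    (hf : ∀ s, ‖f s‖ ≤ C * Real.exp (l * |s|)) (t : ℝ) :
    ‖∫ s in (0 : ℝ)..t, f s‖ ≤ C / l * Real.exp (l * |t|) := by
  have key : ∀ {g : ℝ → E}, (∀ s, ‖g s‖ ≤ C * Real.exp (l * |s|)) → ∀ {t : ℝ}, 0 ≤ t →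
      ‖∫ s in (0 : ℝ)..t, g s‖ ≤ C / l * Real.exp (l * |t|) := by
    intro g hg t ht
    have h1 : ‖∫ s in (0 : ℝ)..t, g s‖ ≤ ∫ s in (0 : ℝ)..t, C * Real.exp (l * s) := by
      refine intervalIntegral.norm_integral_le_of_norm_le ht ?_ ?_
      · refine Eventually.of_forall fun s hs => ?_
        simpa [abs_of_pos hs.1] using hg s
      · exact (by fun_prop : Continuous fun s => C * Real.exp (l * s)).intervalIntegrable _ _
    have h2 : ∫ s in (0 : ℝ)..t, C * Real.exp (l * s)
        = C / l * Real.exp (l * t) - C / l * Real.exp (l * 0) := by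
      refine intervalIntegral.integral_eq_sub_of_hasDerivAt
        (f := fun s => C / l * Real.exp (l * s)) (fun s _ => ?_) ?_
      · exact (((hasDerivAt_id' s).const_mul l).exp.const_mul (C / l)).congr_deriv (by field_simp)
      · exact (by fun_prop : Continuous fun s => C * Real.exp (l * s)).intervalIntegrable _ _
    rw [abs_of_nonneg ht]
    refine h1.trans (h2.le.trans ?_)
    have : 0 ≤ C / l * Real.exp (l * 0) := by positivity
    linarith
  rcases le_total 0 t with ht | ht
  · exact key hf ht
  · have h := key (g := fun s => f (-s)) (fun s => by simpa using hf (-s)) (neg_nonneg.2 ht)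
    rw [intervalIntegral.integral_comp_neg, neg_neg, neg_zero, intervalIntegral.integral_symm,
      norm_neg, abs_neg] at h
    exact h

/-- A globally Lipschitz vector field on a Banach space that vanishes at the origin has a
global integral curve through every point. -/
theorem exists_global_integralCurve [CompleteSpace E] {F : E → E} {K : ℝ≥0}
    (hF : LipschitzWith K F) (hF0 : F 0 = 0) (x₀ : E) :
    ∃ x : ℝ → E, x 0 = x₀ ∧ ∀ t, HasDerivAt x (F (x t)) t := by
  -- The Picard map has Lipschitz constant at most `K / l`. This choice gives `K / l ≤ 1/2`, and the
  -- summand `1` keeps `l` positive when `K = 0`.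
  set l : ℝ := 2 * K + 1 with hl
  have hlpos : 0 < l := by positivity
  have hFn : ∀ x, ‖F x‖ ≤ K * ‖x‖ := fun x => by
    simpa [hF0] using hF.norm_sub_le x 0
  have hFc := hF.continuous
  have hexp : ∀ t : ℝ, Real.exp (-(l * |t|)) * Real.exp (l * |t|) = 1 := fun t => by
    rw [← Real.exp_add]; simp
  -- The unknown is `y t = exp (-l|t|) • x t`, which ranges over bounded continuous functions; `G y`
  -- is the field along the rescaled curve.
  let G : (ℝ →ᵇ E) → ℝ → E := fun y s => F (Real.exp (l * |s|) • y s)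
  have hGc : ∀ y, Continuous (G y) := fun y => by
    refine hFc.comp ?_
    have := y.continuous
    fun_prop
  let Φ : (ℝ →ᵇ E) → (ℝ →ᵇ E) := fun y =>
    BoundedContinuousFunction.ofNormedAddCommGroup
      (fun t => Real.exp (-(l * |t|)) • (x₀ + ∫ s in (0 : ℝ)..t, G y s))
      (by
        have : Continuous fun t => ∫ s in (0 : ℝ)..t, G y s :=
          intervalIntegral.continuous_primitive (fun a b => (hGc y).intervalIntegrable a b) 0
        fun_prop)
      (‖x₀‖ + K * ‖y‖ / l)
      (fun t => by
        have h1 := norm_integral_le_of_norm_le_exp (f := G y) (C := K * ‖y‖) hlpos (by positivity)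
          (fun s => by
            refine (hFn _).trans ?_
            rw [norm_smul, Real.norm_of_nonneg (Real.exp_nonneg _), mul_assoc]
            have := y.norm_coe_le_norm s
            rw [mul_comm ‖y‖]
            gcongr) t
        rw [norm_smul, Real.norm_of_nonneg (Real.exp_nonneg _)]
        have h2 : Real.exp (-(l * |t|)) ≤ 1 := by
          rw [Real.exp_le_one_iff]; have := abs_nonneg t; nlinarith
        calc _ ≤ Real.exp (-(l * |t|)) * (‖x₀‖ + K * ‖y‖ / l * Real.exp (l * |t|)) := by
              gcongr; exact (norm_add_le _ _).trans (by gcongr)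
          _ = Real.exp (-(l * |t|)) * ‖x₀‖
              + K * ‖y‖ / l * (Real.exp (-(l * |t|)) * Real.exp (l * |t|)) := by ring
          _ ≤ _ := by
              rw [hexp, mul_one]
              gcongr
              exact mul_le_of_le_one_left (norm_nonneg _) h2)
  have hΦ : ContractingWith (1 / 2) Φ := by
    refine ⟨by norm_num [← NNReal.coe_lt_coe], LipschitzWith.of_dist_le_mul fun y y' => ?_⟩
    rw [BoundedContinuousFunction.dist_le (by positivity)]
    intro t
    have h1 := norm_integral_le_of_norm_le_exp (f := fun s => G y s - G y' s)
        (C := K * dist y y') hlpos (by positivity)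
      (fun s => by
        refine (hF.norm_sub_le _ _).trans ?_
        rw [← smul_sub, norm_smul, Real.norm_of_nonneg (Real.exp_nonneg _), mul_assoc]
        have := BoundedContinuousFunction.dist_coe_le_dist (f := y) (g := y') s
        rw [dist_eq_norm] at this
        rw [mul_comm (dist y y')]
        gcongr) t
    have h3 : Φ y t - Φ y' t
        = Real.exp (-(l * |t|)) • ∫ s in (0 : ℝ)..t, (G y s - G y' s) := by
      rw [intervalIntegral.integral_sub ((hGc y).intervalIntegrable _ _)
        ((hGc y').intervalIntegrable _ _)]
      change Real.exp (-(l * |t|)) • (x₀ + ∫ s in (0 : ℝ)..t, G y s)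
        - Real.exp (-(l * |t|)) • (x₀ + ∫ s in (0 : ℝ)..t, G y' s) = _
      rw [← smul_sub]
      congr 1
      abel
    rw [dist_eq_norm, h3, norm_smul, Real.norm_of_nonneg (Real.exp_nonneg _)]
    calc _ ≤ Real.exp (-(l * |t|)) * (K * dist y y' / l * Real.exp (l * |t|)) := by gcongr
      _ = K * dist y y' / l * (Real.exp (-(l * |t|)) * Real.exp (l * |t|)) := by ring
      _ = (K / l) * dist y y' := by rw [hexp]; ring
      _ ≤ _ := by
        gcongr
        rw [div_le_iff₀ hlpos]
        push_cast
        rw [hl]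
        linarith
  obtain ⟨y, hy⟩ : ∃ y, Φ y = y := ⟨_, hΦ.fixedPoint_isFixedPt⟩
  have hx : ∀ t, Real.exp (l * |t|) • y t = x₀ + ∫ s in (0 : ℝ)..t, G y s := fun t => by
    have : y t = Real.exp (-(l * |t|)) • (x₀ + ∫ s in (0 : ℝ)..t, G y s) :=
      (congrArg (fun z : ℝ →ᵇ E => z t) hy).symm
    rw [this, smul_smul, mul_comm, hexp, one_smul]
  refine ⟨fun t => Real.exp (l * |t|) • y t, ?_, fun t => ?_⟩
  · simpa using hx 0
  · have h1 : HasDerivAt (fun t => x₀ + ∫ s in (0 : ℝ)..t, G y s) (G y t) t :=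
      (intervalIntegral.integral_hasDerivAt_right ((hGc y).intervalIntegrable _ _)
        ((hGc y).stronglyMeasurableAtFilter _ _) (hGc y).continuousAt).const_add x₀
    rw [← funext hx] at h1
    exact h1

end GlobalODE

/-! ### The truncated lattice equation in weighted `l²`. -/

/-- The Hilbert space `l²(ℤ)`. -/
noncomputable abbrev L2Z := lp (fun _ : ℤ => ℂ) 2

theorem hasSum_sq_norm (u : L2Z) : HasSum (fun n => ‖u n‖ ^ 2) (‖u‖ ^ 2) := by
  simpa using lp.hasSum_norm (p := 2) (by norm_num) u

theorem memlp_two_iff {x : ℤ → ℂ} : Memℓp x 2 ↔ Summable fun n => ‖x n‖ ^ 2 := by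
  rw [memℓp_gen_iff (by norm_num)]
  simp

/-- The constant `9` is `3` from Cauchy–Schwarz on three terms times `3` from the three shifted
copies of the same sum. -/
theorem summable_sq_and_tsum_le {x : ℤ → ℂ} {a : ℤ → ℝ} {C S : ℝ}
    (ha : HasSum (fun n => a n ^ 2) S)
    (hx : ∀ n, ‖x n‖ ≤ C * (a n + a (n + 1) + a (n - 1))) :
    (Summable fun n => ‖x n‖ ^ 2) ∧ ∑' n, ‖x n‖ ^ 2 ≤ 9 * C ^ 2 * S := by
  have h1 : HasSum (fun n => a (n + 1) ^ 2) S :=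
    ((Equiv.addRight (1 : ℤ)).hasSum_iff (f := fun n => a n ^ 2)).2 ha
  have h2 : HasSum (fun n => a (n - 1) ^ 2) S :=
    ((Equiv.subRight (1 : ℤ)).hasSum_iff (f := fun n => a n ^ 2)).2 ha
  have h3 := ((ha.add h1).add h2).mul_left (3 * C ^ 2)
  have hle : ∀ n, ‖x n‖ ^ 2 ≤ 3 * C ^ 2 * (a n ^ 2 + a (n + 1) ^ 2 + a (n - 1) ^ 2) := fun n => by
    have h := pow_le_pow_left₀ (norm_nonneg _) (hx n) 2
    have h' : (a n + a (n + 1) + a (n - 1)) ^ 2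
        ≤ 3 * (a n ^ 2 + a (n + 1) ^ 2 + a (n - 1) ^ 2) := by
      nlinarith [sq_nonneg (a n - a (n + 1)), sq_nonneg (a n - a (n - 1)),
        sq_nonneg (a (n + 1) - a (n - 1))]
    calc _ ≤ _ := h
      _ = C ^ 2 * (a n + a (n + 1) + a (n - 1)) ^ 2 := by ring
      _ ≤ C ^ 2 * (3 * (a n ^ 2 + a (n + 1) ^ 2 + a (n - 1) ^ 2)) := by gcongr
      _ = _ := by ring
  have hs := Summable.of_nonneg_of_le (f := fun n => 3 * C ^ 2 * (a n ^ 2 + a (n + 1) ^ 2 + a (n - 1) ^ 2))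
    (g := fun n => ‖x n‖ ^ 2) (fun n => sq_nonneg _) hle h3.summable
  refine ⟨hs, (hs.tsum_le_tsum hle h3.summable).trans (h3.tsum_eq.le.trans ?_)⟩
  linarith

/-- The square root of the weight of `l^{2,k}`. -/
noncomputable def weight (k : ℕ) (n : ℤ) : ℝ := √((1 + (n : ℝ) ^ 2) ^ k)

theorem weight_pos (k : ℕ) (n : ℤ) : 0 < weight k n := by
  unfold weight; positivity

theorem weight_sq (k : ℕ) (n : ℤ) : weight k n ^ 2 = (1 + (n : ℝ) ^ 2) ^ k :=
  Real.sq_sqrt (by positivity)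

/-- For neighbours `1 + n² ≤ 3(1 + m²)`, so the shifts are bounded on the weighted space and the
nearest-neighbour coupling stays Lipschitz there. -/
theorem weight_le {k : ℕ} {m n : ℤ} (h : |m - n| ≤ 1) :
    weight k n ≤ √(3 ^ k) * weight k m := by
  unfold weight
  rw [← Real.sqrt_mul (by positivity), ← mul_pow]
  refine Real.sqrt_le_sqrt (pow_le_pow_left₀ (by positivity) ?_ _)
  have h' : |(m : ℝ) - n| ≤ 1 := by exact_mod_cast h
  rw [abs_le] at h'
  nlinarith [sq_nonneg ((m : ℝ) + (m - n))]

theorem one_add_sq_le_weight_sq {k : ℕ} (hk : 1 ≤ k) (n : ℤ) :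
    1 + (n : ℝ) ^ 2 ≤ weight k n ^ 2 := by
  rw [weight_sq]
  exact le_self_pow₀ (by nlinarith [sq_nonneg (n : ℝ)]) (by omega)

theorem summable_inv_one_add_sq : Summable fun n : ℤ => (1 + (n : ℝ) ^ 2)⁻¹ := by
  have h : Summable fun n : ℤ => ((n : ℝ) ^ 2)⁻¹ := by
    simpa using (Real.summable_one_div_int_pow (p := 2)).2 (by norm_num)
  refine Summable.of_nonneg_of_le (fun n => by positivity) (fun n => ?_)
    (h.add (summable_of_ne_finset_zero (f := fun n : ℤ => if n = 0 then (1 : ℝ) else 0) (s := {0})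
      (by simp)))
  by_cases hn : n = 0
  · simp [hn]
  · simp only [hn, if_false, add_zero]
    have : (n : ℝ) ≠ 0 := by exact_mod_cast hn
    exact inv_anti₀ (by positivity) (by linarith)

/-- Clipping of a real number to `[-1, 1]`. -/
noncomputable def clip (a : ℝ) : ℝ := max (-1) (min 1 a)

theorem abs_clip_le (a : ℝ) : |clip a| ≤ 1 := by
  unfold clip; rw [abs_le]; grind

theorem abs_clip_sub_le (a b : ℝ) : |clip a - clip b| ≤ |a - b| := by
  unfold clip
  rcases le_total a b with h | h
  · rw [abs_of_nonpos (by grind), abs_of_nonpos (by linarith)]; grind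
  · rw [abs_of_nonneg (by grind), abs_of_nonneg (by linarith)]; grind

theorem clip_of_abs_le {a : ℝ} (h : |a| ≤ 1) : clip a = a := by
  unfold clip; rw [abs_le] at h; grind

/-- Clipping of both coordinates of a complex number to `[-1, 1]`. -/
noncomputable def cclip (x : ℂ) : ℂ := ⟨clip x.re, clip x.im⟩

theorem norm_cclip_le (x : ℂ) : ‖cclip x‖ ≤ 2 := by
  have := Complex.norm_le_abs_re_add_abs_im (cclip x)
  have h1 := abs_clip_le x.re
  have h2 := abs_clip_le x.im
  simp only [cclip] at this ⊢
  linarith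

theorem norm_cclip_sub_le (x y : ℂ) : ‖cclip x - cclip y‖ ≤ 2 * ‖x - y‖ := by
  have := Complex.norm_le_abs_re_add_abs_im (cclip x - cclip y)
  have h1 := abs_clip_sub_le x.re y.re
  have h2 := abs_clip_sub_le x.im y.im
  have h3 := Complex.abs_re_le_norm (x - y)
  have h4 := Complex.abs_im_le_norm (x - y)
  simp only [cclip, sub_re, sub_im] at *
  linarith

theorem cclip_of_norm_le {x : ℂ} (h : ‖x‖ ≤ 1) : cclip x = x :=
  Complex.ext (clip_of_abs_le ((Complex.abs_re_le_norm x).trans h))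
    (clip_of_abs_le ((Complex.abs_im_le_norm x).trans h))

/-- The factor `1 - |x|²`, cut off outside the unit disc. -/
noncomputable def cutoff (x : ℂ) : ℝ := 1 - min 1 ‖x‖ ^ 2

theorem cutoff_eq_max (x : ℂ) : cutoff x = max 0 (1 - ‖x‖ ^ 2) := by
  unfold cutoff
  have := norm_nonneg x
  rcases le_total 1 ‖x‖ with h | h
  · rw [min_eq_left h, max_eq_left (by nlinarith)]; norm_num
  · rw [min_eq_right h, max_eq_right (by nlinarith)]

theorem abs_cutoff_sub_le (x y : ℂ) : |cutoff x - cutoff y| ≤ 2 * ‖x - y‖ := by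
  have hx := norm_nonneg x
  have hy := norm_nonneg y
  have h1 : |min 1 ‖x‖ - min 1 ‖y‖| ≤ ‖x - y‖ := by
    have h := abs_norm_sub_norm_le x y
    refine le_trans ?_ h
    rcases le_total ‖x‖ ‖y‖ with h | h
    · rw [abs_of_nonpos (by grind), abs_of_nonpos (by linarith)]; grind
    · rw [abs_of_nonneg (by grind), abs_of_nonneg (by linarith)]; grind
  have h2 : |min 1 ‖x‖ + min 1 ‖y‖| ≤ 2 := by rw [abs_le]; grind
  have h3 : cutoff x - cutoff y = -((min 1 ‖x‖ + min 1 ‖y‖) * (min 1 ‖x‖ - min 1 ‖y‖)) := by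
    unfold cutoff; ring
  rw [h3, abs_neg, abs_mul]
  gcongr

theorem abs_cutoff_le (x : ℂ) : |cutoff x| ≤ 1 := by
  have := norm_nonneg x
  rw [cutoff_eq_max, abs_le]
  constructor
  · have := le_max_left 0 (1 - ‖x‖ ^ 2); linarith
  · exact max_le (by norm_num) (by nlinarith)

/-- The right-hand side of the Ablowitz–Ladik equation, solved for the time derivative, with the
nonlinearity truncated outside the unit disc. -/
noncomputable def truncRHS (x y y' : ℂ) : ℂ :=
  2 * I * x - I * (cutoff x * (cclip y + cclip y'))

/-- Both factors of the truncated product are bounded and Lipschitz, so the product is globally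
Lipschitz. The largest coefficient, that of `‖x - u‖`, is `2 + 2 · 4`. -/
theorem norm_truncRHS_sub_le (x y y' u v v' : ℂ) :
    ‖truncRHS x y y' - truncRHS u v v'‖ ≤ 10 * (‖x - u‖ + ‖y - v‖ + ‖y' - v'‖) := by
  have h : truncRHS x y y' - truncRHS u v v' = 2 * I * (x - u)
      - I * ((cutoff x - cutoff u : ℝ) * (cclip y + cclip y')
        + cutoff u * ((cclip y - cclip v) + (cclip y' - cclip v'))) := by
    unfold truncRHS; push_cast; ring
  have h1 : ‖(cutoff x - cutoff u : ℝ) * (cclip y + cclip y')‖ ≤ (2 * ‖x - u‖) * (2 + 2) := by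
    rw [norm_mul, Complex.norm_real]
    have := (norm_add_le _ _).trans (add_le_add (norm_cclip_le y) (norm_cclip_le y'))
    have := abs_cutoff_sub_le x u
    rw [Real.norm_eq_abs]
    gcongr
  have h2 : ‖(cutoff u : ℂ) * ((cclip y - cclip v) + (cclip y' - cclip v'))‖
      ≤ 1 * (2 * ‖y - v‖ + 2 * ‖y' - v'‖) := by
    rw [norm_mul, Complex.norm_real]
    have := (norm_add_le _ _).trans (add_le_add (norm_cclip_sub_le y v) (norm_cclip_sub_le y' v'))
    have := abs_cutoff_le u
    rw [Real.norm_eq_abs]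
    gcongr
  rw [h]
  refine (norm_sub_le _ _).trans ?_
  have h3 := norm_add_le ((cutoff x - cutoff u : ℝ) * (cclip y + cclip y'))
    ((cutoff u : ℂ) * ((cclip y - cclip v) + (cclip y' - cclip v')))
  have h4 : ‖2 * I * (x - u)‖ = 2 * ‖x - u‖ := by simp
  rw [h4, norm_mul, Complex.norm_I, one_mul]
  have := norm_nonneg (y - v)
  have := norm_nonneg (y' - v')
  linarith

theorem truncRHS_zero : truncRHS 0 0 0 = 0 := by
  have : cclip 0 = 0 := cclip_of_norm_le (by simp)
  simp [truncRHS, this]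

/-- The truncated vector field in the weighted coordinates `w_n q_n`, as a sequence. -/
noncomputable def fieldFun (k : ℕ) (u : ℤ → ℂ) (n : ℤ) : ℂ :=
  weight k n * truncRHS (u n / weight k n) (u (n + 1) / weight k (n + 1))
    (u (n - 1) / weight k (n - 1))

theorem norm_fieldFun_sub_le (k : ℕ) (u v : ℤ → ℂ) (n : ℤ) :
    ‖fieldFun k u n - fieldFun k v n‖ ≤ 10 * √(3 ^ k) *
      (‖u n - v n‖ + ‖u (n + 1) - v (n + 1)‖ + ‖u (n - 1) - v (n - 1)‖) := by
  have hw := weight_pos k n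
  have key : ∀ m : ℤ, |m - n| ≤ 1 →
      weight k n * ‖u m / weight k m - v m / weight k m‖ ≤ √(3 ^ k) * ‖u m - v m‖ := by
    intro m hm
    have hw' := weight_pos k m
    rw [← sub_div, norm_div, Complex.norm_real, Real.norm_of_nonneg hw'.le, mul_div_assoc',
      div_le_iff₀ hw']
    have := mul_le_mul_of_nonneg_right (weight_le (k := k) hm) (norm_nonneg (u m - v m))
    linarith
  unfold fieldFun
  rw [← mul_sub, norm_mul, Complex.norm_real, Real.norm_of_nonneg hw.le]
  have h := mul_le_mul_of_nonneg_left (norm_truncRHS_sub_le (u n / weight k n)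
    (u (n + 1) / weight k (n + 1)) (u (n - 1) / weight k (n - 1)) (v n / weight k n)
    (v (n + 1) / weight k (n + 1)) (v (n - 1) / weight k (n - 1))) hw.le
  have h0 := key n (by simp)
  have h1 := key (n + 1) (by simp)
  have h2 := key (n - 1) (by simp)
  refine h.trans ?_
  linarith

theorem fieldFun_zero (k : ℕ) : fieldFun k 0 = 0 := by
  funext n; simp [fieldFun, truncRHS_zero]

/-- The truncated vector field on `l²` in the weighted coordinates. -/
noncomputable def field (k : ℕ) (u : L2Z) : L2Z :=
  ⟨fieldFun k u, memlp_two_iff.2 (summable_sq_and_tsum_le (hasSum_sq_norm u) (C := 10 * √(3 ^ k)) fun n => by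
    have := norm_fieldFun_sub_le k u 0 n
    simpa [fieldFun_zero] using this).1⟩

theorem field_apply (k : ℕ) (u : L2Z) (n : ℤ) : field k u n = fieldFun k u n := rfl

theorem field_zero (k : ℕ) : field k 0 = 0 := by
  ext n; exact congrFun (fieldFun_zero k) n

theorem lipschitzWith_field (k : ℕ) :
    LipschitzWith ⟨30 * √(3 ^ k), by positivity⟩ (field k) := by
  refine LipschitzWith.of_dist_le_mul fun u v => ?_
  have h := (summable_sq_and_tsum_le (x := ⇑(field k u - field k v)) (hasSum_sq_norm (u - v))
    (C := 10 * √(3 ^ k)) (fun n => norm_fieldFun_sub_le k u v n)).2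
  have h' := (hasSum_sq_norm (field k u - field k v)).tsum_eq
  rw [dist_eq_norm, dist_eq_norm]
  refine abs_le_of_sq_le_sq' ?_ (mul_nonneg (NNReal.coe_nonneg _) (norm_nonneg _)) |>.2
  rw [← h']
  refine h.trans (le_of_eq ?_)
  change _ = (30 * √(3 ^ k) * ‖u - v‖) ^ 2
  ring

/-- The truncated system has global solutions in the weighted space. -/
theorem exists_trunc_solution {k : ℕ} {q₀ : ℤ → ℂ} (hq₀ : MemL2k k q₀) :
    ∃ u : ℝ → L2Z, Continuous u ∧ (∀ n, u 0 n / weight k n = q₀ n) ∧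
      ∀ t n, HasDerivAt (fun s => u s n / weight k n)
        (truncRHS (u t n / weight k n) (u t (n + 1) / weight k (n + 1))
          (u t (n - 1) / weight k (n - 1))) t := by
  have hw : ∀ n, (weight k n : ℂ) ≠ 0 := fun n => by
    exact_mod_cast (weight_pos k n).ne'
  let u₀ : L2Z := ⟨fun n => weight k n * q₀ n, memlp_two_iff.2 (by
    refine hq₀.congr fun n => ?_
    rw [norm_mul, mul_pow, Complex.norm_real, Real.norm_of_nonneg (weight_pos k n).le,
      weight_sq])⟩
  obtain ⟨u, hu0, hu⟩ := exists_global_integralCurve (lipschitzWith_field k) (field_zero k) u₀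
  refine ⟨u, continuous_iff_continuousAt.2 fun t => (hu t).continuousAt, fun n => ?_,
    fun t n => ?_⟩
  · rw [hu0]
    change (weight k n : ℂ) * q₀ n / weight k n = q₀ n
    field_simp [hw n]
  · have h1 : HasDerivAt (fun s => u s n) (field k (u t) n) t :=
      ((lp.evalCLM ℝ (fun _ : ℤ => ℂ) 2 n).hasFDerivAt.comp_hasDerivAt t (hu t))
    refine (h1.div_const _).congr_deriv ?_
    rw [field_apply, fieldFun, mul_div_cancel_left₀ _ (hw n)]

/-! ### Invariance of the unit disc and existence of solutions. -/

theorem pos_of_hasDerivAt_max {v g : ℝ → ℝ} {C : ℝ} (hg : ∀ t, |g t| ≤ C)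
    (hv : ∀ t, HasDerivAt v (-(max 0 (v t) * g t)) t) (h0 : 0 < v 0) (t : ℝ) : 0 < v t := by
  by_contra! ht
  have hcont : Continuous v := continuous_iff_continuousAt.2 fun t => (hv t).continuousAt
  obtain ⟨s, hs⟩ : ∃ s, v s = 0 := mem_range_of_exists_le_of_exists_ge hcont ⟨t, ht⟩ ⟨0, h0.le⟩
  have hC : 0 ≤ C := (abs_nonneg _).trans (hg 0)
  -- Zero is a solution of the same Lipschitz equation. A curve that touches it at time `s`
  -- coincides with it for all times, contrary to `0 < v 0`.
  have huniq := ODE_solution_unique_univ (f := v) (g := fun _ => (0 : ℝ)) (t₀ := s)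
    (v := fun t y => -(max 0 y * g t)) (s := fun _ => Set.univ) (K := ⟨C, hC⟩)
    (fun t => LipschitzWith.lipschitzOnWith (LipschitzWith.of_dist_le_mul fun x y => ?_))
    (fun t => ⟨hv t, trivial⟩) (fun t => ⟨by simpa using hasDerivAt_const t (0 : ℝ), trivial⟩) hs
  · exact h0.ne' (congrFun huniq 0)
  · rw [Real.dist_eq, Real.dist_eq]
    have h1 : -(max 0 x * g t) - -(max 0 y * g t) = -((max 0 x - max 0 y) * g t) := by ring
    rw [h1, abs_neg, abs_mul, mul_comm]
    have h2 : |max 0 x - max 0 y| ≤ |x - y| := by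
      have := abs_max_sub_max_le_max 0 x 0 y
      simpa using this
    change _ ≤ C * |x - y|
    exact mul_le_mul (hg t) h2 (abs_nonneg _) hC

/-- The rotation `2i q_n` does not change `|q_n|`, and the coupling is multiplied by `cutoff = max 0
(1 - |q_n|²)`. Thus `v = 1 - |q_n|²` satisfies `v' = -max(0, v) g` with bounded `g` and cannot reach
zero. -/
theorem norm_lt_one_of_trunc {q : ℝ → ℤ → ℂ}
    (hq : ∀ t n, HasDerivAt (fun s => q s n) (truncRHS (q t n) (q t (n + 1)) (q t (n - 1))) t)
    {n : ℤ} (h0 : ‖q 0 n‖ < 1) (t : ℝ) : ‖q t n‖ < 1 := by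
  let S : ℝ → ℂ := fun t => cclip (q t (n + 1)) + cclip (q t (n - 1))
  have hS : ∀ t, ‖S t‖ ≤ 4 := fun t =>
    (norm_add_le _ _).trans (by linarith [norm_cclip_le (q t (n + 1)), norm_cclip_le (q t (n - 1))])
  let g : ℝ → ℝ := fun t => -2 * (I * (starRingEnd ℂ) (cclip (q t n)) * S t).re
  have hpos := pos_of_hasDerivAt_max (v := fun t => 1 - ‖q t n‖ ^ 2) (g := g) (C := 16)
    (fun t => ?_) (fun t => ?_) ?_ t
  · have : ‖q t n‖ ^ 2 < 1 := by linarith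
    nlinarith [norm_nonneg (q t n)]
  · have h1 := Complex.abs_re_le_norm (I * (starRingEnd ℂ) (cclip (q t n)) * S t)
    have h2 : ‖I * (starRingEnd ℂ) (cclip (q t n)) * S t‖ ≤ 2 * 4 := by
      rw [norm_mul, norm_mul, Complex.norm_I, one_mul, RCLike.norm_conj]
      exact mul_le_mul (norm_cclip_le _) (hS t) (norm_nonneg _) (by norm_num)
    simp only [g]
    rw [abs_mul, abs_neg, abs_two]
    linarith
  · have h1 := ((hq t n).norm_sq).const_sub 1
    refine h1.congr_deriv ?_
    -- Clipping changes `q t n` only where the cutoff vanishes. Replacing it by its clipped value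
    -- keeps `g` bounded without any a priori bound on `q`.
    have h2 : (cutoff (q t n) : ℂ) * (starRingEnd ℂ) (q t n)
        = cutoff (q t n) * (starRingEnd ℂ) (cclip (q t n)) := by
      rcases le_total ‖q t n‖ 1 with h | h
      · rw [cclip_of_norm_le h]
      · have : cutoff (q t n) = 0 := by
          rw [cutoff, min_eq_left h]; norm_num
        simp [this]
    rw [← cutoff_eq_max]
    simp only [g]
    have h3 : inner ℝ (q t n) (truncRHS (q t n) (q t (n + 1)) (q t (n - 1)))
        = -(cutoff (q t n) * (I * (starRingEnd ℂ) (cclip (q t n)) * S t).re) := by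
      rw [Complex.inner, ← Complex.re_ofReal_mul, ← Complex.neg_re]
      have h4 : truncRHS (q t n) (q t (n + 1)) (q t (n - 1)) * (starRingEnd ℂ) (q t n)
          = 2 * I * (q t n * (starRingEnd ℂ) (q t n))
            - I * S t * (cutoff (q t n) * (starRingEnd ℂ) (q t n)) := by
        unfold truncRHS; simp only [S]; ring
      rw [mul_comm, mul_comm] at *
      rw [h4, h2, Complex.mul_conj]
      rw [Complex.sub_re]
      have h5 : (2 * I * ((Complex.normSq (q t n) : ℝ) : ℂ)).re = 0 := by simp
      rw [h5, zero_sub, ← Complex.neg_re]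
      congr 1
      ring
    rw [h3]
    ring
  · have := norm_nonneg (q 0 n)
    change 0 < 1 - ‖q 0 n‖ ^ 2
    nlinarith

/-- The a priori bounds on a time slice that the scattering theory needs: decay of order one and
summability. -/
def DecayBound (q : ℤ → ℂ) (C : ℝ) : Prop :=
  (∀ n : ℤ, ‖q n‖ * √(1 + (n : ℝ) ^ 2) ≤ C) ∧ (Summable fun n => ‖q n‖) ∧ ∑' n, ‖q n‖ ≤ C

/-- Summability rests on `2‖q n‖ ≤ (1 + n²)‖q n‖² + (1 + n²)⁻¹`, where `k ≥ 1` controls the first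
term. The pointwise bound comes from a single term of the sum. -/
theorem decayBound_of_hasSum {k : ℕ} (hk : 1 ≤ k) {q : ℤ → ℂ} {A : ℝ}
    (h : HasSum (fun n : ℤ => weight k n ^ 2 * ‖q n‖ ^ 2) A) :
    DecayBound q (1 + A + ∑' n : ℤ, (1 + (n : ℝ) ^ 2)⁻¹) := by
  have hA : 0 ≤ A := h.nonneg fun n => by positivity
  have hZ := summable_inv_one_add_sq
  have hZ0 : 0 ≤ ∑' n : ℤ, (1 + (n : ℝ) ^ 2)⁻¹ := tsum_nonneg fun n => by positivity
  have hn : ∀ n : ℤ, ‖q n‖ ^ 2 * (1 + (n : ℝ) ^ 2) ≤ weight k n ^ 2 * ‖q n‖ ^ 2 := fun n => by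
    rw [mul_comm]
    exact mul_le_mul_of_nonneg_right (one_add_sq_le_weight_sq hk n) (sq_nonneg _)
  have hle : ∀ n : ℤ, ‖q n‖ ≤ weight k n ^ 2 * ‖q n‖ ^ 2 + (1 + (n : ℝ) ^ 2)⁻¹ := fun n => by
    have h1 := hn n
    have h2 : 0 < 1 + (n : ℝ) ^ 2 := by positivity
    have h3 : (‖q n‖ ^ 2 * (1 + (n : ℝ) ^ 2)) + (1 + (n : ℝ) ^ 2)⁻¹ - 2 * ‖q n‖
        = (‖q n‖ * (1 + (n : ℝ) ^ 2) - 1) ^ 2 * (1 + (n : ℝ) ^ 2)⁻¹ := by field_simp; ring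
    have h4 : 0 ≤ (‖q n‖ * (1 + (n : ℝ) ^ 2) - 1) ^ 2 * (1 + (n : ℝ) ^ 2)⁻¹ := by positivity
    have := norm_nonneg (q n)
    linarith
  have hs := h.summable.add hZ
  have hqs := Summable.of_nonneg_of_le (fun n => norm_nonneg _) hle hs
  refine ⟨fun n => ?_, hqs, ?_⟩
  · have h1 := (hn n).trans (le_hasSum h n fun j _ => by positivity)
    have h2 : (‖q n‖ * √(1 + (n : ℝ) ^ 2)) ^ 2 ≤ A := by
      rw [mul_pow, Real.sq_sqrt (by positivity)]; exact h1
    nlinarith [sq_nonneg (‖q n‖ * √(1 + (n : ℝ) ^ 2) - 1)]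
  · have := hqs.tsum_le_tsum hle hs
    rw [h.summable.tsum_add hZ, h.tsum_eq] at this
    linarith

theorem supNormLtOne_of_summable {q : ℤ → ℂ} (hs : Summable fun n => ‖q n‖) (h : ∀ n, ‖q n‖ < 1) :
    SupNormLtOne q := by
  have hev : ∀ᶠ n in cofinite, ‖q n‖ < 1 / 2 :=
    hs.tendsto_cofinite_zero.eventually (gt_mem_nhds (by norm_num))
  rw [eventually_cofinite] at hev
  obtain ⟨ρ, hρ1, hρ⟩ : ∃ ρ : ℝ, ρ < 1 ∧ ∀ n ∈ hev.toFinset, ‖q n‖ ≤ ρ := by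
    induction hev.toFinset using Finset.induction_on with
    | empty => exact ⟨0, by norm_num, by simp⟩
    | insert a s _ ih =>
      obtain ⟨ρ, h1, h2⟩ := ih
      refine ⟨max ρ ‖q a‖, max_lt h1 (h a), fun n hn => ?_⟩
      rcases Finset.mem_insert.1 hn with rfl | hn
      · exact le_max_right _ _
      · exact (h2 n hn).trans (le_max_left _ _)
  refine ⟨max ρ (1 / 2), max_lt hρ1 (by norm_num), fun n => ?_⟩
  by_cases hn : ‖q n‖ < 1 / 2
  · exact hn.le.trans (le_max_right _ _)
  · exact (hρ n (by simpa using hn)).trans (le_max_left _ _)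

theorem exists_solution {k : ℕ} (hk : 1 ≤ k) {q₀ : ℤ → ℂ} (hq₀ : MemL2k k q₀)
    (hsup : SupNormLtOne q₀) :
    ∃ q : ℝ → ℤ → ℂ, IsSolution q₀ q ∧ (∀ t, MemL2k k (q t)) ∧ (∀ t, SupNormLtOne (q t)) ∧
      ∀ T : ℝ, ∃ C, ∀ t, |t| ≤ T → DecayBound (q t) C := by
  obtain ⟨u, huc, hu0, hu⟩ := exists_trunc_solution hq₀
  let q : ℝ → ℤ → ℂ := fun t n => u t n / weight k n
  have hq0 : q 0 = q₀ := funext hu0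
  have hq : ∀ t n, HasDerivAt (fun s => q s n) (truncRHS (q t n) (q t (n + 1)) (q t (n - 1))) t := hu
  have hlt : ∀ t n, ‖q t n‖ < 1 := fun t n => by
    refine norm_lt_one_of_trunc hq ?_ t
    obtain ⟨ρ, h1, h2⟩ := hsup
    rw [hq0]
    exact (h2 n).trans_lt h1
  have hsum : ∀ t, HasSum (fun n : ℤ => weight k n ^ 2 * ‖q t n‖ ^ 2) (‖u t‖ ^ 2) := fun t => by
    convert hasSum_sq_norm (u t) using 2 with n
    have := (weight_pos k n).ne'
    simp only [q]
    rw [norm_div, Complex.norm_real, Real.norm_of_nonneg (weight_pos k n).le]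
    field_simp
  have hdec := fun t => decayBound_of_hasSum hk (hsum t)
  refine ⟨q, ⟨hq0, fun t n => ⟨(hq t n).differentiableAt, ?_⟩, fun T => ⟨1, fun t _ n =>
    (hlt t n).le⟩⟩, fun t => ?_, fun t => supNormLtOne_of_summable (hdec t).2.1 (hlt t), fun T => ?_⟩
  · rw [(hq t n).deriv, truncRHS, cclip_of_norm_le (hlt t _).le, cclip_of_norm_le (hlt t _).le,
      cutoff, min_eq_right (hlt t n).le]
    push_cast
    linear_combination (2 * q t n - (1 - (‖q t n‖ : ℂ) ^ 2) * (q t (n + 1) + q t (n - 1)))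
      * Complex.I_sq
  · refine (hsum t).summable.congr fun n => ?_
    rw [weight_sq]
  · obtain ⟨A, hA⟩ := (isCompact_Icc (a := -T) (b := T)).exists_bound_of_continuousOn
      (f := u) huc.continuousOn
    refine ⟨1 + A ^ 2 + ∑' n : ℤ, (1 + (n : ℝ) ^ 2)⁻¹, fun t ht => ?_⟩
    have h1 : ‖u t‖ ^ 2 ≤ A ^ 2 := pow_le_pow_left₀ (norm_nonneg _) (hA t (abs_le.1 ht)) 2
    obtain ⟨ha, hb, hc⟩ := hdec t
    exact ⟨fun n => (ha n).trans (by linarith), hb, hc.trans (by linarith)⟩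

/-! ### Uniqueness of bounded solutions. -/

theorem IsSolution.hasDerivAt {q₀ : ℤ → ℂ} {q : ℝ → ℤ → ℂ} (h : IsSolution q₀ q) (t : ℝ) (n : ℤ) :
    HasDerivAt (fun s => q s n) (-I * (q t (n + 1) - 2 * q t n + q t (n - 1)
        - ((‖q t n‖ ^ 2 : ℝ) : ℂ) * (q t (n + 1) + q t (n - 1)))) t := by
  obtain ⟨h1, h2⟩ := h.2.1 t n
  refine h1.hasDerivAt.congr_deriv ?_
  rw [← h2]
  linear_combination (deriv (fun s => q s n) t) * Complex.I_sq

theorem norm_rhs_sub_le {C D : ℝ} {x y y' u v v' : ℂ} (hx : ‖x‖ ≤ C) (hy : ‖y‖ ≤ C)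
    (hy' : ‖y'‖ ≤ C) (hu : ‖u‖ ≤ C) (h1 : ‖x - u‖ ≤ D)
    (h2 : ‖y - v‖ ≤ D) (h3 : ‖y' - v'‖ ≤ D) :
    ‖-I * (y - 2 * x + y' - ((‖x‖ ^ 2 : ℝ) : ℂ) * (y + y'))
      - -I * (v - 2 * u + v' - ((‖u‖ ^ 2 : ℝ) : ℂ) * (v + v'))‖ ≤ (4 + 6 * C ^ 2) * D := by
  have hC : 0 ≤ C := (norm_nonneg _).trans hx
  have hD : 0 ≤ D := (norm_nonneg _).trans h1
  have h : -I * (y - 2 * x + y' - ((‖x‖ ^ 2 : ℝ) : ℂ) * (y + y'))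
      - -I * (v - 2 * u + v' - ((‖u‖ ^ 2 : ℝ) : ℂ) * (v + v'))
      = -I * ((((y - v) + (y' - v')) - 2 * (x - u))
        - ((((‖x‖ + ‖u‖) * (‖x‖ - ‖u‖) : ℝ) : ℂ) * (y + y')
        + ((‖u‖ ^ 2 : ℝ) : ℂ) * ((y - v) + (y' - v')))) := by
    push_cast; ring
  have e1 : ‖((y - v) + (y' - v')) - 2 * (x - u)‖ ≤ (D + D) + 2 * D := by
    refine (norm_sub_le _ _).trans (add_le_add ((norm_add_le _ _).trans (add_le_add h2 h3)) ?_)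
    rw [norm_mul]; norm_num; exact h1
  have e2 : ‖(((‖x‖ + ‖u‖) * (‖x‖ - ‖u‖) : ℝ) : ℂ) * (y + y')‖ ≤ ((C + C) * D) * (C + C) := by
    rw [norm_mul, Complex.norm_real, norm_mul]
    refine mul_le_mul (mul_le_mul ?_ ?_ (norm_nonneg _) (by linarith))
      ((norm_add_le _ _).trans (add_le_add hy hy')) (norm_nonneg _) (by positivity)
    · rw [Real.norm_of_nonneg (by positivity)]; linarith
    · exact (abs_norm_sub_norm_le x u).trans h1
  have e3 : ‖((‖u‖ ^ 2 : ℝ) : ℂ) * ((y - v) + (y' - v'))‖ ≤ C ^ 2 * (D + D) := by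
    rw [norm_mul, Complex.norm_real, Real.norm_of_nonneg (by positivity)]
    exact mul_le_mul (pow_le_pow_left₀ (norm_nonneg _) hu 2)
      ((norm_add_le _ _).trans (add_le_add h2 h3)) (norm_nonneg _) (by positivity)
  rw [h, norm_mul, norm_neg, Complex.norm_I, one_mul]
  refine (norm_sub_le _ _).trans ?_
  have := norm_add_le ((((‖x‖ + ‖u‖) * (‖x‖ - ‖u‖) : ℝ) : ℂ) * (y + y'))
    (((‖u‖ ^ 2 : ℝ) : ℂ) * ((y - v) + (y' - v')))
  nlinarith

/-- No decay is required: on `[-T, T]` both solutions are bounded by one `C`, and the right-hand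
sides differ by at most `L = 4 + 6C²` times the sup-norm difference. Estimating site by site avoids
differentiating a supremum. -/
theorem IsSolution.unique {q₀ : ℤ → ℂ} {p q : ℝ → ℤ → ℂ} (hp : IsSolution q₀ p)
    (hq : IsSolution q₀ q) : p = q := by
  suffices h : ∀ T > 0, ∀ t, |t| ≤ T → ∀ n, p t n = q t n by
    funext t n
    exact h (|t| + 1) (by positivity) t (by linarith) n
  intro T hT
  obtain ⟨C₁, hC₁⟩ := hp.2.2 T
  obtain ⟨C₂, hC₂⟩ := hq.2.2 T
  set C := max C₁ C₂
  have hpC : ∀ t, |t| ≤ T → ∀ n, ‖p t n‖ ≤ C := fun t ht n => (hC₁ t ht n).trans (le_max_left _ _)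
  have hqC : ∀ t, |t| ≤ T → ∀ n, ‖q t n‖ ≤ C := fun t ht n => (hC₂ t ht n).trans (le_max_right _ _)
  have hC : 0 ≤ C := (norm_nonneg _).trans (hpC 0 (by simpa using hT.le) 0)
  set L := 4 + 6 * C ^ 2 with hL
  have hLpos : 0 < L := by positivity
  -- With `L τ = 1/2`, each use of the mean value inequality halves the bound on the difference over
  -- a time interval of radius `τ`.
  set τ := 1 / (2 * L) with hτ
  have hτpos : 0 < τ := by positivity
  have hstep : ∀ t₀, |t₀| ≤ T → (∀ n, p t₀ n = q t₀ n) → ∀ t, |t| ≤ T → |t - t₀| ≤ τ →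
      ∀ n, p t n = q t n := by
    intro t₀ ht₀ h0
    have hb : ∀ j : ℕ, ∀ t, |t| ≤ T → |t - t₀| ≤ τ → ∀ n, ‖p t n - q t n‖ ≤ 2 * C * (1 / 2) ^ j := by
      intro j
      induction j with
      | zero =>
        intro t ht _ n
        have := (norm_sub_le (p t n) (q t n)).trans (add_le_add (hpC t ht n) (hqC t ht n))
        linarith
      | succ j ih =>
        intro t ht htτ n
        have hconv : Convex ℝ (Set.Icc (-T) T ∩ Set.Icc (t₀ - τ) (t₀ + τ)) :=
          (convex_Icc _ _).inter (convex_Icc _ _)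
        have hmem : ∀ s, s ∈ Set.Icc (-T) T ∩ Set.Icc (t₀ - τ) (t₀ + τ) ↔
            |s| ≤ T ∧ |s - t₀| ≤ τ := by
          intro s
          rw [abs_le, abs_le]
          simp only [Set.mem_inter_iff, Set.mem_Icc]
          constructor <;> rintro ⟨⟨_, _⟩, _, _⟩ <;> refine ⟨⟨?_, ?_⟩, ?_, ?_⟩ <;> linarith
        have := hconv.norm_image_sub_le_of_norm_hasDerivWithin_le
          (f := fun s => p s n - q s n) (C := L * (2 * C * (1 / 2) ^ j)) (x := t₀) (y := t)
          (fun s _ => ((hp.hasDerivAt s n).sub (hq.hasDerivAt s n)).hasDerivWithinAt)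
          (fun s hs => by
            have hs' := (hmem s).1 hs
            exact norm_rhs_sub_le (hpC s hs'.1 _) (hpC s hs'.1 _) (hpC s hs'.1 _) (hqC s hs'.1 _)
              (ih s hs'.1 hs'.2 _) (ih s hs'.1 hs'.2 _) (ih s hs'.1 hs'.2 _))
          ((hmem t₀).2 ⟨ht₀, by simpa using hτpos.le⟩) ((hmem t).2 ⟨ht, htτ⟩)
        rw [h0 n, sub_self, sub_zero, Real.norm_eq_abs] at this
        refine this.trans ?_
        calc _ ≤ L * (2 * C * (1 / 2) ^ j) * τ := by gcongr
          _ = _ := by rw [hτ, pow_succ]; field_simp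
    intro t ht htτ n
    have hlim : Tendsto (fun j : ℕ => 2 * C * (1 / 2 : ℝ) ^ j) atTop (𝓝 (2 * C * 0)) :=
      (tendsto_pow_atTop_nhds_zero_of_lt_one (by norm_num) (by norm_num)).const_mul _
    have := ge_of_tendsto' hlim fun j => hb j t ht htτ n
    rw [mul_zero] at this
    exact sub_eq_zero.1 (norm_le_zero_iff.1 this)
  -- The intermediate time for `t` is `t · j / (j + 1)`: it is nearer to `0`, hence still in `[-T,
  -- T]`, and lies within `|t| / (j + 1) ≤ τ` of `t`.
  have hall : ∀ j : ℕ, ∀ t, |t| ≤ T → |t| ≤ j * τ → ∀ n, p t n = q t n := by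
    intro j
    induction j with
    | zero =>
      intro t _ ht n
      have : t = 0 := by simpa using ht
      rw [this, hp.1, hq.1]
    | succ j ih =>
      intro t ht htj
      have hj : (0 : ℝ) < j + 1 := by positivity
      have habs : |t * (j / (j + 1))| = |t| * (j / (j + 1)) := by
        rw [abs_mul, abs_of_nonneg (a := (j : ℝ) / (j + 1)) (by positivity)]
      have hfrac : (j : ℝ) / (j + 1) ≤ 1 := by rw [div_le_one hj]; linarith
      have h1 : |t * (j / (j + 1))| ≤ T := by
        rw [habs]; exact (mul_le_of_le_one_right (abs_nonneg _) hfrac).trans ht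
      push_cast at htj
      refine hstep (t * (j / (j + 1))) h1 (ih _ h1 ?_) t ht ?_
      · rw [habs, mul_div_assoc', div_le_iff₀ hj]
        nlinarith [Nat.cast_nonneg (α := ℝ) j]
      · have h2 : t - t * (j / (j + 1)) = t / (j + 1) := by field_simp; ring
        rw [h2, abs_div, abs_of_pos hj, div_le_iff₀ hj]
        linarith
  intro t ht
  obtain ⟨j, hj⟩ := exists_nat_ge (|t| / τ)
  exact hall j t ht ((div_le_iff₀ hτpos).1 hj)

/-! ### Transfer matrices, uniqueness of scattering data and the bound on `r`. -/

theorem circlePt_ne_zero (θ : ℝ) : circlePt θ ≠ 0 := Complex.exp_ne_zero _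

theorem norm_circlePt (θ : ℝ) : ‖circlePt θ‖ = 1 := Complex.norm_exp_ofReal_mul_I θ

theorem conj_zpow_of_norm_one {z : ℂ} (hz : ‖z‖ = 1) (n : ℤ) :
    (starRingEnd ℂ) (z ^ n) = z ^ (-n) := by
  rw [map_zpow₀, zpow_neg, ← inv_zpow, Complex.inv_eq_conj hz]

/-- The Lax matrix in the interaction picture. -/
noncomputable def stepMat (q : ℤ → ℂ) (z : ℂ) (j : ℤ) : Matrix (Fin 2) (Fin 2) ℂ :=
  !![1, q j * z ^ (-(2 * j + 1)); (starRingEnd ℂ) (q j) * z ^ (2 * j + 1), 1]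

theorem stepMat_mul_zPow (q : ℤ → ℂ) {z : ℂ} (hz : z ≠ 0) (j : ℤ) :
    stepMat q z j * zPow z (-j) = zPow z (-(j + 1)) * laxMatrix (q j) z := by
  ext a b
  fin_cases a <;> fin_cases b <;>
    simp [zPow, laxMatrix, stepMat, Matrix.mul_apply, Fin.sum_univ_two]
  · rw [zpow_add₀ hz]; field_simp; rw [← zpow_add₀ hz]; simp
  · rw [mul_assoc, ← zpow_add₀ hz, mul_comm]; congr 2; ring
  · rw [mul_assoc, ← zpow_neg, ← zpow_add₀ hz, mul_comm]; congr 2; ring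
  · rw [zpow_add₀ hz]; field_simp

/-- The ordered product of `n` consecutive step matrices, beginning at site `m`. -/
noncomputable def transfer (q : ℤ → ℂ) (z : ℂ) (m : ℤ) : ℕ → Matrix (Fin 2) (Fin 2) ℂ
  | 0 => 1
  | n + 1 => stepMat q z (m + n) * transfer q z m n

theorem transfer_mul {q : ℤ → ℂ} {z : ℂ} (hz : z ≠ 0) {X : ℤ → Matrix (Fin 2) (Fin 2) ℂ}
    (hX : ∀ n, X (n + 1) = laxMatrix (q n) z * X n) (m : ℤ) (n : ℕ) :
    transfer q z m n * (zPow z (-m) * X m) = zPow z (-(m + n)) * X (m + n) := by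
  induction n with
  | zero => simp [transfer]
  | succ n ih =>
    rw [transfer, Matrix.mul_assoc, ih, ← Matrix.mul_assoc, stepMat_mul_zPow q hz,
      Matrix.mul_assoc, ← hX]
    push_cast
    rw [add_assoc]

/-- The transfer matrix from `-N` to `N`. -/
noncomputable def fullTransfer (q : ℤ → ℂ) (z : ℂ) (N : ℕ) : Matrix (Fin 2) (Fin 2) ℂ :=
  transfer q z (-N) (2 * N)

/-- The product from `-N` to `N` carries `K N = z^{Nσ₃} X⁻(-N)`, which tends to `I`, to `z^{-Nσ₃}
X⁻(N) = (z^{-Nσ₃} X⁺(N)) S`, which tends to `S`. Hence `S` is determined by the potential, whichever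
Jost solutions were used to produce it. -/
theorem IsScatteringMatrix.tendsto {q : ℤ → ℂ} {z : ℂ} {S : Matrix (Fin 2) (Fin 2) ℂ}
    (h : IsScatteringMatrix q z S) (hz : z ≠ 0) :
    Tendsto (fullTransfer q z) atTop (𝓝 S) := by
  obtain ⟨Xp, Xm, ⟨_, hp⟩, ⟨hm, hm'⟩, hS⟩ := h
  have hN : Tendsto (fun N : ℕ => (N : ℤ)) atTop atTop := tendsto_natCast_atTop_atTop
  have hK := hm'.comp (tendsto_neg_atTop_atBot.comp hN)
  have hR := (hp.comp hN).mul_const S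
  rw [Matrix.one_mul] at hR
  set K : ℕ → Matrix (Fin 2) (Fin 2) ℂ := fun N => zPow z (-(-(N : ℤ))) * Xm (-N) with hKdef
  have hK' : Tendsto K atTop (𝓝 1) := hK
  have hdet : Tendsto (fun N => (K N).det) atTop (𝓝 1) := by
    have := ((continuous_id (X := Matrix (Fin 2) (Fin 2) ℂ)).matrix_det.tendsto 1).comp hK'
    simpa [Function.comp_def] using this
  have hadj : Tendsto (fun N => (K N).adjugate) atTop (𝓝 1) := by
    have := ((continuous_id (X := Matrix (Fin 2) (Fin 2) ℂ)).matrix_adjugate.tendsto 1).comp hK'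
    simpa [Function.comp_def] using this
  have hlim := (hdet.inv₀ one_ne_zero).smul (hR.mul hadj)
  rw [inv_one, one_smul, Matrix.mul_one] at hlim
  refine hlim.congr' ?_
  filter_upwards [hdet.eventually_ne one_ne_zero] with N hN0
  have h1 : fullTransfer q z N * K N = zPow z (-(N : ℤ)) * Xm N := by
    have := transfer_mul hz hm (-N) (2 * N)
    push_cast at this
    rw [show -(N : ℤ) + 2 * N = N by ring] at this
    exact this
  have h2 : (zPow z (-(N : ℤ)) * Xp N) * S = fullTransfer q z N * K N := by
    rw [h1, hS, Matrix.mul_assoc]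
  simp only [Function.comp]
  rw [h2, Matrix.mul_assoc, Matrix.mul_adjugate, Matrix.mul_smul, Matrix.mul_one, smul_smul,
    inv_mul_cancel₀ hN0, one_smul]

theorem IsScatteringMatrix.unique {q : ℤ → ℂ} {z : ℂ} {S S' : Matrix (Fin 2) (Fin 2) ℂ}
    (h : IsScatteringMatrix q z S) (h' : IsScatteringMatrix q z S') (hz : z ≠ 0) : S = S' :=
  tendsto_nhds_unique (h.tendsto hz) (h'.tendsto hz)

theorem IsReflectionCoeff.unique {q : ℤ → ℂ} {r r' : ℝ → ℂ} (h : IsReflectionCoeff q r)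
    (h' : IsReflectionCoeff q r') : r = r' := by
  funext θ
  obtain ⟨S, hS, _, hr⟩ := h θ
  obtain ⟨S', hS', _, hr'⟩ := h' θ
  rw [hr, hr', hS.unique hS' (circlePt_ne_zero θ)]

section Circle

variable (q : ℤ → ℂ) {z : ℂ} (hz : ‖z‖ = 1) (m : ℤ)
include hz

/-- On the circle each step matrix has the form `[[α, conj β], [β, conj α]]`, and this form is
closed under products. The first column therefore determines the matrix. -/
theorem transfer_conj (n : ℕ) :
    transfer q z m n 0 1 = (starRingEnd ℂ) (transfer q z m n 1 0) ∧
    transfer q z m n 1 1 = (starRingEnd ℂ) (transfer q z m n 0 0) := by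
  induction n with
  | zero => simp [transfer]
  | succ n ih =>
    simp only [transfer, stepMat, Matrix.mul_apply, Fin.sum_univ_two, Matrix.of_apply,
      Matrix.cons_val', Matrix.cons_val_zero, Matrix.cons_val_one, Matrix.cons_val_fin_one,
      ih.1, ih.2, map_add, map_mul, Complex.conj_conj, conj_zpow_of_norm_one hz, neg_neg, map_one]
    constructor <;> ring

/-- By the conjugation symmetry the left side is the determinant of the product, and each step has
determinant `1 - ‖q j‖²`. -/
theorem transfer_normSq_sub (n : ℕ) :
    ‖transfer q z m n 0 0‖ ^ 2 - ‖transfer q z m n 1 0‖ ^ 2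
      = ∏ j ∈ Finset.range n, (1 - ‖q (m + j)‖ ^ 2) := by
  induction n with
  | zero => simp [transfer]
  | succ n ih =>
    rw [Finset.prod_range_succ, ← ih]
    have hz0 : z ≠ 0 := by rintro rfl; simp at hz
    have hzz : z ^ (2 * (m + (n : ℤ)) + 1) ≠ 0 := zpow_ne_zero _ hz0
    have key : ∀ x : ℂ, ((‖x‖ ^ 2 : ℝ) : ℂ) = x * (starRingEnd ℂ) x := fun x => by
      rw [Complex.mul_conj, Complex.normSq_eq_norm_sq]
    rw [← Complex.ofReal_inj]
    push_cast [key]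
    simp only [transfer, stepMat, Matrix.mul_apply, Fin.sum_univ_two, Matrix.of_apply,
      Matrix.cons_val', Matrix.cons_val_zero, Matrix.cons_val_one, Matrix.cons_val_fin_one,
      map_add, map_mul, Complex.conj_conj, conj_zpow_of_norm_one hz, map_one]
    simp only [zpow_neg]
    field_simp
    ring

theorem norm_transfer_le (n : ℕ) :
    ‖transfer q z m n 0 0‖ ≤ Real.exp (∑ j ∈ Finset.range n, ‖q (m + j)‖) ∧
    ‖transfer q z m n 1 0‖ ≤ Real.exp (∑ j ∈ Finset.range n, ‖q (m + j)‖) := by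
  induction n with
  | zero => simp [transfer]
  | succ n ih =>
    rw [Finset.sum_range_succ, Real.exp_add]
    set A := Real.exp (∑ j ∈ Finset.range n, ‖q (m + j)‖) with hA
    have hA0 : 0 < A := Real.exp_pos _
    have h1 := Real.add_one_le_exp ‖q (m + n)‖
    have hn : ∀ e : ℤ, ‖z ^ e‖ = 1 := fun e => by rw [norm_zpow, hz, one_zpow]
    have h2 : A + ‖q (m + n)‖ * A ≤ A * Real.exp ‖q (m + n)‖ := by nlinarith
    constructor
    · simp only [transfer, stepMat, Matrix.mul_apply, Fin.sum_univ_two, Matrix.of_apply,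
        Matrix.cons_val', Matrix.cons_val_zero, Matrix.cons_val_one, Matrix.cons_val_fin_one]
      refine (norm_add_le _ _).trans (le_trans ?_ h2)
      rw [norm_mul, norm_mul, norm_mul, norm_one, one_mul, hn, mul_one]
      exact add_le_add ih.1 (mul_le_mul_of_nonneg_left ih.2 (norm_nonneg _))
    · simp only [transfer, stepMat, Matrix.mul_apply, Fin.sum_univ_two, Matrix.of_apply,
        Matrix.cons_val', Matrix.cons_val_zero, Matrix.cons_val_one, Matrix.cons_val_fin_one]
      refine (norm_add_le _ _).trans (le_trans ?_ h2)
      rw [norm_mul, norm_mul, norm_mul, norm_one, one_mul, hn, mul_one, RCLike.norm_conj, add_comm]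
      exact add_le_add ih.2 (mul_le_mul_of_nonneg_left ih.1 (norm_nonneg _))

end Circle

theorem sum_range_norm_le {q : ℤ → ℂ} (hs : Summable fun n => ‖q n‖) (m : ℤ) (n : ℕ) :
    ∑ j ∈ Finset.range n, ‖q (m + j)‖ ≤ ∑' n, ‖q n‖ := by
  have hinj : Function.Injective fun j : ℕ => m + (j : ℤ) := fun a b h => by simpa using h
  rw [← Finset.sum_image (f := fun n => ‖q n‖) (g := fun j : ℕ => m + (j : ℤ)) hinj.injOn]
  exact hs.sum_le_tsum _ fun _ _ => norm_nonneg _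

/-- A lower bound for all finite products `∏ (1 - |q_j|²)`. -/
theorem exists_pos_le_prod {q : ℤ → ℂ} (hs : Summable fun n => ‖q n‖) (hq : SupNormLtOne q) :
    ∃ δ : ℝ, 0 < δ ∧ ∀ s : Finset ℤ, δ ≤ ∏ j ∈ s, (1 - ‖q j‖ ^ 2) := by
  obtain ⟨ρ, hρ, h⟩ := hq
  have hρ0 : 0 ≤ ρ := (norm_nonneg _).trans (h 0)
  have hρ2 : 0 < 1 - ρ := by linarith
  refine ⟨Real.exp (-((1 - ρ)⁻¹ * ∑' n, ‖q n‖)), Real.exp_pos _, fun s => ?_⟩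
  -- With `x = ‖q j‖ ≤ ρ` and `c = (1 - ρ)⁻¹` one has `c(1 - x) ≥ 1`, so `(1 + c x)(1 - x²) ≥ 1 - x²
  -- + x(1 + x) ≥ 1`; then `1 + c x ≤ exp (c x)`.
  have h1 : ∀ j, Real.exp (-((1 - ρ)⁻¹ * ‖q j‖)) ≤ 1 - ‖q j‖ ^ 2 := fun j => by
    have hx := norm_nonneg (q j)
    have hx1 := h j
    have h2 := Real.add_one_le_exp ((1 - ρ)⁻¹ * ‖q j‖)
    rw [Real.exp_neg, inv_le_comm₀ (Real.exp_pos _) (by nlinarith)]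
    refine le_trans ?_ h2
    rw [inv_eq_one_div, div_le_iff₀ (by nlinarith)]
    have h3 : (1 - ρ)⁻¹ * (1 - ‖q j‖) ≥ 1 := by
      calc (1 : ℝ) = (1 - ρ)⁻¹ * (1 - ρ) := (inv_mul_cancel₀ hρ2.ne').symm
        _ ≤ _ := by gcongr
    nlinarith [mul_nonneg hx (by linarith : (0:ℝ) ≤ 1 + ‖q j‖), mul_nonneg hx hx]
  calc _ ≤ Real.exp (∑ j ∈ s, -((1 - ρ)⁻¹ * ‖q j‖)) := by
        rw [Finset.sum_neg_distrib, ← Finset.mul_sum]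
        refine Real.exp_le_exp.2 (neg_le_neg ?_)
        gcongr
        exact hs.sum_le_tsum _ fun _ _ => norm_nonneg _
    _ = ∏ j ∈ s, Real.exp (-((1 - ρ)⁻¹ * ‖q j‖)) := Real.exp_sum _ _
    _ ≤ _ := Finset.prod_le_prod (fun _ _ => (Real.exp_pos _).le) fun j _ => h1 j

theorem exists_pos_le_prod_range {q : ℤ → ℂ} (hs : Summable fun n => ‖q n‖) (hq : SupNormLtOne q) :
    ∃ δ : ℝ, 0 < δ ∧ ∀ (m : ℤ) (n : ℕ), δ ≤ ∏ j ∈ Finset.range n, (1 - ‖q (m + j)‖ ^ 2) := by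
  obtain ⟨δ, hδ, h⟩ := exists_pos_le_prod hs hq
  refine ⟨δ, hδ, fun m n => ?_⟩
  have hinj : Function.Injective fun j : ℕ => m + (j : ℤ) := fun a b h => by simpa using h
  have := h ((Finset.range n).image fun j : ℕ => m + (j : ℤ))
  rwa [Finset.prod_image hinj.injOn] at this

theorem exists_scattering_bounds {q : ℤ → ℂ} (hs : Summable fun n => ‖q n‖)
    (hq : SupNormLtOne q) :
    ∃ δ K : ℝ, 0 < δ ∧ ∀ z : ℂ, ‖z‖ = 1 → ∀ S, IsScatteringMatrix q z S →
      ‖S 0 0‖ ≤ K ∧ δ ≤ ‖S 0 0‖ ^ 2 - ‖S 1 0‖ ^ 2 := by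
  obtain ⟨δ, hδ, h⟩ := exists_pos_le_prod_range hs hq
  refine ⟨δ, Real.exp (∑' n, ‖q n‖), hδ, fun z hz S hS => ?_⟩
  have hlim := hS.tendsto (by rintro rfl; simp at hz)
  have h0 : Tendsto (fun N => ‖fullTransfer q z N 0 0‖) atTop (𝓝 ‖S 0 0‖) :=
    ((continuous_apply_apply 0 0).tendsto S |>.comp hlim).norm
  have h1 : Tendsto (fun N => ‖fullTransfer q z N 1 0‖) atTop (𝓝 ‖S 1 0‖) :=
    ((continuous_apply_apply 1 0).tendsto S |>.comp hlim).norm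
  refine ⟨le_of_tendsto' h0 fun N => ?_, ge_of_tendsto' ((h0.pow 2).sub (h1.pow 2)) fun N => ?_⟩
  · exact (norm_transfer_le q hz _ _).1.trans (Real.exp_le_exp.2 (sum_range_norm_le hs _ _))
  · rw [fullTransfer, transfer_normSq_sub q hz]
    exact h _ _

/-- Since `|a|² - |b|² ≥ δ` and `|a| ≤ K` uniformly on the circle, `|b/a|² ≤ 1 - δ / |a|² ≤ 1 - δ /
K²`. -/
theorem IsReflectionCoeff.supNormLtOne {q : ℤ → ℂ} (hs : Summable fun n => ‖q n‖)
    (hq : SupNormLtOne q) {r : ℝ → ℂ} (hr : IsReflectionCoeff q r) : SupNormLtOne r := by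
  obtain ⟨δ, K, hδ, h⟩ := exists_scattering_bounds hs hq
  have hK : 0 < K ^ 2 ∧ δ ≤ K ^ 2 := by
    obtain ⟨S, hS, h0, _⟩ := hr 0
    obtain ⟨h1, h2⟩ := h _ (norm_circlePt 0) S hS
    have h3 := pow_le_pow_left₀ (norm_nonneg _) h1 2
    have h4 := sq_nonneg ‖S 1 0‖
    constructor <;> linarith
  refine ⟨√(1 - δ / K ^ 2), ?_, fun θ => ?_⟩
  · rw [Real.sqrt_lt' one_pos]
    have : 0 < δ / K ^ 2 := div_pos hδ hK.1
    linarith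
  · obtain ⟨S, hS, h0, hrθ⟩ := hr θ
    obtain ⟨h1, h2⟩ := h _ (norm_circlePt θ) S hS
    have ha : 0 < ‖S 0 0‖ ^ 2 := by positivity
    have h3 := pow_le_pow_left₀ (norm_nonneg _) h1 2
    refine Real.le_sqrt_of_sq_le ?_
    rw [hrθ, norm_div, div_pow, div_le_iff₀ ha]
    have h4 : δ / K ^ 2 * ‖S 0 0‖ ^ 2 ≤ δ := by
      rw [div_mul_eq_mul_div, div_le_iff₀ hK.1]
      exact mul_le_mul_of_nonneg_left h3 hδ.le
    linarith

/-! ### The Lax pair in time and the evolution of the scattering data. -/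

/-- The time part of the Lax pair, in the interaction picture. -/
noncomputable def timeMat (q : ℤ → ℂ) (z : ℂ) (n : ℤ) : Matrix (Fin 2) (Fin 2) ℂ :=
  !![I * (q n * (starRingEnd ℂ) (q (n - 1)) - (z - z⁻¹) ^ 2 / 2),
    -I * (z * q n - z⁻¹ * q (n - 1)) * z ^ (-(2 * n));
    I * (z⁻¹ * (starRingEnd ℂ) (q n) - z * (starRingEnd ℂ) (q (n - 1))) * z ^ (2 * n),
    -I * (q (n - 1) * (starRingEnd ℂ) (q n) - (z - z⁻¹) ^ 2 / 2)]

theorem IsSolution.hasDerivAt_conj {q₀ : ℤ → ℂ} {q : ℝ → ℤ → ℂ} (h : IsSolution q₀ q) (t : ℝ)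
    (n : ℤ) : HasDerivAt (fun s => (starRingEnd ℂ) (q s n))
      (I * ((starRingEnd ℂ) (q t (n + 1)) - 2 * (starRingEnd ℂ) (q t n)
        + (starRingEnd ℂ) (q t (n - 1)) - ((‖q t n‖ ^ 2 : ℝ) : ℂ) *
          ((starRingEnd ℂ) (q t (n + 1)) + (starRingEnd ℂ) (q t (n - 1))))) t := by
  have := (h.hasDerivAt t n).star
  refine this.congr_deriv ?_
  rw [← starRingEnd_apply]
  simp only [map_mul, map_sub, map_add, map_neg, Complex.conj_I, Complex.conj_ofReal, neg_neg]
  rw [map_ofNat]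

/-- The zero-curvature equation. -/
theorem hasDerivAt_stepMat {q₀ : ℤ → ℂ} {q : ℝ → ℤ → ℂ} (h : IsSolution q₀ q) {z : ℂ}
    (hz : z ≠ 0) (t : ℝ) (n : ℤ) (i j : Fin 2) :
    HasDerivAt (fun s => stepMat (q s) z n i j)
      ((timeMat (q t) z (n + 1) * stepMat (q t) z n
        - stepMat (q t) z n * timeMat (q t) z n) i j) t := by
  have hn2 : ((‖q t n‖ ^ 2 : ℝ) : ℂ) = q t n * (starRingEnd ℂ) (q t n) := by
    rw [Complex.mul_conj, Complex.normSq_eq_norm_sq]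
  have h1 := h.hasDerivAt t n
  have h2 := h.hasDerivAt_conj t n
  rw [hn2] at h1 h2
  have e1 : z ^ (2 * n + 1) = z * z ^ (2 * n) := by rw [zpow_add₀ hz, zpow_one, mul_comm]
  have e2 : z ^ (2 * (n + 1)) = z ^ 2 * z ^ (2 * n) := by
    rw [mul_add, zpow_add₀ hz, mul_comm]; norm_cast
  have he : z ^ (2 * n) ≠ 0 := zpow_ne_zero _ hz
  have hI : I ^ 2 = -1 := Complex.I_sq
  fin_cases i <;> fin_cases j <;>
    simp only [stepMat, timeMat, Matrix.mul_apply, Fin.sum_univ_two, Matrix.of_apply,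
      Matrix.cons_val', Matrix.cons_val_zero, Matrix.cons_val_one, Matrix.cons_val_fin_one,
      Matrix.sub_apply, Fin.zero_eta, Fin.mk_one, zpow_neg, e1, e2, add_sub_cancel_right]
  · refine (hasDerivAt_const t (1 : ℂ)).congr_deriv ?_
    field_simp; ring
  · refine (h1.mul_const _).congr_deriv ?_
    field_simp; ring
  · refine (h2.mul_const _).congr_deriv ?_
    field_simp; ring
  · refine (hasDerivAt_const t (1 : ℂ)).congr_deriv ?_
    field_simp; ring

/-- The zero-curvature equation telescopes along the ordered product: the time matrices at interior
sites cancel and only those at the two ends survive. -/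
theorem hasDerivAt_transfer {q₀ : ℤ → ℂ} {q : ℝ → ℤ → ℂ} (h : IsSolution q₀ q) {z : ℂ}
    (hz : z ≠ 0) (t : ℝ) (m : ℤ) (n : ℕ) (i j : Fin 2) :
    HasDerivAt (fun s => transfer (q s) z m n i j)
      ((timeMat (q t) z (m + n) * transfer (q t) z m n
        - transfer (q t) z m n * timeMat (q t) z m) i j) t := by
  induction n generalizing i j with
  | zero => simpa [transfer] using hasDerivAt_const t ((1 : Matrix (Fin 2) (Fin 2) ℂ) i j)
  | succ n ih =>
    have hfun : (fun s => transfer (q s) z m (n + 1) i j) = fun s =>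
        stepMat (q s) z (m + n) i 0 * transfer (q s) z m n 0 j
          + stepMat (q s) z (m + n) i 1 * transfer (q s) z m n 1 j := by
      funext s; simp [transfer, Matrix.mul_apply, Fin.sum_univ_two]
    rw [hfun]
    have hs := hasDerivAt_stepMat h hz t (m + n)
    refine (((hs i 0).mul (ih 0 j)).add ((hs i 1).mul (ih 1 j))).congr_deriv ?_
    have hcast : m + ((n + 1 : ℕ) : ℤ) = m + n + 1 := by push_cast; ring
    rw [hcast]
    simp only [transfer, Matrix.sub_apply, Matrix.mul_apply, Fin.sum_univ_two]
    ring

/-- Since `z - z⁻¹ = 2i sin θ`, this is the dispersion relation: the diagonal of `timeMat` tends to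
`∓i(cos 2θ - 1)` where the potential vanishes. -/
theorem sq_circlePt_sub_inv (θ : ℝ) :
    (circlePt θ - (circlePt θ)⁻¹) ^ 2 / 2 = ((Real.cos (2 * θ) - 1 : ℝ) : ℂ) := by
  rw [circlePt, ← Complex.exp_neg]
  have h : Complex.exp (θ * I) - Complex.exp (-(θ * I)) = 2 * I * Complex.sin θ := by
    rw [Complex.sin]
    have : -(θ : ℂ) * I = -(θ * I) := by ring
    rw [this]
    linear_combination (Complex.exp (θ * I) - Complex.exp (-(θ * I))) * Complex.I_sq
  rw [h]
  push_cast
  rw [Complex.cos_two_mul]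
  linear_combination 2 * Complex.sin θ ^ 2 * Complex.I_sq
    - 2 * Complex.sin_sq_add_cos_sq (θ : ℂ)

/-- Decay of the entries of the time part towards its limit. -/
theorem norm_timeMat_sub_le {q : ℤ → ℂ} {z : ℂ} (hz : ‖z‖ = 1) {C e : ℝ} {n : ℤ}
    (h1 : ‖q n‖ ≤ e) (h2 : ‖q (n - 1)‖ ≤ e) (hC : e ≤ C) :
    ‖timeMat q z n 0 0 + I * ((z - z⁻¹) ^ 2 / 2)‖ ≤ (C + 2) * e ∧
    ‖timeMat q z n 0 1‖ ≤ (C + 2) * e ∧ ‖timeMat q z n 1 0‖ ≤ (C + 2) * e ∧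
    ‖timeMat q z n 1 1 - I * ((z - z⁻¹) ^ 2 / 2)‖ ≤ (C + 2) * e := by
  have he : 0 ≤ e := (norm_nonneg _).trans h1
  have hzn : ∀ k : ℤ, ‖z ^ k‖ = 1 := fun k => by rw [norm_zpow, hz, one_zpow]
  have hzi : ‖z⁻¹‖ = 1 := by rw [norm_inv, hz, inv_one]
  have hCe := mul_le_mul_of_nonneg_right hC he
  have hqq : ‖q n‖ * ‖q (n - 1)‖ ≤ e * e := mul_le_mul h1 h2 (norm_nonneg _) he
  simp only [timeMat, Matrix.of_apply, Matrix.cons_val', Matrix.cons_val_zero,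
    Matrix.cons_val_one, Matrix.cons_val_fin_one]
  refine ⟨?_, ?_, ?_, ?_⟩
  · rw [← mul_add, sub_add_cancel, norm_mul, Complex.norm_I, one_mul, norm_mul, RCLike.norm_conj]
    linarith
  · rw [norm_mul, norm_mul, norm_neg, Complex.norm_I, one_mul, hzn, mul_one]
    refine (norm_sub_le _ _).trans ?_
    rw [norm_mul, norm_mul, hz, hzi]
    nlinarith
  · rw [norm_mul, norm_mul, Complex.norm_I, one_mul, hzn, mul_one]
    refine (norm_sub_le _ _).trans ?_
    rw [norm_mul, norm_mul, hz, hzi, RCLike.norm_conj, RCLike.norm_conj]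
    nlinarith
  · have : -I * (q (n - 1) * (starRingEnd ℂ) (q n) - (z - z⁻¹) ^ 2 / 2) - I * ((z - z⁻¹) ^ 2 / 2)
        = -I * (q (n - 1) * (starRingEnd ℂ) (q n)) + 0 := by ring
    rw [this, add_zero, norm_mul, norm_neg, Complex.norm_I, one_mul, norm_mul, RCLike.norm_conj]
    linarith

theorem DecayBound.norm_le {q : ℤ → ℂ} {C : ℝ} (h : DecayBound q C) {n : ℤ} {N : ℕ}
    (hn : (N : ℝ) ≤ |(n : ℝ)|) (hN : 0 < N) : ‖q n‖ ≤ C / N := by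
  have hN' : (0 : ℝ) < N := by exact_mod_cast hN
  rw [le_div_iff₀ hN']
  refine le_trans ?_ (h.1 n)
  gcongr
  refine Real.le_sqrt_of_sq_le ?_
  have := pow_le_pow_left₀ hN'.le hn 2
  rw [sq_abs] at this
  linarith

/-- Evolution of the first column of the scattering matrix. -/
theorem scattering_evolution {q₀ : ℤ → ℂ} {q : ℝ → ℤ → ℂ} (h : IsSolution q₀ q)
    (hb : ∀ T : ℝ, ∃ C, ∀ t, |t| ≤ T → DecayBound (q t) C) (θ t : ℝ)
    {S₀ S : Matrix (Fin 2) (Fin 2) ℂ} (hS₀ : IsScatteringMatrix q₀ (circlePt θ) S₀)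
    (hS : IsScatteringMatrix (q t) (circlePt θ) S) :
    S 0 0 = S₀ 0 0 ∧
      S 1 0 = S₀ 1 0 * exp (2 * I * ((Real.cos (2 * θ) - 1 : ℝ) : ℂ) * (t : ℂ)) := by
  obtain ⟨C, hC⟩ := hb |t|
  set z := circlePt θ with hzdef
  have hz : ‖z‖ = 1 := norm_circlePt θ
  have hz0 : z ≠ 0 := circlePt_ne_zero θ
  have hS' := hS.tendsto hz0
  have hS₀' := hS₀.tendsto hz0
  rw [← h.1] at hS₀'
  set w : ℝ := Real.cos (2 * θ) - 1 with hw
  have hω : (z - z⁻¹) ^ 2 / 2 = (w : ℂ) := sq_circlePt_sub_inv θ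
  have hC0 : 0 ≤ C := (tsum_nonneg fun _ => norm_nonneg _).trans (hC t le_rfl).2.2
  set K := Real.exp C with hK
  have hKT : ∀ s, |s| ≤ |t| → ∀ N, ‖fullTransfer (q s) z N 0 0‖ ≤ K ∧
      ‖fullTransfer (q s) z N 1 0‖ ≤ K ∧ ‖fullTransfer (q s) z N 0 1‖ ≤ K ∧
      ‖fullTransfer (q s) z N 1 1‖ ≤ K := by
    intro s hs N
    have h1 := norm_transfer_le (q s) hz (-N) (2 * N)
    have h2 : Real.exp (∑ j ∈ Finset.range (2 * N), ‖q s (-(N : ℤ) + j)‖) ≤ K :=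
      Real.exp_le_exp.2 ((sum_range_norm_le (hC s hs).2.1 _ _).trans (hC s hs).2.2)
    obtain ⟨h3, h4⟩ := transfer_conj (q s) hz (-N) (2 * N)
    simp only [fullTransfer]
    rw [h3, h4, RCLike.norm_conj, RCLike.norm_conj]
    exact ⟨h1.1.trans h2, h1.2.trans h2, h1.2.trans h2, h1.1.trans h2⟩
  -- the time part at the two ends, `N ≥ 1`
  have hW : ∀ s, |s| ≤ |t| → ∀ N : ℕ, ∀ n : ℤ, n = (N + 1 : ℕ) + 1 ∨ n = -((N + 1 : ℕ) + 1) →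
      ‖timeMat (q s) z n 0 0 + I * w‖ ≤ (C + 2) * (C / (N + 1 : ℕ)) ∧
      ‖timeMat (q s) z n 0 1‖ ≤ (C + 2) * (C / (N + 1 : ℕ)) ∧
      ‖timeMat (q s) z n 1 0‖ ≤ (C + 2) * (C / (N + 1 : ℕ)) ∧
      ‖timeMat (q s) z n 1 1 - I * w‖ ≤ (C + 2) * (C / (N + 1 : ℕ)) := by
    intro s hs N n hn
    rw [← hω]
    have hNpos : (0 : ℝ) ≤ N := Nat.cast_nonneg N
    refine norm_timeMat_sub_le hz ((hC s hs).norm_le ?_ (by omega))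
      ((hC s hs).norm_le ?_ (by omega)) (div_le_self hC0 (by push_cast; linarith))
    · rcases hn with rfl | rfl
      · push_cast; rw [abs_of_nonneg (by linarith)]; linarith
      · push_cast; rw [abs_of_nonpos (by linarith)]; linarith
    · rcases hn with rfl | rfl
      · push_cast; rw [abs_of_nonneg (by linarith)]; linarith
      · push_cast; rw [abs_of_nonpos (by linarith)]; linarith
  -- With end sites `±(N + 2)`, both sites `n` and `n - 1` that enter the time part have absolute
  -- value at least `N + 1`, so the decay bound applies without division by zero.
  have hcast : ∀ N : ℕ, -(((N + 2 : ℕ) : ℕ) : ℤ) + ((2 * (N + 2) : ℕ) : ℤ) = ((N + 1 : ℕ) : ℤ) + 1 :=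
    fun N => by push_cast; ring
  have hcast' : ∀ N : ℕ, -(((N + 2 : ℕ) : ℕ) : ℤ) = -(((N + 1 : ℕ) : ℤ) + 1) :=
    fun N => by push_cast; ring
  have hder := fun (s : ℝ) (N : ℕ) (i j : Fin 2) =>
    hasDerivAt_transfer h hz0 s (-((N + 2 : ℕ) : ℤ)) (2 * (N + 2)) i j
  have hlim0 : Tendsto (fun N : ℕ => 4 * ((C + 2) * (C / (N + 1 : ℕ)) * K) * |t|) atTop (𝓝 0) := by
    have h1 : Tendsto (fun N : ℕ => C / ((N + 1 : ℕ) : ℝ)) atTop (𝓝 0) :=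
      (tendsto_const_div_atTop_nhds_zero_nat C).comp (tendsto_add_atTop_nat 1)
    have := ((((h1.const_mul (C + 2)).mul_const K).const_mul 4).mul_const |t|)
    simpa using this
  -- The mean value inequality is used at fixed `N`, and `N → ∞` is taken afterwards. The scattering
  -- matrix itself need not be differentiated in time.
  have hmean : ∀ {f : ℝ → ℂ} {f' : ℝ → ℂ} {B : ℝ}, (∀ s, HasDerivAt f (f' s) s) →
      (∀ s, |s| ≤ |t| → ‖f' s‖ ≤ B) → ‖f t - f 0‖ ≤ B * |t| := by
    intro f f' B h1 h2
    have := (convex_Icc (-|t|) |t|).norm_image_sub_le_of_norm_hasDerivWithin_le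
      (f := f) (x := 0) (y := t) (fun s _ => (h1 s).hasDerivWithinAt)
      (fun s hs => h2 s (abs_le.2 hs)) ⟨neg_nonpos.2 (abs_nonneg t), abs_nonneg t⟩
      (abs_le.1 le_rfl)
    simpa using this
  have hfour : ∀ {B : ℝ} {x₁ x₂ x₃ x₄ : ℂ}, ‖x₁‖ ≤ B → ‖x₂‖ ≤ B → ‖x₃‖ ≤ B → ‖x₄‖ ≤ B →
      ‖x₁ + x₂ - x₃ - x₄‖ ≤ 4 * B := by
    intro B x₁ x₂ x₃ x₄ h1 h2 h3 h4
    have := norm_sub_le (x₁ + x₂ - x₃) x₄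
    have := norm_sub_le (x₁ + x₂) x₃
    have := norm_add_le x₁ x₂
    linarith
  have hmul : ∀ {A : ℝ} {x y : ℂ}, ‖x‖ ≤ A → ‖y‖ ≤ K → ‖x * y‖ ≤ A * K := fun hx hy => by
    rw [norm_mul]; exact mul_le_mul hx hy (norm_nonneg _) ((norm_nonneg _).trans hx)
  have hmul' : ∀ {A : ℝ} {x y : ℂ}, ‖x‖ ≤ K → ‖y‖ ≤ A → ‖x * y‖ ≤ A * K := fun hx hy => by
    rw [mul_comm]; exact hmul hy hx
  constructor
  · have hlim : Tendsto (fun N => fullTransfer (q t) z (N + 2) 0 0 - fullTransfer (q 0) z (N + 2) 0 0)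
        atTop (𝓝 (S 0 0 - S₀ 0 0)) :=
      (((continuous_apply_apply 0 0).tendsto S |>.comp hS').comp (tendsto_add_atTop_nat 2)).sub
        (((continuous_apply_apply 0 0).tendsto S₀ |>.comp hS₀').comp (tendsto_add_atTop_nat 2))
    refine sub_eq_zero.1 (tendsto_nhds_unique hlim (squeeze_zero_norm (fun N => ?_) hlim0))
    refine hmean (f := fun s => fullTransfer (q s) z (N + 2) 0 0) (fun s => hder s N 0 0)
      fun s hs => ?_
    obtain ⟨k1, k2, k3, k4⟩ := hKT s hs (N + 2)
    obtain ⟨a1, a2, a3, a4⟩ := hW s hs N _ (Or.inl rfl)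
    obtain ⟨b1, b2, b3, b4⟩ := hW s hs N _ (Or.inr rfl)
    rw [hcast, hcast', ← hcast' N]
    rw [← hcast' N] at b1 b2 b3 b4
    simp only [Matrix.sub_apply, Matrix.mul_apply, Fin.sum_univ_two]
    change ‖_ * fullTransfer (q s) z (N + 2) 0 0 + _ * fullTransfer (q s) z (N + 2) 1 0 -
      (fullTransfer (q s) z (N + 2) 0 0 * _ + fullTransfer (q s) z (N + 2) 0 1 * _)‖ ≤ _
    refine le_trans (le_of_eq ?_) (hfour (hmul a1 k1) (hmul a2 k2) (hmul' k1 b1) (hmul' k3 b3))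
    congr 1
    ring
  -- In the lower left entry the limiting diagonal parts add up to `c` instead of cancelling. The
  -- integrating factor `exp (-c t)`, of modulus one, removes them and leaves only `O(1/N)` terms.
  · set c : ℂ := 2 * I * (w : ℂ) with hc
    have hexp : ∀ s : ℝ, ‖exp (-(c * s))‖ = 1 := fun s => by
      have : -(c * s) = ((-(2 * w * s) : ℝ) : ℂ) * I := by rw [hc]; push_cast; ring
      rw [this, Complex.norm_exp_ofReal_mul_I]
    have hlim : Tendsto (fun N => exp (-(c * t)) * fullTransfer (q t) z (N + 2) 1 0
          - exp (-(c * (0 : ℝ))) * fullTransfer (q 0) z (N + 2) 1 0)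
        atTop (𝓝 (exp (-(c * t)) * S 1 0 - exp (-(c * (0 : ℝ))) * S₀ 1 0)) :=
      ((((continuous_apply_apply 1 0).tendsto S |>.comp hS').comp
          (tendsto_add_atTop_nat 2)).const_mul _).sub
        ((((continuous_apply_apply 1 0).tendsto S₀ |>.comp hS₀').comp
          (tendsto_add_atTop_nat 2)).const_mul _)
    have hzero : exp (-(c * t)) * S 1 0 - exp (-(c * (0 : ℝ))) * S₀ 1 0 = 0 := by
      refine tendsto_nhds_unique hlim (squeeze_zero_norm (fun N => ?_) hlim0)
      have hE : ∀ s : ℝ, HasDerivAt (fun s : ℝ => exp (-(c * s))) (exp (-(c * s)) * -c) s :=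
        fun s => by
          have := (((hasDerivAt_id (s : ℂ)).const_mul c).neg.cexp).comp_ofReal
          simpa using this
      refine hmean (f := fun s => exp (-(c * s)) * fullTransfer (q s) z (N + 2) 1 0)
        (fun s => (hE s).mul (hder s N 1 0)) fun s hs => ?_
      obtain ⟨k1, k2, k3, k4⟩ := hKT s hs (N + 2)
      obtain ⟨a1, a2, a3, a4⟩ := hW s hs N _ (Or.inl rfl)
      obtain ⟨b1, b2, b3, b4⟩ := hW s hs N _ (Or.inr rfl)
      rw [hcast, hcast', ← hcast' N]
      rw [← hcast' N] at b1 b2 b3 b4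
      simp only [Matrix.sub_apply, Matrix.mul_apply, Fin.sum_univ_two]
      rw [mul_assoc, ← mul_add, norm_mul, hexp, one_mul]
      change ‖-c * fullTransfer (q s) z (N + 2) 1 0 + (_ * fullTransfer (q s) z (N + 2) 0 0
        + _ * fullTransfer (q s) z (N + 2) 1 0 -
        (fullTransfer (q s) z (N + 2) 1 0 * _ + fullTransfer (q s) z (N + 2) 1 1 * _))‖ ≤ _
      refine le_trans (le_of_eq ?_) (hfour (hmul a3 k1) (hmul a4 k2) (hmul' k2 b1) (hmul' k4 b3))
      congr 1
      rw [hc]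
      ring
    have h1 : exp (c * t) * exp (-(c * t)) = 1 := by rw [← Complex.exp_add]; simp
    simp only [Complex.ofReal_zero, mul_zero, neg_zero, Complex.exp_zero, one_mul] at hzero
    linear_combination (exp (c * t)) * hzero - S 1 0 * h1

/-! ### Left Jost vectors on the unit disc. -/

/-- The Lax matrix divided by `z`, in the variable `w = 1 / z`. -/
noncomputable def discMat (c w : ℂ) : Matrix (Fin 2) (Fin 2) ℂ :=
  !![1, c * w; (starRingEnd ℂ) c * w, w ^ 2]

/-- The ordered product of the `N` disc matrices at the sites `n - 1, …, n - N`. -/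
noncomputable def backProd (p : ℤ → ℂ) (n : ℤ) (w : ℂ) : ℕ → Matrix (Fin 2) (Fin 2) ℂ
  | 0 => 1
  | N + 1 => backProd p n w N * discMat (p (n - N - 1)) w

/-- Products grow on the right, towards `-∞`, whereas the recursion in `n` multiplies on the left;
this identity passes to `jost_succ` in the limit. -/
theorem discMat_mul_backProd (p : ℤ → ℂ) (n : ℤ) (w : ℂ) (N : ℕ) :
    discMat (p n) w * backProd p n w N = backProd p (n + 1) w (N + 1) := by
  induction N with
  | zero => simp [backProd]
  | succ N ih =>
    rw [backProd, ← Matrix.mul_assoc, ih, backProd.eq_2 _ _ _ (N + 1)]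
    congr 3
    push_cast
    ring

theorem norm_backProd_le (p : ℤ → ℂ) (n : ℤ) {w : ℂ} (hw : ‖w‖ ≤ 1) (N : ℕ) (i j : Fin 2) :
    ‖backProd p n w N i j‖ ≤ Real.exp (∑ k ∈ Finset.range N, ‖p (n - k - 1)‖) := by
  induction N generalizing j with
  | zero => fin_cases i <;> fin_cases j <;> simp [backProd]
  | succ N ih =>
    rw [Finset.sum_range_succ, Real.exp_add]
    set A := Real.exp (∑ k ∈ Finset.range N, ‖p (n - k - 1)‖)
    have hA : 0 < A := Real.exp_pos _
    have hc := norm_nonneg (p (n - N - 1))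
    have h1 := Real.add_one_le_exp ‖p (n - N - 1)‖
    have h2 : A + A * ‖p (n - N - 1)‖ ≤ A * Real.exp ‖p (n - N - 1)‖ := by nlinarith
    have hcw : ‖p (n - N - 1)‖ * ‖w‖ ≤ ‖p (n - N - 1)‖ := mul_le_of_le_one_right hc hw
    have hw2 : ‖w‖ ^ 2 ≤ 1 := pow_le_one₀ (norm_nonneg _) hw
    have hmul : ∀ {x y : ℂ} {B : ℝ}, ‖x‖ ≤ A → ‖y‖ ≤ B → ‖x * y‖ ≤ A * B := fun hx hy => by
      rw [norm_mul]; exact mul_le_mul hx hy (norm_nonneg _) hA.le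
    refine le_trans ?_ h2
    fin_cases j <;>
      simp only [backProd, discMat, Matrix.mul_apply, Fin.sum_univ_two, Matrix.of_apply,
        Matrix.cons_val', Matrix.cons_val_zero, Matrix.cons_val_one, Matrix.cons_val_fin_one,
        Fin.zero_eta, Fin.mk_one] <;>
      refine (norm_add_le _ _).trans ?_
    · rw [mul_one]
      exact add_le_add (ih 0) (hmul (ih 1) (by rwa [norm_mul, RCLike.norm_conj]))
    · rw [add_comm]
      refine add_le_add ?_ (hmul (ih 0) (by rwa [norm_mul]))
      simpa using hmul (ih 1) (by rwa [norm_pow] : ‖w ^ 2‖ ≤ 1)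

theorem hasSum_back {p : ℤ → ℂ} (hs : Summable fun n => ‖p n‖) (n : ℤ) :
    Summable fun N : ℕ => ‖p (n - N - 1)‖ := by
  have hinj : Function.Injective fun N : ℕ => n - (N : ℤ) - 1 := fun a b h => by simpa using h
  exact hs.comp_injective hinj

theorem sum_back_le {p : ℤ → ℂ} (hs : Summable fun n => ‖p n‖) (n : ℤ) (N : ℕ) :
    ∑ k ∈ Finset.range N, ‖p (n - k - 1)‖ ≤ ∑' n, ‖p n‖ := by
  have hinj : Function.Injective fun N : ℕ => n - (N : ℤ) - 1 := fun a b h => by simpa using h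
  rw [← Finset.sum_image (f := fun n => ‖p n‖) (g := fun k : ℕ => n - (k : ℤ) - 1) hinj.injOn]
  exact hs.sum_le_tsum _ fun _ _ => norm_nonneg _

/-- The left Jost vector at site `n` as a function on the unit disc. -/
noncomputable def jost (p : ℤ → ℂ) (n : ℤ) (w : ℂ) (i : Fin 2) : ℂ :=
  (1 : Matrix (Fin 2) (Fin 2) ℂ) i 0
    + ∑' N : ℕ, (starRingEnd ℂ) (p (n - N - 1)) * w * backProd p n w N i 1

section

variable {p : ℤ → ℂ} (hs : Summable fun n => ‖p n‖)
include hs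

theorem norm_jost_term_le (n : ℤ) {w : ℂ} (hw : ‖w‖ ≤ 1) (i : Fin 2) (N : ℕ) :
    ‖(starRingEnd ℂ) (p (n - N - 1)) * w * backProd p n w N i 1‖
      ≤ ‖p (n - N - 1)‖ * Real.exp (∑' n, ‖p n‖) := by
  rw [norm_mul, norm_mul, RCLike.norm_conj]
  refine mul_le_mul (mul_le_of_le_one_right (norm_nonneg _) hw) ?_ (norm_nonneg _) (norm_nonneg _)
  exact (norm_backProd_le p n hw N i 1).trans (Real.exp_le_exp.2 (sum_back_le hs n N))

/-- Each further factor on the right adds to the first column a multiple of the second column, with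
coefficient `conj(p) w`. The series defining `jost` is this telescoping sum; it converges because
the products are uniformly bounded and `p` is summable. -/
theorem tendsto_backProd (n : ℤ) {w : ℂ} (hw : ‖w‖ ≤ 1) (i : Fin 2) :
    Tendsto (fun N => backProd p n w N i 0) atTop (𝓝 (jost p n w i)) := by
  have hsum : Summable fun N : ℕ =>
      (starRingEnd ℂ) (p (n - N - 1)) * w * backProd p n w N i 1 :=
    Summable.of_norm_bounded ((hasSum_back hs n).mul_right _) (norm_jost_term_le hs n hw i)
  refine (hsum.hasSum.tendsto_sum_nat.const_add _).congr fun N => ?_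
  induction N with
  | zero => simp [backProd]
  | succ N ih =>
    rw [Finset.sum_range_succ, ← add_assoc, ih]
    simp only [backProd, discMat, Matrix.mul_apply, Fin.sum_univ_two, Matrix.of_apply,
        Matrix.cons_val', Matrix.cons_val_zero, Matrix.cons_val_one, Matrix.cons_val_fin_one]
    ring

theorem continuousOn_jost (n : ℤ) (i : Fin 2) :
    ContinuousOn (fun w => jost p n w i) (Metric.closedBall 0 1) := by
  have hc : ∀ N j, Continuous fun w => backProd p n w N i j := by
    intro N
    induction N with
    | zero => intro j; simpa [backProd] using continuous_const
    | succ N ih =>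
      intro j
      have h0 := ih 0
      have h1 := ih 1
      fin_cases j <;>
      simp only [backProd, discMat, Matrix.mul_apply, Fin.sum_univ_two, Matrix.of_apply,
        Matrix.cons_val', Matrix.cons_val_zero, Matrix.cons_val_one, Matrix.cons_val_fin_one,
        Fin.zero_eta, Fin.mk_one] <;> fun_prop
  refine continuousOn_const.add (continuousOn_tsum (fun N => ?_)
    ((hasSum_back hs n).mul_right (Real.exp (∑' n, ‖p n‖))) fun N w hw =>
      norm_jost_term_le hs n (by simpa using hw) i N)
  have := hc N 1
  fun_prop

theorem differentiableOn_jost (n : ℤ) (i : Fin 2) :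
    DifferentiableOn ℂ (fun w => jost p n w i) (Metric.ball 0 1) := by
  have hc : ∀ N j, Differentiable ℂ fun w => backProd p n w N i j := by
    intro N
    induction N with
    | zero => intro j; simp [backProd]
    | succ N ih =>
      intro j
      have h0 := ih 0
      have h1 := ih 1
      fin_cases j <;>
      simp only [backProd, discMat, Matrix.mul_apply, Fin.sum_univ_two, Matrix.of_apply,
        Matrix.cons_val', Matrix.cons_val_zero, Matrix.cons_val_one, Matrix.cons_val_fin_one,
        Fin.zero_eta, Fin.mk_one] <;> fun_prop
  refine (differentiableOn_const _).add (differentiableOn_tsum_of_summable_norm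
    ((hasSum_back hs n).mul_right (Real.exp (∑' n, ‖p n‖))) (fun N => ?_) Metric.isOpen_ball
    fun N w hw => norm_jost_term_le hs n (by simpa using (Metric.ball_subset_closedBall hw)) i N)
  have := hc N 1
  fun_prop

theorem jost_succ (n : ℤ) {w : ℂ} (hw : ‖w‖ ≤ 1) :
    jost p (n + 1) w 0 = jost p n w 0 + p n * w * jost p n w 1 ∧
    jost p (n + 1) w 1 = (starRingEnd ℂ) (p n) * w * jost p n w 0 + w ^ 2 * jost p n w 1 := by
  have h0 := tendsto_backProd hs n hw 0
  have h1 := tendsto_backProd hs n hw 1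
  have key : ∀ i, Tendsto (fun N => (discMat (p n) w * backProd p n w N) i 0) atTop
      (𝓝 (jost p (n + 1) w i)) := fun i => by
    simp only [discMat_mul_backProd]
    exact (tendsto_backProd hs (n + 1) hw i).comp (tendsto_add_atTop_nat 1)
  constructor
  · refine tendsto_nhds_unique (key 0) ((h0.add (h1.const_mul (p n * w))).congr fun N => ?_)
    simp [discMat, Matrix.mul_apply, Fin.sum_univ_two]
  · refine tendsto_nhds_unique (key 1)
      ((h0.const_mul ((starRingEnd ℂ) (p n) * w)).add (h1.const_mul (w ^ 2)) |>.congr fun N => ?_)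
    simp [discMat, Matrix.mul_apply, Fin.sum_univ_two]

theorem tendsto_jost_atBot {w : ℂ} (hw : ‖w‖ ≤ 1) (i : Fin 2) :
    Tendsto (fun n => jost p n w i) atBot (𝓝 ((1 : Matrix (Fin 2) (Fin 2) ℂ) i 0)) := by
  rw [tendsto_iff_norm_sub_tendsto_zero]
  have htail : Tendsto (fun k : ℕ => (∑' N : ℕ, ‖p (-((N + k : ℕ) : ℤ) - 1)‖)
      * Real.exp (∑' n, ‖p n‖)) atTop (𝓝 0) := by
    have := (tendsto_sum_nat_add fun N : ℕ => ‖p (-(N : ℤ) - 1)‖).mul_const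
      (Real.exp (∑' n, ‖p n‖))
    simpa using this
  have hto : Tendsto (fun n : ℤ => (-n).toNat) atBot atTop :=
    tendsto_atTop.2 fun b => (eventually_le_atBot (-b : ℤ)).mono fun n hn => by omega
  refine squeeze_zero' (Eventually.of_forall fun _ => norm_nonneg _) ?_ (htail.comp hto)
  filter_upwards [eventually_le_atBot 0] with n hn
  have h1 : ‖jost p n w i - (1 : Matrix (Fin 2) (Fin 2) ℂ) i 0‖
      ≤ ∑' N : ℕ, ‖p (n - N - 1)‖ * Real.exp (∑' n, ‖p n‖) := by
    rw [jost, add_sub_cancel_left]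
    exact tsum_of_norm_bounded ((hasSum_back hs n).mul_right _).hasSum (norm_jost_term_le hs n hw i)
  refine h1.trans (le_of_eq ?_)
  rw [tsum_mul_right]
  simp only [Function.comp]
  congr 3
  funext N
  congr 2
  push_cast
  rw [Int.toNat_of_nonneg (by omega)]
  ring

omit hs in
theorem jost_zero (n : ℤ) (i : Fin 2) : jost p n 0 i = (1 : Matrix (Fin 2) (Fin 2) ℂ) i 0 := by
  simp [jost]

/-- On the circle the conjugate of a function of `z⁻¹` becomes a function of `z` for the conjugate
potential. This continues the conjugated vectors holomorphically into `|z| < 1`. -/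
theorem jost_conj (n : ℤ) {w : ℂ} (hw : ‖w‖ ≤ 1) (i : Fin 2) :
    jost (fun m => (starRingEnd ℂ) (p m)) n ((starRingEnd ℂ) w) i
      = (starRingEnd ℂ) (jost p n w i) := by
  have hs' : Summable fun n => ‖(starRingEnd ℂ) (p n)‖ := by simpa using hs
  refine tendsto_nhds_unique (tendsto_backProd hs' n (by simpa using hw) i)
    (((Complex.continuous_conj.tendsto _).comp (tendsto_backProd hs n hw i)).congr fun N => ?_)
  have : ∀ N j, (starRingEnd ℂ) (backProd p n w N i j)
      = backProd (fun m => (starRingEnd ℂ) (p m)) n ((starRingEnd ℂ) w) N i j := by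
    intro N
    induction N with
    | zero => intro j; fin_cases i <;> fin_cases j <;> simp [backProd]
    | succ N ih =>
      intro j
      fin_cases j <;>
        simp [backProd, discMat, Matrix.mul_apply, Fin.sum_univ_two, ih]
  exact this N 0

omit hs in
-- The matrix `[[1, c], [conj c, 1]]` multiplies the indefinite form `|x|² - |y|²` by `1 - |c|²`.
-- For `|c| < 1` the cone `|y| < |x|` is thus preserved.
theorem normSq_hyperbolic (c x y : ℂ) :
    ‖x + c * y‖ ^ 2 - ‖(starRingEnd ℂ) c * x + y‖ ^ 2 = (1 - ‖c‖ ^ 2) * (‖x‖ ^ 2 - ‖y‖ ^ 2) := by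
  simp only [Complex.sq_norm, Complex.normSq_apply, Complex.add_re, Complex.add_im, Complex.mul_re,
    Complex.mul_im, Complex.conj_re, Complex.conj_im]
  ring

theorem jost_succ_normSq_sub (n : ℤ) {w : ℂ} (hw : ‖w‖ = 1) :
    ‖jost p (n + 1) w 0‖ ^ 2 - ‖jost p (n + 1) w 1‖ ^ 2
      = (1 - ‖p n‖ ^ 2) * (‖jost p n w 0‖ ^ 2 - ‖jost p n w 1‖ ^ 2) := by
  obtain ⟨h0, h1⟩ := jost_succ hs n hw.le
  have h := normSq_hyperbolic (p n) (jost p n w 0) (w * jost p n w 1)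
  have h2 : (starRingEnd ℂ) (p n) * w * jost p n w 0 + w ^ 2 * jost p n w 1
      = w * ((starRingEnd ℂ) (p n) * jost p n w 0 + w * jost p n w 1) := by ring
  rw [h0, h1, h2, norm_mul w, hw, one_mul, mul_assoc (p n), h, norm_mul, hw, one_mul]

/-- The first component of the left Jost vector dominates the second one. -/
theorem norm_jost_lt (hlt : ∀ n, ‖p n‖ < 1) (n : ℤ) {w : ℂ} (hw : ‖w‖ ≤ 1) :
    ‖jost p n w 1‖ < ‖jost p n w 0‖ := by
  have hstep : ∀ m, ‖jost p m w 1‖ < ‖jost p m w 0‖ →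
      ‖jost p (m + 1) w 1‖ < ‖jost p (m + 1) w 0‖ := by
    intro m hm
    obtain ⟨h0, h1⟩ := jost_succ hs m hw
    have h := normSq_hyperbolic (p m) (jost p m w 0) (w * jost p m w 1)
    have h2 : (starRingEnd ℂ) (p m) * w * jost p m w 0 + w ^ 2 * jost p m w 1
        = w * ((starRingEnd ℂ) (p m) * jost p m w 0 + w * jost p m w 1) := by ring
    have hy : ‖w * jost p m w 1‖ < ‖jost p m w 0‖ := by
      rw [norm_mul]; exact (mul_le_of_le_one_left (norm_nonneg _) hw).trans_lt hm
    have hpos : 0 < (1 - ‖p m‖ ^ 2) * (‖jost p m w 0‖ ^ 2 - ‖w * jost p m w 1‖ ^ 2) := by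
      have hc := hlt m
      have := norm_nonneg (p m)
      have := norm_nonneg (w * jost p m w 1)
      refine mul_pos ?_ ?_ <;> nlinarith
    rw [h0, h1, h2, norm_mul w, mul_assoc (p m)]
    refine (mul_le_of_le_one_left (norm_nonneg _) hw).trans_lt ?_
    exact lt_of_pow_lt_pow_left₀ 2 (norm_nonneg _) (by linarith)
  have h0 := (tendsto_jost_atBot hs hw 0).norm
  have h1 := (tendsto_jost_atBot hs hw 1).norm
  -- The vector tends to `(1, 0)` at `-∞`, so the domination holds at some site `m ≤ n`; the steps
  -- then carry it to `n`.
  obtain ⟨m, hm, hmn⟩ := ((h1.eventually_lt h0 (by simp)).and (eventually_le_atBot n)).exists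
  induction n, hmn using Int.leInduction with
  | base => exact hm
  | succ k _ hk => exact hstep k hk

/-- The ratio of the second component and `w` at the centre of the disc. -/
theorem tendsto_jost_div (n : ℤ) :
    Tendsto (fun w => jost p (n + 1) w 1 / w) (𝓝[≠] 0) (𝓝 ((starRingEnd ℂ) (p n))) := by
  have hball : Metric.closedBall (0 : ℂ) 1 ∈ 𝓝 (0 : ℂ) := Metric.closedBall_mem_nhds 0 one_pos
  have hc : ∀ i, ContinuousAt (fun w => jost p n w i) 0 := fun i =>
    (continuousOn_jost hs n i).continuousAt hball
  have hlim : Tendsto (fun w => (starRingEnd ℂ) (p n) * jost p n w 0 + w * jost p n w 1) (𝓝 0)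
      (𝓝 ((starRingEnd ℂ) (p n) * jost p n 0 0 + 0 * jost p n 0 1)) :=
    (tendsto_const_nhds.mul (hc 0)).add (tendsto_id.mul (hc 1))
  rw [jost_zero, jost_zero] at hlim
  simp only [Matrix.one_apply_eq, mul_one, zero_mul, add_zero] at hlim
  refine (hlim.mono_left nhdsWithin_le_nhds).congr' ?_
  filter_upwards [self_mem_nhdsWithin, nhdsWithin_le_nhds hball] with w hw0 hw
  have hw0' : w ≠ 0 := hw0
  rw [(jost_succ hs n (by simpa using hw)).2]
  field_simp

end

/-! ### Right Jost vectors and the coefficient `a`. -/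

/-- The reflected potential, which exchanges the two ends of the lattice. -/
noncomputable def reflect (p : ℤ → ℂ) (k : ℤ) : ℂ := -(starRingEnd ℂ) (p (-k - 1))

theorem summable_reflect {p : ℤ → ℂ} (hs : Summable fun n => ‖p n‖) :
    Summable fun n => ‖reflect p n‖ := by
  have hinj : Function.Injective fun k : ℤ => -k - 1 := fun a b h => by simpa using h
  simpa [reflect, Function.comp_def] using hs.comp_injective hinj

theorem norm_reflect_lt {p : ℤ → ℂ} (h : ∀ n, ‖p n‖ < 1) (n : ℤ) : ‖reflect p n‖ < 1 := by
  simpa [reflect] using h (-n - 1)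

theorem reflect_conj (p : ℤ → ℂ) :
    reflect (fun m => (starRingEnd ℂ) (p m)) = fun m => (starRingEnd ℂ) (reflect p m) := by
  funext m; simp [reflect]

/-- First component of the right Jost vector, up to normalization. -/
noncomputable def rjost₁ (p : ℤ → ℂ) (n : ℤ) (w : ℂ) : ℂ := jost (reflect p) (-n) w 1

/-- Second component of the right Jost vector, up to normalization. -/
noncomputable def rjost₂ (p : ℤ → ℂ) (n : ℤ) (w : ℂ) : ℂ := jost (reflect p) (-n) w 0

/-- The transmission denominator `a` as a function on the disc, computed at site `n`. -/
noncomputable def discA (p : ℤ → ℂ) (n : ℤ) (w : ℂ) : ℂ :=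
  jost p n w 0 * rjost₂ p n w - jost p n w 1 * rjost₁ p n w

section

variable {p : ℤ → ℂ} (hs : Summable fun n => ‖p n‖)
include hs

/-- The inverse of a Lax matrix is, up to the factor `(1 - |c|²)⁻¹` and an exchange of components,
the Lax matrix with potential `-conj c`. Propagation from `+∞` is therefore left propagation for
`reflect p`; the omitted factors are restored later by `tailProd`. -/
theorem rjost_eq (n : ℤ) {w : ℂ} (hw : ‖w‖ ≤ 1) :
    rjost₁ p n w = w ^ 2 * rjost₁ p (n + 1) w - p n * w * rjost₂ p (n + 1) w ∧
    rjost₂ p n w = rjost₂ p (n + 1) w - (starRingEnd ℂ) (p n) * w * rjost₁ p (n + 1) w := by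
  obtain ⟨h0, h1⟩ := jost_succ (summable_reflect hs) (-(n + 1)) hw
  have e : -(n + 1) + 1 = -n := by ring
  have e' : reflect p (-(n + 1)) = -(starRingEnd ℂ) (p n) := by
    simp only [reflect]; congr 3; ring
  rw [e, e'] at h0 h1
  rw [map_neg, Complex.conj_conj] at h1
  unfold rjost₁ rjost₂
  rw [h0, h1]
  constructor <;> ring

/-- The left vector advances by `discMat`, and `(rjost₂, -rjost₁)` moves back by its transpose, so
their pairing does not depend on the site. -/
theorem discA_succ (n : ℤ) {w : ℂ} (hw : ‖w‖ ≤ 1) : discA p (n + 1) w = discA p n w := by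
  obtain ⟨h0, h1⟩ := jost_succ hs n hw
  obtain ⟨h2, h3⟩ := rjost_eq hs n hw
  unfold discA
  rw [h0, h1, h2, h3]
  ring

theorem discA_eq (m n : ℤ) {w : ℂ} (hw : ‖w‖ ≤ 1) : discA p m w = discA p n w := by
  suffices h : ∀ n, discA p n w = discA p 0 w by rw [h m, h n]
  intro n
  induction n using Int.induction_on with
  | zero => rfl
  | succ i ih => rw [discA_succ hs _ hw, ih]
  | pred i ih => rw [← ih, ← discA_succ hs _ hw, sub_add_cancel]

/-- Each factor of the first product strictly dominates the corresponding factor of the second. This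
excludes zeros of `a` in the open disc and on the circle alike. -/
theorem discA_ne_zero (hlt : ∀ n, ‖p n‖ < 1) (n : ℤ) {w : ℂ} (hw : ‖w‖ ≤ 1) :
    discA p n w ≠ 0 := by
  have h1 := norm_jost_lt hs hlt n hw
  have h2 := norm_jost_lt (summable_reflect hs) (norm_reflect_lt hlt) (-n) hw
  intro h
  have h3 : ‖jost p n w 0 * rjost₂ p n w‖ = ‖jost p n w 1 * rjost₁ p n w‖ := by
    rw [sub_eq_zero.1 h]
  rw [norm_mul, norm_mul] at h3
  exact (mul_lt_mul'' h1 h2 (norm_nonneg _) (norm_nonneg _)).ne' h3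

omit hs in
theorem discA_zero (n : ℤ) : discA p n 0 = 1 := by
  simp [discA, rjost₁, rjost₂, jost_zero]

theorem discA_conj (n : ℤ) {w : ℂ} (hw : ‖w‖ ≤ 1) :
    discA (fun m => (starRingEnd ℂ) (p m)) n ((starRingEnd ℂ) w)
      = (starRingEnd ℂ) (discA p n w) := by
  have := summable_reflect hs
  simp only [discA, rjost₁, rjost₂, reflect_conj, jost_conj hs _ hw, jost_conj this _ hw, map_sub,
    map_mul]

theorem tendsto_rjost_atTop {w : ℂ} (hw : ‖w‖ ≤ 1) :
    Tendsto (fun n => rjost₁ p n w) atTop (𝓝 0) ∧ Tendsto (fun n => rjost₂ p n w) atTop (𝓝 1) := by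
  have h := fun i => (tendsto_jost_atBot (summable_reflect hs) hw i).comp tendsto_neg_atTop_atBot
  exact ⟨by simpa [rjost₁, Function.comp_def] using h 1,
    by simpa [rjost₂, Function.comp_def] using h 0⟩

end

/-- The product `∏_{j ≥ n} (1 - |p_j|²)`. -/
noncomputable def tailProd (p : ℤ → ℂ) (n : ℤ) : ℝ := ‖rjost₂ p n 1‖ ^ 2 - ‖rjost₁ p n 1‖ ^ 2

section

variable {p : ℤ → ℂ} (hs : Summable fun n => ‖p n‖) (hlt : ∀ n, ‖p n‖ < 1)
include hs

theorem rjost_normSq_sub (n : ℤ) {w : ℂ} (hw : ‖w‖ = 1) :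
    ‖rjost₂ p n w‖ ^ 2 - ‖rjost₁ p n w‖ ^ 2
      = (1 - ‖p n‖ ^ 2) * (‖rjost₂ p (n + 1) w‖ ^ 2 - ‖rjost₁ p (n + 1) w‖ ^ 2) := by
  have h := jost_succ_normSq_sub (summable_reflect hs) (-(n + 1)) hw
  have e : -(n + 1) + 1 = -n := by ring
  have e' : reflect p (-(n + 1)) = -(starRingEnd ℂ) (p n) := by
    simp only [reflect]; congr 3; ring
  rw [e, e', norm_neg, RCLike.norm_conj] at h
  exact h

include hlt

theorem tailProd_pos (n : ℤ) : 0 < tailProd p n := by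
  have := norm_jost_lt (summable_reflect hs) (norm_reflect_lt hlt) (-n) (w := 1) (by simp)
  have h2 := norm_nonneg (jost (reflect p) (-n) 1 1)
  unfold tailProd rjost₁ rjost₂
  nlinarith

/-- On the circle the left side satisfies the same recursion for every `w`, with the nonzero factors
`1 - ‖p n‖²`, and tends to `1` at `+∞`. Its value at `w = 1`, which defines `tailProd`, is therefore
its value everywhere. -/
theorem rjost_normSq_eq_tailProd (n : ℤ) {w : ℂ} (hw : ‖w‖ = 1) :
    ‖rjost₂ p n w‖ ^ 2 - ‖rjost₁ p n w‖ ^ 2 = tailProd p n := by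
  set f : ℤ → ℝ := fun n => ‖rjost₂ p n w‖ ^ 2 - ‖rjost₁ p n w‖ ^ 2 with hf
  have hlim : ∀ w : ℂ, ‖w‖ = 1 →
      Tendsto (fun n => ‖rjost₂ p n w‖ ^ 2 - ‖rjost₁ p n w‖ ^ 2) atTop (𝓝 1) := fun w hw => by
    obtain ⟨h1, h2⟩ := tendsto_rjost_atTop hs hw.le
    simpa using (h2.norm.pow 2).sub (h1.norm.pow 2)
  have hconst : ∀ k : ℕ, f (n + k) * tailProd p n = f n * tailProd p (n + k) := by
    intro k
    induction k with
    | zero => simp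
    | succ k ih =>
      have h1 := rjost_normSq_sub hs (n + k) hw
      have h2 := rjost_normSq_sub hs (n + k) (w := 1) (by simp)
      have hc : 1 - ‖p (n + k)‖ ^ 2 ≠ 0 := by
        have := hlt (n + k)
        have := norm_nonneg (p (n + k))
        nlinarith
      push_cast
      rw [← add_assoc]
      refine mul_left_cancel₀ hc ?_
      change f (n + k) = _ * f (n + k + 1) at h1
      change tailProd p (n + k) = _ * tailProd p (n + k + 1) at h2
      rw [h1, h2] at ih
      linarith
  have hto : Tendsto (fun k : ℕ => n + (k : ℤ)) atTop atTop :=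
    tendsto_atTop_add_const_left _ _ tendsto_natCast_atTop_atTop
  have l1 := (((hlim w hw).comp hto).mul_const (tailProd p n))
  have l2 := (((hlim 1 (by simp)).comp hto).const_mul (f n))
  have := tendsto_nhds_unique l1 (l2.congr fun k => (hconst k).symm)
  rw [one_mul, mul_one] at this
  exact this.symm

omit hlt in
theorem tendsto_tailProd : Tendsto (tailProd p) atTop (𝓝 1) := by
  obtain ⟨h1, h2⟩ := tendsto_rjost_atTop hs (w := 1) (by simp)
  have := (h2.norm.pow 2).sub (h1.norm.pow 2)
  rw [norm_one, norm_zero, one_pow, zero_pow two_ne_zero, sub_zero] at this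
  exact this

end

/-! ### Jost solutions and the scattering matrix on the unit circle. -/

/-- The coefficient `b` on the unit circle, computed at site `n`. -/
noncomputable def circB (p : ℤ → ℂ) (n : ℤ) (z : ℂ) : ℂ :=
  z ^ (2 * n) * ((starRingEnd ℂ) (rjost₂ p n z⁻¹) * jost p n z⁻¹ 1
    - (starRingEnd ℂ) (rjost₁ p n z⁻¹) * jost p n z⁻¹ 0)

/-- The Jost solution normalized at `+∞`. -/
noncomputable def jostPlus (p : ℤ → ℂ) (z : ℂ) (n : ℤ) : Matrix (Fin 2) (Fin 2) ℂ :=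
  !![z ^ n * (tailProd p n : ℂ)⁻¹ * (starRingEnd ℂ) (rjost₂ p n z⁻¹),
      z ^ (-n) * (tailProd p n : ℂ)⁻¹ * rjost₁ p n z⁻¹;
    z ^ n * (tailProd p n : ℂ)⁻¹ * (starRingEnd ℂ) (rjost₁ p n z⁻¹),
      z ^ (-n) * (tailProd p n : ℂ)⁻¹ * rjost₂ p n z⁻¹]

/-- The Jost solution normalized at `-∞`. -/
noncomputable def jostMinus (p : ℤ → ℂ) (z : ℂ) (n : ℤ) : Matrix (Fin 2) (Fin 2) ℂ :=
  !![z ^ n * jost p n z⁻¹ 0, z ^ (-n) * (starRingEnd ℂ) (jost p n z⁻¹ 1);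
    z ^ n * jost p n z⁻¹ 1, z ^ (-n) * (starRingEnd ℂ) (jost p n z⁻¹ 0)]

section

variable {p : ℤ → ℂ} (hs : Summable fun n => ‖p n‖) {z : ℂ} (hz : ‖z‖ = 1)
include hs hz

theorem circB_succ (n : ℤ) : circB p (n + 1) z = circB p n z := by
  have hz0 : z ≠ 0 := by rintro rfl; simp at hz
  have hw : ‖z⁻¹‖ ≤ 1 := by rw [norm_inv, hz, inv_one]
  obtain ⟨h0, h1⟩ := jost_succ hs n hw
  obtain ⟨h2, h3⟩ := rjost_eq hs n hw
  have hconj : (starRingEnd ℂ) z⁻¹ = z := by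
    have := conj_zpow_of_norm_one hz (-1); simpa using this
  have e2 : z ^ (2 * (n + 1)) = z ^ 2 * z ^ (2 * n) := by
    rw [mul_add, zpow_add₀ hz0, mul_comm]; norm_cast
  unfold circB
  rw [h0, h1, h2, h3, e2]
  simp only [map_sub, map_mul, map_pow, Complex.conj_conj, hconj]
  field_simp
  ring

theorem circB_eq (m n : ℤ) : circB p m z = circB p n z := by
  suffices h : ∀ n, circB p n z = circB p 0 z by rw [h m, h n]
  intro n
  induction n using Int.induction_on with
  | zero => rfl
  | succ i ih => rw [circB_succ hs hz, ih]
  | pred i ih => rw [← ih, ← circB_succ hs hz, sub_add_cancel]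

theorem isJost_jostMinus : IsJost p z atBot (jostMinus p z) := by
  have hz0 : z ≠ 0 := by rintro rfl; simp at hz
  have hw : ‖z⁻¹‖ ≤ 1 := by rw [norm_inv, hz, inv_one]
  have hconj : (starRingEnd ℂ) z⁻¹ = z := by
    have := conj_zpow_of_norm_one hz (-1); simpa using this
  refine ⟨fun n => ?_, ?_⟩
  · obtain ⟨h0, h1⟩ := jost_succ hs n hw
    have e1 : z ^ (n + 1) = z * z ^ n := by rw [zpow_add₀ hz0, zpow_one, mul_comm]
    unfold jostMinus
    rw [h0, h1]
    ext i j
    fin_cases i <;> fin_cases j <;>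
      simp only [laxMatrix, Matrix.mul_apply, Fin.sum_univ_two, Matrix.of_apply,
        Matrix.cons_val', Matrix.cons_val_zero, Matrix.cons_val_one, Matrix.cons_val_fin_one,
        Fin.zero_eta, Fin.mk_one, e1, zpow_neg, map_add, map_mul, map_pow, hconj,
        Complex.conj_conj] <;> field_simp <;> ring
  · have h0 := tendsto_jost_atBot hs hw 0
    have h1 := tendsto_jost_atBot hs hw 1
    have h1' : ∀ k : ℤ → ℤ, Tendsto (fun n => z ^ k n * jost p n z⁻¹ 1) atBot (𝓝 0) := fun k => by
      refine squeeze_zero_norm (fun n => le_of_eq ?_) (tendsto_zero_iff_norm_tendsto_zero.1 h1)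
      rw [norm_mul, norm_zpow, hz, one_zpow, one_mul]
    refine tendsto_pi_nhds.2 fun i => tendsto_pi_nhds.2 fun j => ?_
    fin_cases i <;> fin_cases j <;>
      simp only [jostMinus, zPow, Matrix.mul_apply, Fin.sum_univ_two, Matrix.of_apply,
        Matrix.cons_val', Matrix.cons_val_zero, Matrix.cons_val_one, Matrix.cons_val_fin_one,
        Fin.zero_eta, Fin.mk_one, zero_mul, zero_add, add_zero, neg_neg]
    · refine h0.congr fun n => ?_
      rw [← mul_assoc, ← zpow_add₀ hz0]; simp
    · have h := (Complex.continuous_conj.tendsto _).comp (h1' fun n => 2 * n)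
      rw [map_zero] at h
      refine h.congr fun n => ?_
      simp only [Function.comp, map_mul, conj_zpow_of_norm_one hz]
      rw [← mul_assoc, ← zpow_add₀ hz0]; congr 2; ring
    · refine (h1' fun n => 2 * n).congr fun n => ?_
      rw [← mul_assoc, ← zpow_add₀ hz0]; congr 2; ring
    · have h := (Complex.continuous_conj.tendsto _).comp h0
      rw [Matrix.one_apply_eq, map_one] at h
      refine h.congr fun n => ?_
      rw [← mul_assoc, ← zpow_add₀ hz0]; simp

omit hz in
theorem tailProd_succ (n : ℤ) : tailProd p n = (1 - ‖p n‖ ^ 2) * tailProd p (n + 1) :=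
  rjost_normSq_sub hs n (w := 1) (by simp)

variable (hlt : ∀ n, ‖p n‖ < 1)
include hlt

theorem isJost_jostPlus : IsJost p z atTop (jostPlus p z) := by
  have hz0 : z ≠ 0 := by rintro rfl; simp at hz
  have hw : ‖z⁻¹‖ ≤ 1 := by rw [norm_inv, hz, inv_one]
  have hconj : (starRingEnd ℂ) z⁻¹ = z := by
    have := conj_zpow_of_norm_one hz (-1); simpa using this
  refine ⟨fun n => ?_, ?_⟩
  · obtain ⟨h2, h3⟩ := rjost_eq hs n hw
    have e1 : z ^ (n + 1) = z * z ^ n := by rw [zpow_add₀ hz0, zpow_one, mul_comm]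
    have hκ : (tailProd p n : ℂ)
        = (1 - p n * (starRingEnd ℂ) (p n)) * (tailProd p (n + 1) : ℂ) := by
      rw [tailProd_succ hs, Complex.mul_conj, Complex.normSq_eq_norm_sq]; push_cast; ring
    have hκ0 : (tailProd p n : ℂ) ≠ 0 := by exact_mod_cast (tailProd_pos hs hlt n).ne'
    have hκ1 : (tailProd p (n + 1) : ℂ) ≠ 0 := by exact_mod_cast (tailProd_pos hs hlt (n + 1)).ne'
    have hκi : (tailProd p (n + 1) : ℂ)⁻¹
        = (1 - p n * (starRingEnd ℂ) (p n)) * (tailProd p n : ℂ)⁻¹ := by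
      field_simp; rw [hκ, mul_comm]
    unfold jostPlus
    rw [h2, h3, hκi]
    ext i j
    fin_cases i <;> fin_cases j <;>
      simp only [laxMatrix, Matrix.mul_apply, Fin.sum_univ_two, Matrix.of_apply,
        Matrix.cons_val', Matrix.cons_val_zero, Matrix.cons_val_one, Matrix.cons_val_fin_one,
        Fin.zero_eta, Fin.mk_one, e1, zpow_neg, map_sub, map_mul, map_pow, hconj,
        Complex.conj_conj] <;> field_simp <;> ring
  · obtain ⟨h1, h2⟩ := tendsto_rjost_atTop hs hw
    have hκ : Tendsto (fun n => (tailProd p n : ℂ)⁻¹) atTop (𝓝 1) := by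
      have := (((Complex.continuous_ofReal.tendsto 1).comp (tendsto_tailProd hs)).inv₀
        (by simp))
      simpa [Function.comp_def] using this
    have h1 := hκ.mul h1
    have h2 := hκ.mul h2
    rw [mul_zero] at h1
    rw [mul_one] at h2
    have h1' : ∀ k : ℤ → ℤ, Tendsto (fun n => z ^ k n * ((tailProd p n : ℂ)⁻¹ * rjost₁ p n z⁻¹))
        atTop (𝓝 0) := fun k => by
      refine squeeze_zero_norm (fun n => le_of_eq ?_) (tendsto_zero_iff_norm_tendsto_zero.1 h1)
      rw [norm_mul, norm_zpow, hz, one_zpow, one_mul]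
    refine tendsto_pi_nhds.2 fun i => tendsto_pi_nhds.2 fun j => ?_
    fin_cases i <;> fin_cases j <;>
      simp only [jostPlus, zPow, Matrix.mul_apply, Fin.sum_univ_two, Matrix.of_apply,
        Matrix.cons_val', Matrix.cons_val_zero, Matrix.cons_val_one, Matrix.cons_val_fin_one,
        Fin.zero_eta, Fin.mk_one, zero_mul, zero_add, add_zero, neg_neg]
    · have h := (Complex.continuous_conj.tendsto _).comp h2
      rw [map_one] at h
      refine h.congr fun n => ?_
      simp only [Function.comp, map_mul, map_inv₀, Complex.conj_ofReal]
      rw [← mul_assoc, ← mul_assoc, ← zpow_add₀ hz0]; simp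
    · refine (h1' fun n => -(2 * n)).congr fun n => ?_
      rw [← mul_assoc, ← mul_assoc, ← mul_assoc, ← zpow_add₀ hz0]; congr 3; ring
    · have h := (Complex.continuous_conj.tendsto _).comp (h1' fun n => -(2 * n))
      rw [map_zero] at h
      refine h.congr fun n => ?_
      simp only [Function.comp, map_mul, conj_zpow_of_norm_one hz, map_inv₀, Complex.conj_ofReal]
      rw [← mul_assoc, ← mul_assoc, ← mul_assoc, ← zpow_add₀ hz0]; congr 3; ring
    · refine h2.congr fun n => ?_
      rw [← mul_assoc, ← mul_assoc, ← zpow_add₀ hz0]; simp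

/-- The left Jost vector on the circle in terms of the right ones. -/
theorem jost_eq_of_norm_one (n : ℤ) :
    (tailProd p n : ℂ) * jost p n z⁻¹ 0
      = discA p n z⁻¹ * (starRingEnd ℂ) (rjost₂ p n z⁻¹)
        + circB p n z * z ^ (-(2 * n)) * rjost₁ p n z⁻¹ ∧
    (tailProd p n : ℂ) * jost p n z⁻¹ 1
      = discA p n z⁻¹ * (starRingEnd ℂ) (rjost₁ p n z⁻¹)
        + circB p n z * z ^ (-(2 * n)) * rjost₂ p n z⁻¹ := by
  have hz0 : z ≠ 0 := by rintro rfl; simp at hz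
  have hκ : (tailProd p n : ℂ) = rjost₂ p n z⁻¹ * (starRingEnd ℂ) (rjost₂ p n z⁻¹)
      - rjost₁ p n z⁻¹ * (starRingEnd ℂ) (rjost₁ p n z⁻¹) := by
    rw [← rjost_normSq_eq_tailProd hs hlt n (w := z⁻¹) (by rw [norm_inv, hz, inv_one]),
      Complex.mul_conj, Complex.normSq_eq_norm_sq, Complex.mul_conj, Complex.normSq_eq_norm_sq]
    push_cast; ring
  have hzz : z ^ (2 * n) ≠ 0 := zpow_ne_zero _ hz0
  rw [hκ, circB, discA, zpow_neg]
  constructor <;> field_simp <;> ring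

/-- The first column is `jost_eq_of_norm_one` with the powers of `z` and the normalization restored;
the second is its complex conjugate. -/
theorem isScatteringMatrix_disc :
    IsScatteringMatrix p z !![discA p 0 z⁻¹, (starRingEnd ℂ) (circB p 0 z);
      circB p 0 z, (starRingEnd ℂ) (discA p 0 z⁻¹)] := by
  refine ⟨_, _, isJost_jostPlus hs hz hlt, isJost_jostMinus hs hz, fun n => ?_⟩
  have hz0 : z ≠ 0 := by rintro rfl; simp at hz
  have hκ0 : (tailProd p n : ℂ) ≠ 0 := by exact_mod_cast (tailProd_pos hs hlt n).ne'
  obtain ⟨h0, h1⟩ := jost_eq_of_norm_one hs hz hlt n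
  rw [← discA_eq hs n 0 (by rw [norm_inv, hz, inv_one]), ← circB_eq hs hz n 0]
  have h0' := congrArg (starRingEnd ℂ) h0
  have h1' := congrArg (starRingEnd ℂ) h1
  simp only [map_add, map_mul, Complex.conj_ofReal, Complex.conj_conj, conj_zpow_of_norm_one hz,
    neg_neg] at h0' h1'
  have e2 : z ^ (2 * n) = z ^ n * z ^ n := by rw [two_mul, zpow_add₀ hz0]
  rw [zpow_neg, e2] at h0 h1
  rw [e2] at h0' h1'
  have hzn : z ^ n ≠ 0 := zpow_ne_zero _ hz0
  have hk := mul_inv_cancel₀ hκ0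
  have hx := mul_inv_cancel₀ hzn
  rw [mul_inv] at h0 h1
  ext i j
  fin_cases i <;> fin_cases j <;>
    simp only [jostPlus, jostMinus, Matrix.mul_apply, Fin.sum_univ_two, Matrix.of_apply,
      Matrix.cons_val', Matrix.cons_val_zero, Matrix.cons_val_one, Matrix.cons_val_fin_one,
      Fin.zero_eta, Fin.mk_one, zpow_neg] <;> refine mul_left_cancel₀ hκ0 ?_
  · linear_combination z ^ n * h0 - (z ^ n * discA p n z⁻¹ * (starRingEnd ℂ) (rjost₂ p n z⁻¹)
      + (z ^ n)⁻¹ * circB p n z * (rjost₁ p n z⁻¹)) * hk + circB p n z * (rjost₁ p n z⁻¹) * (z ^ n)⁻¹ * hx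
  · linear_combination (z ^ n)⁻¹ * h1' - (z ^ n * (starRingEnd ℂ) (rjost₂ p n z⁻¹) * (starRingEnd ℂ) (circB p n z)
      + (z ^ n)⁻¹ * (rjost₁ p n z⁻¹) * (starRingEnd ℂ) (discA p n z⁻¹)) * hk + (starRingEnd ℂ) (circB p n z) * (starRingEnd ℂ) (rjost₂ p n z⁻¹) * z ^ n * hx
  · linear_combination z ^ n * h1 - (z ^ n * discA p n z⁻¹ * (starRingEnd ℂ) (rjost₁ p n z⁻¹)
      + (z ^ n)⁻¹ * circB p n z * (rjost₂ p n z⁻¹)) * hk + circB p n z * (rjost₂ p n z⁻¹) * (z ^ n)⁻¹ * hx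
  · linear_combination (z ^ n)⁻¹ * h0' - (z ^ n * (starRingEnd ℂ) (rjost₁ p n z⁻¹) * (starRingEnd ℂ) (circB p n z)
      + (z ^ n)⁻¹ * (rjost₂ p n z⁻¹) * (starRingEnd ℂ) (discA p n z⁻¹)) * hk + (starRingEnd ℂ) (circB p n z) * (starRingEnd ℂ) (rjost₁ p n z⁻¹) * z ^ n * hx

end

/-- The reflection coefficient of a summable potential with values in the unit disc. -/
theorem exists_isReflectionCoeff {p : ℤ → ℂ} (hs : Summable fun n => ‖p n‖)
    (hlt : ∀ n, ‖p n‖ < 1) :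
    IsReflectionCoeff p fun θ => circB p 0 (circlePt θ) / discA p 0 (circlePt θ)⁻¹ := fun θ =>
  ⟨_, isScatteringMatrix_disc hs (norm_circlePt θ) hlt, by
    simpa using discA_ne_zero hs hlt 0 (by rw [norm_inv, norm_circlePt, inv_one]), by simp⟩

/-! ### Uniqueness for the Riemann–Hilbert problem. -/

/-- If two functions on the disc have boundary values related by `z ↦ z⁻¹`, both are constant. -/
theorem eqOn_const_of_boundary_inv {F G : ℂ → ℂ} (hF : DiffContOnCl ℂ F (Metric.ball 0 1))
    (hG : DiffContOnCl ℂ G (Metric.ball 0 1)) (h : ∀ z, ‖z‖ = 1 → F z = G z⁻¹) :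
    Set.EqOn F (fun _ => G 0) (Metric.closedBall 0 1) ∧
      Set.EqOn G (fun _ => G 0) (Metric.closedBall 0 1) := by
  have hFball : Set.EqOn F (fun _ => G 0) (Metric.ball 0 1) := by
    intro w hw
    have hw1 : ‖w‖ < 1 := by simpa using hw
    have hden : ∀ u ∈ Metric.closedBall (0 : ℂ) 1, 1 - w * u ≠ 0 := by
      intro u hu h0
      have hu1 : ‖u‖ ≤ 1 := by simpa using hu
      have h1 : ‖w * u‖ < 1 := by
        rw [norm_mul]
        exact (mul_le_of_le_one_right (norm_nonneg _) hu1).trans_lt hw1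
      rw [← sub_eq_zero.1 h0, norm_one] at h1
      exact lt_irrefl _ h1
    -- In Cauchy's formula for `F w` the substitution `u = z⁻¹` turns `dz / (z - w)` into `du / (u
    -- (1 - w u))`. What remains is Cauchy's formula at the centre for `G u / (1 - w u)`,
    -- holomorphic because `|w| < 1`, so `F w = G 0`.
    have hH : DiffContOnCl ℂ (fun u => (1 - w * u)⁻¹ * G u) (Metric.ball 0 1) := by
      have h1 : Differentiable ℂ fun u : ℂ => 1 - w * u := by fun_prop
      have h2 := h1.diffContOnCl (s := Metric.ball (0 : ℂ) 1)
      have h3 := h2.inv (fun x hx => hden x (by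
        rwa [closure_ball _ one_ne_zero] at hx))
      exact h3.smul hG
    have e1 := hF.circleIntegral_sub_inv_smul hw
    have e2 := hH.circleIntegral_sub_inv_smul (Metric.mem_ball_self one_pos)
    have hpi : (2 * Real.pi * I : ℂ) ≠ 0 := Complex.two_pi_I_ne_zero
    have key : (∮ z in C(0, 1), (z - w)⁻¹ • F z)
        = ∮ u in C(0, 1), (u - 0)⁻¹ • ((1 - w * u)⁻¹ * G u) := by
      rw [circleIntegral, circleIntegral]
      have := intervalIntegral.integral_comp_sub_left (a := 0) (b := 2 * Real.pi)
        (fun θ => deriv (circleMap 0 1) θ • ((circleMap 0 1 θ - w)⁻¹ • F (circleMap 0 1 θ)))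
        (2 * Real.pi)
      rw [sub_self, sub_zero] at this
      rw [← this]
      refine intervalIntegral.integral_congr fun θ _ => ?_
      have hinv : circleMap 0 1 (2 * Real.pi - θ) = (circleMap 0 1 θ)⁻¹ := by
        simp only [circleMap, Complex.ofReal_one, one_mul, zero_add, ← Complex.exp_neg]
        push_cast
        rw [sub_mul, Complex.exp_sub, Complex.exp_two_pi_mul_I, Complex.exp_neg, one_div]
      have hn : ‖circleMap 0 1 θ‖ = 1 := by simp
      have hne : circleMap 0 1 θ ≠ 0 := by
        intro h0; rw [h0, norm_zero] at hn; exact zero_ne_one hn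
      have hd := hden (circleMap 0 1 θ) (by simp)
      simp only [deriv_circleMap, hinv, smul_eq_mul, sub_zero]
      rw [h _ (by rw [norm_inv, hn, inv_one]), inv_inv]
      have hd' : (circleMap 0 1 θ)⁻¹ - w ≠ 0 := by
        intro h0
        apply hd
        rw [← sub_eq_zero.1 h0]
        field_simp
        ring
      field_simp
    rw [key, e2] at e1
    have := mul_left_cancel₀ hpi e1
    simpa using this.symm
  have hFc : Set.EqOn F (fun _ => G 0) (Metric.closedBall 0 1) := by
    have hcl : closure (Metric.ball (0 : ℂ) 1) = Metric.closedBall 0 1 := closure_ball _ one_ne_zero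
    exact hFball.of_subset_closure (hcl ▸ hF.continuousOn) continuousOn_const
      Metric.ball_subset_closedBall hcl.ge
  refine ⟨hFc, ?_⟩
  have := Complex.eqOn_closure_of_eqOn_frontier Metric.isBounded_ball hG
    (diffContOnCl_const (c := G 0)) (fun z hz => ?_)
  · rwa [closure_ball _ one_ne_zero] at this
  · rw [frontier_ball _ one_ne_zero] at hz
    have hz1 : ‖z‖ = 1 := by simpa using hz
    have := h z⁻¹ (by rw [norm_inv, hz1, inv_one])
    rw [inv_inv] at this
    rw [← this]
    exact hFc (by simp [hz1])

/-- Unrestricted limits at every boundary point already force the boundary function to be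
continuous, so no regularity of `v` is needed. -/
theorem exists_diffContOnCl_extension {f : ℂ → ℂ} (hf : DifferentiableOn ℂ f (Metric.ball 0 1))
    {v : ℂ → ℂ} (hv : ∀ z, ‖z‖ = 1 → Tendsto f (𝓝[Metric.ball 0 1] z) (𝓝 (v z))) :
    ∃ F : ℂ → ℂ, DiffContOnCl ℂ F (Metric.ball 0 1) ∧ Set.EqOn F f (Metric.ball 0 1) ∧
      ∀ z, ‖z‖ = 1 → F z = v z := by
  have hcl : closure (Metric.ball (0 : ℂ) 1) = Metric.closedBall 0 1 := closure_ball _ one_ne_zero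
  have heq := extendFrom_extends hf.continuousOn
  refine ⟨extendFrom (Metric.ball 0 1) f, ⟨hf.congr heq, ?_⟩, heq, fun z hz => ?_⟩
  · refine continuousOn_extendFrom le_rfl fun x hx => ?_
    rw [hcl] at hx
    rcases (mem_closedBall_zero_iff.1 hx).lt_or_eq with h | h
    · exact ⟨f x, hf.continuousOn x (by simpa using h)⟩
    · exact ⟨v x, hv x h⟩
  · exact extendFrom_eq (by rw [hcl]; simp [hz]) (hv z hz)

theorem exists_circlePt {z : ℂ} (hz : ‖z‖ = 1) : ∃ θ : ℝ, z = circlePt θ :=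
  ⟨z.arg, by
    have := Complex.norm_mul_exp_arg_mul_I z
    rw [hz, Complex.ofReal_one, one_mul] at this
    exact this.symm⟩

/-- A function holomorphic off the unit circle, without jump, with a limit at infinity, is
constant. -/
theorem eq_of_no_jump {f : ℂ → ℂ} {c : ℂ} (hf : DifferentiableOn ℂ f {z | ‖z‖ ≠ 1})
    (hc : Tendsto f (Bornology.cobounded ℂ) (𝓝 c))
    (hj : ∀ θ : ℝ, ∃ v, Tendsto f (𝓝[{w | 1 < ‖w‖}] circlePt θ) (𝓝 v) ∧
      Tendsto f (𝓝[{w | ‖w‖ < 1}] circlePt θ) (𝓝 v)) {z : ℂ} (hz : ‖z‖ ≠ 1) : f z = c := by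
  have hj' : ∀ z : ℂ, ∃ v, ‖z‖ = 1 → Tendsto f (𝓝[{w | 1 < ‖w‖}] z) (𝓝 v) ∧
      Tendsto f (𝓝[{w | ‖w‖ < 1}] z) (𝓝 v) := fun z => by
    by_cases hz : ‖z‖ = 1
    · obtain ⟨θ, rfl⟩ := exists_circlePt hz
      obtain ⟨v, hv⟩ := hj θ
      exact ⟨v, fun _ => hv⟩
    · exact ⟨0, fun h => absurd h hz⟩
  choose v hv using hj'
  have hball : Metric.ball (0 : ℂ) 1 = {w | ‖w‖ < 1} := by ext; simp
  obtain ⟨F, hF, hFf, hFv⟩ := exists_diffContOnCl_extension (f := f) (v := v)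
    (hf.mono fun z hz => (mem_ball_zero_iff.1 hz).ne) (fun z hz => by rw [hball]; exact (hv z hz).2)
  set g : ℂ → ℂ := fun w => if w = 0 then c else f w⁻¹ with hg
  have hg0 : ∀ w, w ≠ 0 → g w = f w⁻¹ := fun w hw => if_neg hw
  -- The limit at infinity makes `0` a removable singularity of `f w⁻¹`.
  have hgd : DifferentiableOn ℂ g (Metric.ball 0 1) := by
    rw [← Complex.differentiableOn_compl_singleton_and_continuousAt_iff
      (Metric.ball_mem_nhds (0 : ℂ) one_pos)]
    constructor
    · have h1 : DifferentiableOn ℂ (fun w => f w⁻¹) (Metric.ball 0 1 \ {0}) := by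
        refine hf.comp (differentiableOn_inv.mono fun w hw => hw.2) fun w hw => ?_
        have h1 : ‖w‖ < 1 := mem_ball_zero_iff.1 hw.1
        have h2 : 0 < ‖w‖ := norm_pos_iff.2 hw.2
        change ‖w⁻¹‖ ≠ 1
        rw [norm_inv]
        exact (one_lt_inv₀ h2 |>.2 h1).ne'
      exact h1.congr fun w hw => hg0 w hw.2
    · have h1 : Tendsto (fun w => f w⁻¹) (𝓝[≠] 0) (𝓝 c) := hc.comp tendsto_inv₀_nhdsNE_zero
      rw [continuousAt_iff_punctured_nhds]
      have : g 0 = c := if_pos rfl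
      rw [this]
      exact h1.congr' (by filter_upwards [self_mem_nhdsWithin] with w hw using (hg0 w hw).symm)
  obtain ⟨G, hG, hGg, hGv⟩ := exists_diffContOnCl_extension (f := g) (v := fun w => v w⁻¹) hgd
    (fun z hz => by
      have hz0 : z ≠ 0 := by rintro rfl; simp at hz
      have h1 := (hv z⁻¹ (by rw [norm_inv, hz, inv_one])).1
      have h2 : Tendsto (fun w : ℂ => w⁻¹) (𝓝[Metric.ball 0 1] z) (𝓝[{w | 1 < ‖w‖}] z⁻¹) := by
        refine tendsto_nhdsWithin_iff.2
          ⟨((continuousAt_inv₀ hz0).tendsto).mono_left nhdsWithin_le_nhds, ?_⟩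
        filter_upwards [self_mem_nhdsWithin, nhdsWithin_le_nhds (isOpen_ne.mem_nhds hz0)]
          with w hw hw0
        rw [norm_inv]
        exact (one_lt_inv₀ (norm_pos_iff.2 hw0)).2 (mem_ball_zero_iff.1 hw)
      refine (h1.comp h2).congr' ?_
      filter_upwards [nhdsWithin_le_nhds (isOpen_ne.mem_nhds hz0)] with w hw0
      exact (hg0 w hw0).symm)
  have hG0 : G 0 = c := by rw [hGg (Metric.mem_ball_self one_pos)]; exact if_pos rfl
  obtain ⟨h1, h2⟩ := eqOn_const_of_boundary_inv hF hG fun z hz => by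
    rw [hFv z hz, hGv z⁻¹ (by rw [norm_inv, hz, inv_one]), inv_inv]
  rw [hG0] at h1 h2
  rcases hz.lt_or_gt with h | h
  · have hb : z ∈ Metric.ball (0 : ℂ) 1 := mem_ball_zero_iff.2 h
    rw [← hFf hb]
    exact h1 (Metric.ball_subset_closedBall hb)
  · have hz0 : z ≠ 0 := by rintro rfl; rw [norm_zero] at h; linarith
    have hb : z⁻¹ ∈ Metric.ball (0 : ℂ) 1 := by
      rw [mem_ball_zero_iff, norm_inv]; exact inv_lt_one_of_one_lt₀ h
    have h3 := h2 (Metric.ball_subset_closedBall hb)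
    rwa [hGg hb, hg0 _ (inv_ne_zero hz0), inv_inv] at h3

theorem det_jumpMatrix (r : ℝ → ℂ) (n : ℤ) (θ : ℝ) : (jumpMatrix r n θ).det = 1 := by
  have hz := circlePt_ne_zero θ
  have h2 : ((‖r θ‖ ^ 2 : ℝ) : ℂ) = r θ * (starRingEnd ℂ) (r θ) := by
    rw [Complex.mul_conj, Complex.normSq_eq_norm_sq]
  have h3 : ∀ k : ℤ, (zPow (circlePt θ) k).det = 1 := fun k => by
    rw [zPow, Matrix.det_fin_two_of, ← zpow_add₀ hz]; simp
  rw [jumpMatrix, Matrix.det_mul, Matrix.det_mul, h3, h3, Matrix.det_fin_two_of, h2]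
  ring

theorem IsRHSolution.tendsto_one {r : ℝ → ℂ} {n : ℤ} {M : ℂ → Matrix (Fin 2) (Fin 2) ℂ}
    (h : IsRHSolution r n M) : Tendsto M (Bornology.cobounded ℂ) (𝓝 1) := by
  refine tendsto_pi_nhds.2 fun i => tendsto_pi_nhds.2 fun j => ?_
  have h1 := (h.2.1 i j).trans_tendsto tendsto_inv₀_cobounded
  have h2 := h1.add_const ((1 : Matrix (Fin 2) (Fin 2) ℂ) i j)
  simpa using h2

/-- The jump matrix has determinant one, so `det M` has no jump and equals its value at infinity. In
particular `M` is invertible off the circle. -/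
theorem IsRHSolution.det_eq_one {r : ℝ → ℂ} {n : ℤ} {M : ℂ → Matrix (Fin 2) (Fin 2) ℂ}
    (h : IsRHSolution r n M) {z : ℂ} (hz : ‖z‖ ≠ 1) : (M z).det = 1 := by
  have hdet : Continuous fun A : Matrix (Fin 2) (Fin 2) ℂ => A.det := continuous_id.matrix_det
  refine eq_of_no_jump (f := fun z => (M z).det) ?_ ?_ (fun θ => ?_) hz
  · simp only [Matrix.det_fin_two]
    exact ((h.1 0 0).mul (h.1 1 1)).sub ((h.1 0 1).mul (h.1 1 0))
  · have := (hdet.tendsto 1).comp h.tendsto_one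
    rw [Matrix.det_one] at this
    exact this
  · obtain ⟨Mp, Mm, hp, hm, hj⟩ := h.2.2 θ
    refine ⟨Mp.det, (hdet.tendsto _).comp hp, ?_⟩
    have : Mp.det = Mm.det := by rw [hj, Matrix.det_mul, det_jumpMatrix, mul_one]
    rw [this]
    exact (hdet.tendsto _).comp hm

theorem tendsto_mul_adjugate_apply {X : Type*} {l : Filter X}
    {f g : X → Matrix (Fin 2) (Fin 2) ℂ} {A B : Matrix (Fin 2) (Fin 2) ℂ}
    (hf : Tendsto f l (𝓝 A)) (hg : Tendsto g l (𝓝 B)) (i j : Fin 2) :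
    Tendsto (fun z => (f z * (g z).adjugate) i j) l (𝓝 ((A * B.adjugate) i j)) := by
  have hadj : Continuous fun A : Matrix (Fin 2) (Fin 2) ℂ => A.adjugate :=
    continuous_id.matrix_adjugate
  have hij : Continuous fun A : Matrix (Fin 2) (Fin 2) ℂ => A i j := continuous_id.matrix_elem i j
  have h1 : Tendsto (fun z => (g z).adjugate) l (𝓝 B.adjugate) := (hadj.tendsto B).comp hg
  have h2 : Tendsto (fun z => f z * (g z).adjugate) l (𝓝 (A * B.adjugate)) := hf.mul h1
  exact (hij.tendsto _).comp h2

/-- Uniqueness for the Riemann–Hilbert problem. -/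
theorem IsRHSolution.eqOn {r : ℝ → ℂ} {n : ℤ} {M M' : ℂ → Matrix (Fin 2) (Fin 2) ℂ}
    (h : IsRHSolution r n M) (h' : IsRHSolution r n M') : Set.EqOn M' M {z | ‖z‖ ≠ 1} := by
  intro z hz
  -- The quotient `M' M⁻¹` has no jump. The adjugate stands for the inverse, which keeps the entries
  -- polynomial in those of `M` and `M'`.
  have hone : ∀ i j, (M' z * (M z).adjugate) i j = (1 : Matrix (Fin 2) (Fin 2) ℂ) i j := by
    intro i j
    refine eq_of_no_jump (f := fun z => (M' z * (M z).adjugate) i j) ?_ ?_ (fun θ => ?_) hz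
    · simp only [Matrix.mul_apply, Fin.sum_univ_two, Matrix.adjugate_fin_two]
      fin_cases j <;>
        simp only [Matrix.of_apply, Matrix.cons_val', Matrix.cons_val_zero, Matrix.cons_val_one,
          Matrix.cons_val_fin_one, Fin.zero_eta, Fin.mk_one]
      · exact ((h'.1 i 0).mul (h.1 1 1)).add ((h'.1 i 1).mul (h.1 1 0).neg)
      · exact ((h'.1 i 0).mul (h.1 0 1).neg).add ((h'.1 i 1).mul (h.1 0 0))
    · have := tendsto_mul_adjugate_apply h'.tendsto_one h.tendsto_one i j
      rwa [Matrix.adjugate_one, Matrix.mul_one] at this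
    · obtain ⟨Mp, Mm, hp, hm, hj⟩ := h.2.2 θ
      obtain ⟨Mp', Mm', hp', hm', hj'⟩ := h'.2.2 θ
      refine ⟨(Mp' * Mp.adjugate) i j, tendsto_mul_adjugate_apply hp' hp i j, ?_⟩
      have : Mp' * Mp.adjugate = Mm' * Mm.adjugate := by
        rw [hj, hj', Matrix.adjugate_mul_distrib, Matrix.mul_assoc,
          ← Matrix.mul_assoc _ _ Mm.adjugate, Matrix.mul_adjugate, det_jumpMatrix, one_smul,
          Matrix.one_mul]
      rw [this]
      exact tendsto_mul_adjugate_apply hm' hm i j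
  replace hone : M' z * (M z).adjugate = 1 := Matrix.ext hone
  have h1 : (M z).adjugate * M z = 1 := by
    rw [Matrix.adjugate_mul, h.det_eq_one hz, one_smul]
  calc M' z = M' z * ((M z).adjugate * M z) := by rw [h1, Matrix.mul_one]
    _ = M z := by rw [← Matrix.mul_assoc, hone, Matrix.one_mul]

/-! ### Explicit solution of the Riemann–Hilbert problem and recovery of `q`. -/

/-- Solution of the Riemann–Hilbert problem outside the unit circle, in the variable `1 / z`. -/
noncomputable def rhOut (p : ℤ → ℂ) (m : ℤ) (w : ℂ) : Matrix (Fin 2) (Fin 2) ℂ :=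
  !![jost p m w 0 / discA p m w, (tailProd p m : ℂ)⁻¹ * rjost₁ p m w;
    (tailProd p m : ℂ) * (jost p m w 1 / discA p m w), rjost₂ p m w]

/-- Solution of the Riemann–Hilbert problem inside the unit circle; here `p` is the conjugate
potential and `κ` the normalization. -/
noncomputable def rhIn (p : ℤ → ℂ) (κ : ℂ) (m : ℤ) (w : ℂ) : Matrix (Fin 2) (Fin 2) ℂ :=
  !![κ⁻¹ * rjost₂ p m w, jost p m w 1 / discA p m w;
    rjost₁ p m w, κ * (jost p m w 0 / discA p m w)]

section

variable {p : ℤ → ℂ} (hs : Summable fun n => ‖p n‖) (hlt : ∀ n, ‖p n‖ < 1) (m : ℤ)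
include hs hlt

omit hlt in
theorem diffContOnCl_jost (i : Fin 2) :
    DiffContOnCl ℂ (fun w => jost p m w i) (Metric.ball 0 1) := by
  refine ⟨differentiableOn_jost hs m i, ?_⟩
  rw [closure_ball _ one_ne_zero]
  exact continuousOn_jost hs m i

omit hlt in
theorem diffContOnCl_rjost :
    DiffContOnCl ℂ (rjost₁ p m) (Metric.ball 0 1) ∧
      DiffContOnCl ℂ (rjost₂ p m) (Metric.ball 0 1) :=
  ⟨diffContOnCl_jost (summable_reflect hs) (-m) 1,
    diffContOnCl_jost (summable_reflect hs) (-m) 0⟩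

theorem diffContOnCl_jost_div (i : Fin 2) :
    DiffContOnCl ℂ (fun w => jost p m w i / discA p m w) (Metric.ball 0 1) := by
  have h0 := diffContOnCl_jost hs m 0
  have h1 := diffContOnCl_jost hs m 1
  obtain ⟨h2, h3⟩ := diffContOnCl_rjost hs m
  have ha : DiffContOnCl ℂ (discA p m) (Metric.ball 0 1) := (h0.smul h3).sub (h1.smul h2)
  have hinv := ha.inv fun x hx => discA_ne_zero hs hlt m (by
    rw [closure_ball _ one_ne_zero] at hx; simpa using hx)
  simp only [div_eq_mul_inv]
  exact (diffContOnCl_jost hs m i).smul hinv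

theorem diffContOnCl_rhOut (i j : Fin 2) :
    DiffContOnCl ℂ (fun w => rhOut p m w i j) (Metric.ball 0 1) := by
  obtain ⟨h2, h3⟩ := diffContOnCl_rjost hs m
  fin_cases i <;> fin_cases j
  · exact diffContOnCl_jost_div hs hlt m 0
  · exact h2.const_smul (tailProd p m : ℂ)⁻¹
  · exact (diffContOnCl_jost_div hs hlt m 1).const_smul (tailProd p m : ℂ)
  · exact h3

theorem diffContOnCl_rhIn (κ : ℂ) (i j : Fin 2) :
    DiffContOnCl ℂ (fun w => rhIn p κ m w i j) (Metric.ball 0 1) := by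
  obtain ⟨h2, h3⟩ := diffContOnCl_rjost hs m
  fin_cases i <;> fin_cases j
  · exact h3.const_smul κ⁻¹
  · exact diffContOnCl_jost_div hs hlt m 1
  · exact h2
  · exact (diffContOnCl_jost_div hs hlt m 0).const_smul κ

omit hs hlt in
theorem rhOut_zero (i j : Fin 2) : rhOut p m 0 i j = (1 : Matrix (Fin 2) (Fin 2) ℂ) i j := by
  fin_cases i <;> fin_cases j <;> simp [rhOut, discA_zero, rjost₁, rjost₂, jost_zero]

/-- The jump relation on the unit circle. -/
theorem rhOut_eq_rhIn_mul {r : ℝ → ℂ} (hr : IsReflectionCoeff p r) (θ : ℝ) :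
    rhOut p m (circlePt θ)⁻¹ = rhIn (fun n => (starRingEnd ℂ) (p n)) (tailProd p m) m (circlePt θ)
      * jumpMatrix r m θ := by
  have hr' := congrFun (hr.unique (exists_isReflectionCoeff hs hlt)) θ
  have hz := norm_circlePt θ
  have hz0 := circlePt_ne_zero θ
  have hw : ‖(circlePt θ)⁻¹‖ ≤ 1 := by rw [norm_inv, hz, inv_one]
  rw [jumpMatrix, hr']
  set z := circlePt θ
  rw [circB_eq hs hz 0 m, discA_eq hs 0 m hw]
  have hκ0 : (tailProd p m : ℂ) ≠ 0 := by exact_mod_cast (tailProd_pos hs hlt m).ne'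
  have ha0 := discA_ne_zero hs hlt m hw
  obtain ⟨h0, h1⟩ := jost_eq_of_norm_one hs hz hlt m
  have hconj : (starRingEnd ℂ) z⁻¹ = z := by
    have := conj_zpow_of_norm_one hz (-1); simpa using this
  have hs' := summable_reflect hs
  -- On the circle the interior functions of the conjugate potential are the conjugates of the
  -- exterior ones. The jump relation then becomes a rational identity in the right Jost vector,
  -- `a`, `b` and their conjugates.
  have ej : ∀ i, jost (fun n => (starRingEnd ℂ) (p n)) m z i = (starRingEnd ℂ) (jost p m z⁻¹ i) :=
    fun i => by rw [← jost_conj hs m hw i, hconj]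
  have er1 : rjost₁ (fun n => (starRingEnd ℂ) (p n)) m z = (starRingEnd ℂ) (rjost₁ p m z⁻¹) := by
    unfold rjost₁; rw [reflect_conj, ← jost_conj hs' (-m) hw, hconj]
  have er2 : rjost₂ (fun n => (starRingEnd ℂ) (p n)) m z = (starRingEnd ℂ) (rjost₂ p m z⁻¹) := by
    unfold rjost₂; rw [reflect_conj, ← jost_conj hs' (-m) hw, hconj]
  have ea : discA (fun n => (starRingEnd ℂ) (p n)) m z = (starRingEnd ℂ) (discA p m z⁻¹) := by
    rw [← discA_conj hs m hw, hconj]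
  have hac : (starRingEnd ℂ) (discA p m z⁻¹) ≠ 0 := by simpa using ha0
  have hzm : z ^ m ≠ 0 := zpow_ne_zero _ hz0
  have e2 : z ^ (2 * m) = z ^ m * z ^ m := by rw [two_mul, zpow_add₀ hz0]
  have g0 := congrArg (starRingEnd ℂ) h0
  have g1 := congrArg (starRingEnd ℂ) h1
  simp only [map_add, map_mul, Complex.conj_ofReal, Complex.conj_conj, conj_zpow_of_norm_one hz,
    neg_neg] at g0 g1
  rw [zpow_neg, e2] at h0 h1
  rw [e2] at g0 g1
  rw [rhOut, rhIn, ej, ej, er1, er2, ea]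
  have hn : ∀ x : ℂ, ((‖x‖ ^ 2 : ℝ) : ℂ) = x * (starRingEnd ℂ) x := fun x => by
    rw [Complex.mul_conj, Complex.normSq_eq_norm_sq]
  simp only [hn, map_div₀]
  generalize (tailProd p m : ℂ) = κ at *
  generalize discA p m z⁻¹ = a at *
  generalize circB p m z = b at *
  generalize jost p m z⁻¹ 0 = x0 at *
  generalize jost p m z⁻¹ 1 = x1 at *
  generalize rjost₁ p m z⁻¹ = y1 at *
  generalize rjost₂ p m z⁻¹ = y2 at *
  have h0 := eq_div_of_mul_eq hκ0 ((mul_comm _ _).trans h0)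
  have h1 := eq_div_of_mul_eq hκ0 ((mul_comm _ _).trans h1)
  have g0 := eq_div_of_mul_eq hκ0 ((mul_comm _ _).trans g0)
  have g1 := eq_div_of_mul_eq hκ0 ((mul_comm _ _).trans g1)
  rw [g0, g1, h0, h1]
  generalize (starRingEnd ℂ) a = ac at *
  generalize (starRingEnd ℂ) b = bc at *
  generalize (starRingEnd ℂ) y1 = y1c at *
  generalize (starRingEnd ℂ) y2 = y2c at *
  ext i j
  fin_cases i <;> fin_cases j <;>
    simp only [zPow, Matrix.mul_apply, Fin.sum_univ_two, Matrix.of_apply,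
      Matrix.cons_val', Matrix.cons_val_zero, Matrix.cons_val_one, Matrix.cons_val_fin_one,
      Fin.zero_eta, Fin.mk_one, zpow_neg, neg_neg] <;>
    generalize z ^ m = x at * <;> field_simp <;> ring

/-- Existence for the Riemann–Hilbert problem, with recovery of the potential. -/
theorem exists_isRHSolution {r : ℝ → ℂ} (hr : IsReflectionCoeff p r) (n : ℤ) :
    ∃ M, IsRHSolution r (n + 1) M ∧
      Tendsto (fun z => M z 0 1 / z) (𝓝[≠] 0) (𝓝 (p n)) := by
  set pc : ℤ → ℂ := fun n => (starRingEnd ℂ) (p n) with hpc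
  have hsc : Summable fun n => ‖pc n‖ := by simpa [hpc] using hs
  have hltc : ∀ n, ‖pc n‖ < 1 := by simpa [hpc] using hlt
  have hO := diffContOnCl_rhOut hs hlt (n + 1)
  have hI := diffContOnCl_rhIn hsc hltc (n + 1) (tailProd p (n + 1))
  have hcl : closure (Metric.ball (0 : ℂ) 1) = Metric.closedBall 0 1 := closure_ball _ one_ne_zero
  let M : ℂ → Matrix (Fin 2) (Fin 2) ℂ := fun z =>
    if 1 < ‖z‖ then rhOut p (n + 1) z⁻¹ else rhIn pc (tailProd p (n + 1)) (n + 1) z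
  have hMo : ∀ z, 1 < ‖z‖ → M z = rhOut p (n + 1) z⁻¹ := fun z hz => if_pos hz
  have hMi : ∀ z, ‖z‖ < 1 → M z = rhIn pc (tailProd p (n + 1)) (n + 1) z := fun z hz =>
    if_neg hz.not_gt
  have hopen1 : IsOpen {z : ℂ | 1 < ‖z‖} := isOpen_lt continuous_const continuous_norm
  have hopen2 : IsOpen {z : ℂ | ‖z‖ < 1} := isOpen_lt continuous_norm continuous_const
  refine ⟨M, ⟨fun i j z hz => ?_, fun i j => ?_, fun θ => ?_⟩, ?_⟩
  · refine DifferentiableAt.differentiableWithinAt ?_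
    rcases lt_or_gt_of_ne hz with h | h
    · have h1 : DifferentiableAt ℂ (fun w => rhIn pc (tailProd p (n + 1)) (n + 1) w i j) z :=
        (hI i j).differentiableAt Metric.isOpen_ball (by simpa using h)
      refine h1.congr_of_eventuallyEq ?_
      filter_upwards [hopen2.mem_nhds h] with w hw
      rw [hMi w hw]
    · have hz0 : z ≠ 0 := by rintro rfl; rw [norm_zero] at h; linarith
      have h1 : DifferentiableAt ℂ (fun w => rhOut p (n + 1) w i j) z⁻¹ :=
        (hO i j).differentiableAt Metric.isOpen_ball (by
          rw [mem_ball_zero_iff, norm_inv]; exact inv_lt_one_of_one_lt₀ h)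
      refine (h1.comp z (differentiableAt_inv hz0)).congr_of_eventuallyEq ?_
      filter_upwards [hopen1.mem_nhds h] with w hw
      rw [hMo w hw]
      rfl
  · have h1 : DifferentiableAt ℂ (fun w => rhOut p (n + 1) w i j) 0 :=
      (hO i j).differentiableAt Metric.isOpen_ball (by simp)
    have h2 := h1.isBigO_sub.comp_tendsto (tendsto_inv₀_cobounded (α := ℂ))
    simp only [rhOut_zero, sub_zero] at h2
    refine h2.congr' ?_ EventuallyEq.rfl
    filter_upwards [(tendsto_norm_cobounded_atTop (E := ℂ)).eventually_gt_atTop 1] with w hw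
    simp only [Function.comp]
    rw [hMo w hw]
  · have hz := norm_circlePt θ
    have hz0 := circlePt_ne_zero θ
    refine ⟨rhOut p (n + 1) (circlePt θ)⁻¹, rhIn pc (tailProd p (n + 1)) (n + 1) (circlePt θ),
      ?_, ?_, rhOut_eq_rhIn_mul hs hlt (n + 1) hr θ⟩
    · have hto : Tendsto (fun w : ℂ => w⁻¹) (𝓝[{w | 1 < ‖w‖}] circlePt θ)
          (𝓝[closure (Metric.ball 0 1)] (circlePt θ)⁻¹) := by
        refine tendsto_nhdsWithin_iff.2
          ⟨((continuousAt_inv₀ hz0).tendsto).mono_left nhdsWithin_le_nhds, ?_⟩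
        filter_upwards [self_mem_nhdsWithin] with w hw
        rw [hcl, mem_closedBall_zero_iff, norm_inv]
        exact (inv_lt_one_of_one_lt₀ hw).le
      refine tendsto_pi_nhds.2 fun i => tendsto_pi_nhds.2 fun j => ?_
      have h1 := (hO i j).continuousOn (circlePt θ)⁻¹ (by rw [hcl]; simp [hz])
      refine (Tendsto.comp h1 hto).congr' ?_
      filter_upwards [self_mem_nhdsWithin] with w hw
      rw [hMo w hw]
      rfl
    · refine tendsto_pi_nhds.2 fun i => tendsto_pi_nhds.2 fun j => ?_
      have h1 := (hI i j).continuousOn (circlePt θ) (by rw [hcl]; simp [hz])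
      have h2 := h1.mono_left (nhdsWithin_mono (circlePt θ) (s := {w | ‖w‖ < 1}) (fun w hw => by
        rw [hcl, mem_closedBall_zero_iff]; exact le_of_lt hw))
      refine h2.congr' ?_
      filter_upwards [self_mem_nhdsWithin] with w hw
      rw [hMi w hw]
  -- The `(0, 1)` entry inside is `jost pc (n+1) z 1 / discA pc (n+1) z`. The denominator tends to
  -- `1`, and the numerator over `z` tends to the conjugate of `pc n`, that is to `p n`.
  · have h1 := tendsto_jost_div hsc n
    have ha : ContinuousAt (discA pc (n + 1)) 0 := by
      have h0 := fun i => diffContOnCl_jost hsc (n + 1) i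
      obtain ⟨h2, h3⟩ := diffContOnCl_rjost hsc (n + 1)
      have ha : DiffContOnCl ℂ (discA pc (n + 1)) (Metric.ball 0 1) :=
        ((h0 0).smul h3).sub ((h0 1).smul h2)
      exact (ha.differentiableAt Metric.isOpen_ball (Metric.mem_ball_self one_pos)).continuousAt
    have ha' := ha.tendsto.mono_left (nhdsWithin_le_nhds (s := {0}ᶜ))
    rw [discA_zero] at ha'
    have h2 := h1.div ha' one_ne_zero
    rw [div_one, hpc, Complex.conj_conj] at h2
    refine h2.congr' ?_
    filter_upwards [nhdsWithin_le_nhds (Metric.ball_mem_nhds (0 : ℂ) one_pos)] with w hw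
    rw [hMi w (by simpa using hw)]
    simp only [rhIn, Matrix.of_apply, Matrix.cons_val', Matrix.cons_val_zero, Matrix.cons_val_one,
      Matrix.cons_val_fin_one]
    rw [div_right_comm]
    rfl

end

/-! ### Families uniformly bounded in `H^k`. -/

/-- A family of smooth periodic functions that is bounded in the Sobolev space `H^k`. -/
def BddH {ι : Type*} (k : ℕ) (f : ι → ℝ → ℂ) : Prop :=
  (∀ i, ContDiff ℝ ∞ (f i)) ∧ (∀ i, Function.Periodic (f i) (2 * Real.pi)) ∧
    ∀ j ≤ k, ∃ C : ℝ, ∀ i, ∫ θ in (-Real.pi)..Real.pi, ‖iteratedDeriv j (f i) θ‖ ^ 2 ≤ C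

section

variable {ι : Type*} {k l : ℕ} {f g : ι → ℝ → ℂ}

theorem contDiff_deriv {f : ℝ → ℂ} (hf : ContDiff ℝ ∞ f) : ContDiff ℝ ∞ (deriv f) :=
  (contDiff_infty_iff_deriv.1 hf).2

theorem periodic_deriv {f : ℝ → ℂ} {c : ℝ} (hf : Function.Periodic f c) :
    Function.Periodic (deriv f) c := fun x => by
  rw [← deriv_comp_add_const, funext hf]

theorem integral_mono_sq {u v : ℝ → ℝ} (hu : Continuous u) (hv : Continuous v)
    (h : ∀ θ, u θ ≤ v θ) :
    ∫ θ in (-Real.pi)..Real.pi, u θ ≤ ∫ θ in (-Real.pi)..Real.pi, v θ :=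
  intervalIntegral.integral_mono_on (by linarith [Real.pi_pos]) (hu.intervalIntegrable _ _)
    (hv.intervalIntegrable _ _) fun θ _ => h θ

theorem BddH.mono (hf : BddH k f) (h : l ≤ k) : BddH l f :=
  ⟨hf.1, hf.2.1, fun j hj => hf.2.2 j (hj.trans h)⟩

theorem bddH_succ : BddH (k + 1) f ↔ BddH 0 f ∧ BddH k (fun i => deriv (f i)) := by
  constructor
  · intro h
    refine ⟨h.mono (Nat.zero_le _), fun i => contDiff_deriv (h.1 i), fun i =>
      periodic_deriv (h.2.1 i), fun j hj => ?_⟩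
    obtain ⟨C, hC⟩ := h.2.2 (j + 1) (by omega)
    exact ⟨C, fun i => by rw [← iteratedDeriv_succ']; exact hC i⟩
  · rintro ⟨h0, h1⟩
    refine ⟨h0.1, h0.2.1, fun j hj => ?_⟩
    rcases j with _ | j
    · exact h0.2.2 0 le_rfl
    · obtain ⟨C, hC⟩ := h1.2.2 j (by omega)
      exact ⟨C, fun i => by rw [iteratedDeriv_succ']; exact hC i⟩

theorem bddH_zero_of_norm_le (hs : ∀ i, ContDiff ℝ ∞ (f i))
    (hp : ∀ i, Function.Periodic (f i) (2 * Real.pi)) (hg : BddH 0 g) {C : ℝ}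
    (h : ∀ i θ, ‖f i θ‖ ≤ C * ‖g i θ‖) : BddH 0 f := by
  refine ⟨hs, hp, fun j hj => ?_⟩
  obtain rfl : j = 0 := by omega
  obtain ⟨D, hD⟩ := hg.2.2 0 le_rfl
  refine ⟨C ^ 2 * D, fun i => ?_⟩
  have hfc := (hs i).continuous
  have hgc := (hg.1 i).continuous
  have h1 := integral_mono_sq (u := fun θ => ‖f i θ‖ ^ 2) (v := fun θ => C ^ 2 * ‖g i θ‖ ^ 2)
    (by fun_prop) (by fun_prop) fun θ => by
      rw [← mul_pow]; exact pow_le_pow_left₀ (norm_nonneg _) (h i θ) 2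
  rw [intervalIntegral.integral_const_mul] at h1
  have h2 := hD i
  simp only [iteratedDeriv_zero] at h2 ⊢
  exact h1.trans (mul_le_mul_of_nonneg_left h2 (sq_nonneg _))

theorem bddH_const_one : BddH 0 (fun (_ : ι) (_ : ℝ) => (1 : ℂ)) :=
  ⟨fun _ => contDiff_const, fun _ _ => rfl, fun j hj => ⟨2 * Real.pi, fun i => by
    obtain rfl : j = 0 := by omega
    simp [two_mul]⟩⟩

theorem bddH_zero_of_bounded (hs : ∀ i, ContDiff ℝ ∞ (f i))
    (hp : ∀ i, Function.Periodic (f i) (2 * Real.pi)) {C : ℝ} (h : ∀ i θ, ‖f i θ‖ ≤ C) :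
    BddH 0 f :=
  bddH_zero_of_norm_le hs hp bddH_const_one (C := C) fun i θ => by simpa using h i θ

theorem BddH.add (hf : BddH k f) (hg : BddH k g) : BddH k (fun i θ => f i θ + g i θ) := by
  refine ⟨fun i => (hf.1 i).add (hg.1 i), fun i => (hf.2.1 i).add (hg.2.1 i), fun j hj => ?_⟩
  obtain ⟨C, hC⟩ := hf.2.2 j hj
  obtain ⟨D, hD⟩ := hg.2.2 j hj
  refine ⟨2 * C + 2 * D, fun i => ?_⟩
  have hj' : ((j : ℕ∞) : WithTop ℕ∞) ≤ ∞ := by exact_mod_cast le_top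
  have hfc := (hf.1 i).continuous_iteratedDeriv j hj'
  have hgc := (hg.1 i).continuous_iteratedDeriv j hj'
  have heq : iteratedDeriv j (fun θ => f i θ + g i θ)
      = fun θ => iteratedDeriv j (f i) θ + iteratedDeriv j (g i) θ := by
    funext θ
    exact iteratedDeriv_fun_add ((hf.1 i).of_le hj').contDiffAt ((hg.1 i).of_le hj').contDiffAt
  rw [heq]
  have h1 := integral_mono_sq
    (u := fun θ => ‖iteratedDeriv j (f i) θ + iteratedDeriv j (g i) θ‖ ^ 2)
    (v := fun θ => 2 * ‖iteratedDeriv j (f i) θ‖ ^ 2 + 2 * ‖iteratedDeriv j (g i) θ‖ ^ 2)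
    (by fun_prop) (by fun_prop) fun θ => by
      have := pow_le_pow_left₀ (norm_nonneg _)
        (norm_add_le (iteratedDeriv j (f i) θ) (iteratedDeriv j (g i) θ)) 2
      nlinarith [sq_nonneg (‖iteratedDeriv j (f i) θ‖ - ‖iteratedDeriv j (g i) θ‖)]
  rw [intervalIntegral.integral_add
    ((by fun_prop : Continuous fun θ => 2 * ‖iteratedDeriv j (f i) θ‖ ^ 2).intervalIntegrable _ _)
    ((by fun_prop : Continuous fun θ => 2 * ‖iteratedDeriv j (g i) θ‖ ^ 2).intervalIntegrable _ _),
    intervalIntegral.integral_const_mul, intervalIntegral.integral_const_mul] at h1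
  have := hC i
  have := hD i
  linarith

theorem BddH.neg (hf : BddH k f) : BddH k (fun i θ => -f i θ) := by
  refine ⟨fun i => (hf.1 i).neg, fun i x => congrArg Neg.neg (hf.2.1 i x), fun j hj => ?_⟩
  obtain ⟨C, hC⟩ := hf.2.2 j hj
  refine ⟨C, fun i => ?_⟩
  simpa [iteratedDeriv_fun_neg] using hC i

/-- A bounded family in `H^1` is uniformly bounded. -/
theorem BddH.exists_bound (hf : BddH (k + 1) f) : ∃ C, ∀ i θ, ‖f i θ‖ ≤ C := by
  obtain ⟨A, hA⟩ := hf.2.2 0 (by omega)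
  obtain ⟨B, hB⟩ := hf.2.2 1 (by omega)
  have hπ := Real.pi_pos
  refine ⟨√((2 * A + 2 * (2 * Real.pi * (2 * Real.pi + B) ^ 2)) / (2 * Real.pi)), fun i θ => ?_⟩
  have hfc := (hf.1 i).continuous
  have hdc := (contDiff_deriv (hf.1 i)).continuous
  have hd : Differentiable ℝ (f i) := (hf.1 i).differentiable (by simp)
  have hAi := hA i
  have hBi := hB i
  simp only [iteratedDeriv_zero, iteratedDeriv_one] at hAi hBi
  obtain ⟨x, hx, hxθ⟩ := (hf.2.1 i).exists_mem_Ioc (by positivity) θ (-Real.pi)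
  rw [hxθ]
  have hx' : x ∈ Set.Icc (-Real.pi) Real.pi := ⟨hx.1.le, by linarith [hx.2]⟩
  -- The oscillation over a period is at most `∫ |f'| ≤ ∫ (1 + |f'|²) ≤ 2π + B`.
  have hD : ∀ y ∈ Set.Icc (-Real.pi) Real.pi, ‖f i x - f i y‖ ≤ 2 * Real.pi + B := by
    intro y hy
    rw [← intervalIntegral.integral_deriv_eq_sub (fun z _ => hd z) (hdc.intervalIntegrable y x)]
    refine (intervalIntegral.norm_integral_le_abs_integral_norm).trans ?_
    have h1 : |∫ z in y..x, ‖deriv (f i) z‖| ≤ ∫ z in (-Real.pi)..Real.pi, ‖deriv (f i) z‖ := by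
      have : ∫ z in (-Real.pi)..Real.pi, ‖deriv (f i) z‖
          = |∫ z in (-Real.pi)..Real.pi, ‖deriv (f i) z‖| := by
        rw [abs_of_nonneg]
        exact intervalIntegral.integral_nonneg (by linarith) fun _ _ => norm_nonneg _
      rw [this]
      refine intervalIntegral.abs_integral_mono_interval ?_
        (Eventually.of_forall fun _ => norm_nonneg _) (hdc.norm.intervalIntegrable _ _)
      rw [Set.uIoc_of_le (by linarith : -Real.pi ≤ Real.pi), Set.uIoc]
      exact Set.Ioc_subset_Ioc (le_min hy.1 hx'.1) (max_le hy.2 hx'.2)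
    have h2 := integral_mono_sq (u := fun z => ‖deriv (f i) z‖)
      (v := fun z => 1 + ‖deriv (f i) z‖ ^ 2) (by fun_prop) (by fun_prop) fun z => by
        nlinarith [sq_nonneg (‖deriv (f i) z‖ - 1)]
    rw [intervalIntegral.integral_add (continuous_const.intervalIntegrable _ _)
      ((by fun_prop : Continuous fun z => ‖deriv (f i) z‖ ^ 2).intervalIntegrable _ _)] at h2
    simp only [intervalIntegral.integral_const, smul_eq_mul, mul_one] at h2
    linarith
  refine Real.le_sqrt_of_sq_le ?_
  rw [le_div_iff₀ (by positivity)]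
  -- Averaging `|f x|² ≤ 2|f y|² + 2(2π + B)²` over `y` bounds the value at one point by the `L²`
  -- norm.
  have h3 : ∫ y in (-Real.pi)..Real.pi, ‖f i x‖ ^ 2
      ≤ ∫ y in (-Real.pi)..Real.pi, (2 * ‖f i y‖ ^ 2 + 2 * (2 * Real.pi + B) ^ 2) := by
    refine intervalIntegral.integral_mono_on (by linarith) (by simp)
      ((by fun_prop : Continuous fun y =>
        2 * ‖f i y‖ ^ 2 + 2 * (2 * Real.pi + B) ^ 2).intervalIntegrable _ _) fun y hy => ?_
    have h4 := hD y hy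
    have h5 : ‖f i x‖ ≤ ‖f i y‖ + ‖f i x - f i y‖ := by
      have := norm_add_le (f i y) (f i x - f i y)
      rwa [add_sub_cancel] at this
    have h6 : ‖f i x‖ ^ 2 ≤ (‖f i y‖ + (2 * Real.pi + B)) ^ 2 :=
      pow_le_pow_left₀ (norm_nonneg _) (h5.trans (by linarith)) 2
    nlinarith [sq_nonneg (‖f i y‖ - (2 * Real.pi + B))]
  rw [intervalIntegral.integral_add
    ((by fun_prop : Continuous fun y => 2 * ‖f i y‖ ^ 2).intervalIntegrable _ _)
    (continuous_const.intervalIntegrable _ _), intervalIntegral.integral_const_mul] at h3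
  simp only [intervalIntegral.integral_const, smul_eq_mul] at h3
  linarith

theorem deriv_mul_family (hf : ∀ i, ContDiff ℝ ∞ (f i)) (hg : ∀ i, ContDiff ℝ ∞ (g i)) (i : ι) :
    deriv (fun θ => f i θ * g i θ) = fun θ => deriv (f i) θ * g i θ + f i θ * deriv (g i) θ := by
  funext θ
  exact deriv_fun_mul ((hf i).differentiable (by simp) θ) ((hg i).differentiable (by simp) θ)

theorem bddH_zero_mul {C : ℝ} (hf : ∀ i, ContDiff ℝ ∞ (f i))
    (hfp : ∀ i, Function.Periodic (f i) (2 * Real.pi)) (hC : ∀ i θ, ‖f i θ‖ ≤ C)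
    (hg : BddH 0 g) : BddH 0 (fun i θ => f i θ * g i θ) :=
  bddH_zero_of_norm_le (fun i => (hf i).mul (hg.1 i)) (fun i => (hfp i).mul (hg.2.1 i)) hg (C := C)
    fun i θ => by
      rw [norm_mul]; exact mul_le_mul_of_nonneg_right (hC i θ) (norm_nonneg _)

/-- `H^k` is a module over `H^{k+1}`, uniformly. -/
theorem BddH.mul_of_succ (hf : BddH (k + 1) f) (hg : BddH k g) :
    BddH k (fun i θ => f i θ * g i θ) := by
  induction k generalizing f g with
  | zero =>
    obtain ⟨C, hC⟩ := hf.exists_bound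
    exact bddH_zero_mul hf.1 hf.2.1 hC hg
  | succ k ih =>
    obtain ⟨C, hC⟩ := hf.exists_bound
    refine bddH_succ.2 ⟨bddH_zero_mul hf.1 hf.2.1 hC (hg.mono (Nat.zero_le _)), ?_⟩
    simp only [deriv_mul_family hf.1 hg.1]
    exact (ih (bddH_succ.1 hf).2 (hg.mono (Nat.le_succ _))).add
      (ih (hf.mono (Nat.le_succ _)) (bddH_succ.1 hg).2)

/-- `H^{k+1}` is an algebra, uniformly. -/
theorem BddH.mul (hf : BddH (k + 1) f) (hg : BddH (k + 1) g) :
    BddH (k + 1) (fun i θ => f i θ * g i θ) := by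
  obtain ⟨C, hC⟩ := hf.exists_bound
  refine bddH_succ.2 ⟨bddH_zero_mul hf.1 hf.2.1 hC (hg.mono (Nat.zero_le _)), ?_⟩
  simp only [deriv_mul_family hf.1 hg.1]
  refine BddH.add ?_ (hf.mul_of_succ (bddH_succ.1 hg).2)
  simp only [mul_comm (deriv (f _) _)]
  exact hg.mul_of_succ (bddH_succ.1 hf).2

/-- Inverses of a family in `H^{k+1}` that is bounded away from zero. -/
theorem BddH.inv (hf : BddH (k + 1) f) {δ : ℝ} (hδ : 0 < δ) (h : ∀ i θ, δ ≤ ‖f i θ‖) :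
    BddH (k + 1) (fun i θ => (f i θ)⁻¹) := by
  have hne : ∀ i θ, f i θ ≠ 0 := fun i θ => norm_pos_iff.1 (hδ.trans_le (h i θ))
  have hs : ∀ i, ContDiff ℝ ∞ fun θ => (f i θ)⁻¹ := fun i => (hf.1 i).inv (hne i)
  have hp : ∀ i, Function.Periodic (fun θ => (f i θ)⁻¹) (2 * Real.pi) := fun i x =>
    congrArg Inv.inv (hf.2.1 i x)
  have hb : ∀ i θ, ‖(f i θ)⁻¹‖ ≤ δ⁻¹ := fun i θ => by
    rw [norm_inv]; exact inv_anti₀ hδ (h i θ)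
  -- The derivative is a product of `f⁻¹` twice with `f'`. Membership of `f⁻¹` at one order
  -- therefore yields it at the next, since `H^{k+1}` is an algebra.
  have hd : ∀ i, deriv (fun θ => (f i θ)⁻¹)
      = fun θ => -((f i θ)⁻¹ * ((f i θ)⁻¹ * deriv (f i) θ)) := fun i => by
    funext θ
    rw [deriv_fun_inv'' ((hf.1 i).differentiable (by simp) θ) (hne i θ)]
    have := hne i θ
    field_simp
  induction k with
  | zero =>
    refine bddH_succ.2 ⟨bddH_zero_of_bounded hs hp hb, ?_⟩
    simp only [hd]
    exact (bddH_zero_mul hs hp hb (bddH_zero_mul hs hp hb (bddH_succ.1 hf).2)).neg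
  | succ k ih =>
    refine bddH_succ.2 ⟨bddH_zero_of_bounded hs hp hb, ?_⟩
    simp only [hd]
    have h1 := ih (hf.mono (Nat.le_succ _))
    exact (h1.mul (h1.mul (bddH_succ.1 hf).2)).neg

end

/-! ### Trigonometric polynomials and coefficient majorants. -/

/-- The trigonometric polynomial with coefficients `c` and frequencies `ν`. -/
noncomputable def trigSum {ι : Type*} [Fintype ι] (c : ι → ℂ) (ν : ι → ℤ) (θ : ℝ) : ℂ :=
  ∑ i, c i * circlePt θ ^ ν i

theorem circlePt_zpow (θ : ℝ) (n : ℤ) : circlePt θ ^ n = exp ((n : ℂ) * I * θ) := by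
  rw [circlePt, ← Complex.exp_int_mul]
  ring_nf

theorem circlePt_periodic (θ : ℝ) : circlePt (θ + 2 * Real.pi) = circlePt θ := by
  simp only [circlePt]
  push_cast
  rw [add_mul, Complex.exp_add, Complex.exp_two_pi_mul_I, mul_one]

theorem hasDerivAt_circlePt_zpow (n : ℤ) (θ : ℝ) :
    HasDerivAt (fun θ => circlePt θ ^ n) ((n : ℂ) * I * circlePt θ ^ n) θ := by
  simp only [circlePt_zpow]
  have h := ((hasDerivAt_id (θ : ℂ)).const_mul ((n : ℂ) * I)).cexp.comp_ofReal
  refine h.congr_deriv ?_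
  simp only [id]
  ring

theorem contDiff_circlePt_zpow (n : ℤ) : ContDiff ℝ ∞ fun θ => circlePt θ ^ n := by
  simp only [circlePt_zpow]
  exact ((contDiff_const (c := (n : ℂ) * I)).mul Complex.ofRealCLM.contDiff).cexp

section

variable {ι : Type*} [Fintype ι] (c : ι → ℂ) (ν : ι → ℤ)

theorem contDiff_trigSum : ContDiff ℝ ∞ (trigSum c ν) :=
  ContDiff.sum fun i _ => contDiff_const.mul (contDiff_circlePt_zpow (ν i))

theorem periodic_trigSum : Function.Periodic (trigSum c ν) (2 * Real.pi) := fun θ => by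
  simp only [trigSum, circlePt_periodic]

theorem deriv_trigSum : deriv (trigSum c ν) = trigSum (fun i => c i * ((ν i : ℂ) * I)) ν := by
  funext θ
  have := HasDerivAt.fun_sum (u := Finset.univ) fun i _ =>
    (hasDerivAt_circlePt_zpow (ν i) θ).const_mul (c i)
  rw [show trigSum c ν = fun θ => ∑ i, c i * circlePt θ ^ ν i from rfl, this.deriv]
  simp only [trigSum, mul_assoc]

theorem iteratedDeriv_trigSum (k : ℕ) :
    iteratedDeriv k (trigSum c ν) = trigSum (fun i => c i * ((ν i : ℂ) * I) ^ k) ν := by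
  induction k with
  | zero => simp
  | succ k ih => rw [iteratedDeriv_succ, ih, deriv_trigSum]; simp only [pow_succ, mul_assoc]

theorem integral_circlePt_zpow (n : ℤ) :
    ∫ θ in (-Real.pi)..Real.pi, circlePt θ ^ n = if n = 0 then (2 * Real.pi : ℂ) else 0 := by
  split_ifs with h
  · subst h; simp [two_mul]
  · simp only [circlePt_zpow]
    have hc : (n : ℂ) * I ≠ 0 := mul_ne_zero (Int.cast_ne_zero.2 h) I_ne_zero
    rw [integral_exp_mul_complex hc, div_eq_zero_iff]
    left
    have h1 := circlePt_periodic (-Real.pi)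
    rw [show -Real.pi + 2 * Real.pi = Real.pi by ring] at h1
    rw [← circlePt_zpow, ← circlePt_zpow, h1, sub_self]

/-- The frequencies may repeat, as they do after multiplying two such sums, so Parseval's identity
retains a double sum over coinciding frequencies. -/
theorem integral_normSq_trigSum :
    ((∫ θ in (-Real.pi)..Real.pi, ‖trigSum c ν θ‖ ^ 2 : ℝ) : ℂ)
      = ∑ i, ∑ j, c i * (starRingEnd ℂ) (c j) * if ν i = ν j then (2 * Real.pi : ℂ) else 0 := by
  rw [← intervalIntegral.integral_ofReal]
  have h : ∀ θ : ℝ, ((‖trigSum c ν θ‖ ^ 2 : ℝ) : ℂ)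
      = ∑ i, ∑ j, c i * (starRingEnd ℂ) (c j) * circlePt θ ^ (ν i - ν j) := fun θ => by
    rw [← Complex.normSq_eq_norm_sq, ← Complex.mul_conj, trigSum, map_sum, Finset.sum_mul_sum]
    refine Finset.sum_congr rfl fun i _ => Finset.sum_congr rfl fun j _ => ?_
    rw [map_mul, conj_zpow_of_norm_one (norm_circlePt θ), sub_eq_add_neg,
      zpow_add₀ (circlePt_ne_zero θ)]
    ring
  have hc : ∀ i j, Continuous fun θ => c i * (starRingEnd ℂ) (c j) * circlePt θ ^ (ν i - ν j) :=
    fun i j => continuous_const.mul (contDiff_circlePt_zpow _).continuous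
  simp only [h]
  rw [intervalIntegral.integral_finsetSum fun i _ =>
    (continuous_finsetSum _ fun j _ => hc i j).intervalIntegrable _ _]
  refine Finset.sum_congr rfl fun i _ => ?_
  rw [intervalIntegral.integral_finsetSum fun j _ => (hc i j).intervalIntegrable _ _]
  refine Finset.sum_congr rfl fun j _ => ?_
  rw [intervalIntegral.integral_const_mul, integral_circlePt_zpow]
  simp only [sub_eq_zero]

theorem integral_normSq_trigSum_le {d : ι → ℝ} (h : ∀ i, ‖c i‖ ≤ d i) :
    ∫ θ in (-Real.pi)..Real.pi, ‖trigSum c ν θ‖ ^ 2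
      ≤ ∑ i, ∑ j, d i * d j * if ν i = ν j then 2 * Real.pi else 0 := by
  have hI : 0 ≤ ∫ θ in (-Real.pi)..Real.pi, ‖trigSum c ν θ‖ ^ 2 :=
    intervalIntegral.integral_nonneg (by linarith [Real.pi_pos]) fun _ _ => sq_nonneg _
  rw [← abs_of_nonneg hI, ← Real.norm_eq_abs, ← Complex.norm_real, integral_normSq_trigSum]
  refine norm_sum_le_of_le _ fun i _ => norm_sum_le_of_le _ fun j _ => ?_
  have hd : 0 ≤ d i := (norm_nonneg _).trans (h i)
  rw [norm_mul, norm_mul, RCLike.norm_conj]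
  refine mul_le_mul (mul_le_mul (h i) (h j) (norm_nonneg _) hd) ?_ (norm_nonneg _)
    (mul_nonneg hd ((norm_nonneg _).trans (h j)))
  split_ifs
  · simp [abs_of_pos Real.pi_pos]
  · simp

theorem integral_normSq_trigSum_of_nonneg (d : ι → ℝ) :
    ∫ θ in (-Real.pi)..Real.pi, ‖trigSum (fun i => (d i : ℂ)) ν θ‖ ^ 2
      = ∑ i, ∑ j, d i * d j * if ν i = ν j then 2 * Real.pi else 0 := by
  rw [← Complex.ofReal_inj, integral_normSq_trigSum]
  push_cast
  refine Finset.sum_congr rfl fun i _ => Finset.sum_congr rfl fun j _ => ?_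
  rw [Complex.conj_ofReal]
  split_ifs <;> simp

end

/-- `G` is a trigonometric polynomial whose coefficients dominate those of `f`. -/
def Maj (f G : ℝ → ℂ) : Prop :=
  ∃ (ι : Type) (_ : Fintype ι) (c : ι → ℂ) (d : ι → ℝ) (ν : ι → ℤ),
    (∀ i, ‖c i‖ ≤ d i) ∧ f = trigSum c ν ∧ G = trigSum (fun i => (d i : ℂ)) ν

section

variable {f g F G : ℝ → ℂ}

theorem Maj.monomial {c : ℂ} {d : ℝ} (h : ‖c‖ ≤ d) (n : ℤ) :
    Maj (fun θ => c * circlePt θ ^ n) (fun θ => (d : ℂ) * circlePt θ ^ n) :=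
  ⟨Unit, inferInstance, fun _ => c, fun _ => d, fun _ => n, fun _ => h,
    by funext θ; simp [trigSum], by funext θ; simp [trigSum]⟩

/-- Allows a majorant to be padded by extra nonnegative terms, in order to bring it into product
form. -/
theorem Maj.zero_left (h : Maj f F) : Maj (fun _ => 0) F := by
  obtain ⟨ι, _, c, d, ν, h, -, rfl⟩ := h
  exact ⟨ι, inferInstance, fun _ => 0, d, ν,
    fun i => by simpa using (norm_nonneg _).trans (h i), by funext θ; simp [trigSum], rfl⟩

theorem Maj.add (h : Maj f F) (h' : Maj g G) :
    Maj (fun θ => f θ + g θ) (fun θ => F θ + G θ) := by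
  obtain ⟨ι, _, c, d, ν, h, rfl, rfl⟩ := h
  obtain ⟨κ, _, c', d', ν', h', rfl, rfl⟩ := h'
  exact ⟨ι ⊕ κ, inferInstance, Sum.elim c c', Sum.elim d d', Sum.elim ν ν',
    fun i => by rcases i with i | i <;> simp [h, h'], by funext θ; simp [trigSum],
    by funext θ; simp [trigSum]⟩

theorem Maj.mul (h : Maj f F) (h' : Maj g G) :
    Maj (fun θ => f θ * g θ) (fun θ => F θ * G θ) := by
  obtain ⟨ι, _, c, d, ν, h, rfl, rfl⟩ := h
  obtain ⟨κ, _, c', d', ν', h', rfl, rfl⟩ := h'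
  refine ⟨ι × κ, inferInstance, fun i => c i.1 * c' i.2, fun i => d i.1 * d' i.2,
    fun i => ν i.1 + ν' i.2, fun i => ?_, ?_, ?_⟩
  · rw [norm_mul]
    exact mul_le_mul (h _) (h' _) (norm_nonneg _) ((norm_nonneg _).trans (h _))
  · funext θ
    simp only [trigSum, Finset.sum_mul_sum, Fintype.sum_prod_type,
      zpow_add₀ (circlePt_ne_zero θ)]
    exact Finset.sum_congr rfl fun i _ => Finset.sum_congr rfl fun j _ => by ring
  · funext θ
    simp only [trigSum, Finset.sum_mul_sum, Fintype.sum_prod_type,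
      zpow_add₀ (circlePt_ne_zero θ), Complex.ofReal_mul]
    exact Finset.sum_congr rfl fun i _ => Finset.sum_congr rfl fun j _ => by ring

theorem Maj.contDiff (h : Maj f F) : ContDiff ℝ ∞ f := by
  obtain ⟨ι, _, c, d, ν, h, rfl, rfl⟩ := h
  exact contDiff_trigSum c ν

theorem Maj.periodic (h : Maj f F) : Function.Periodic f (2 * Real.pi) := by
  obtain ⟨ι, _, c, d, ν, h, rfl, rfl⟩ := h
  exact periodic_trigSum c ν

/-- By Parseval both integrals are sums over pairs of equal frequencies. On the right every term is
nonnegative and bounds the modulus of its counterpart; differentiation multiplies both coefficients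
by the same power of the frequency. -/
theorem Maj.integral_le (h : Maj f F) (k : ℕ) :
    ∫ θ in (-Real.pi)..Real.pi, ‖iteratedDeriv k f θ‖ ^ 2
      ≤ ∫ θ in (-Real.pi)..Real.pi, ‖iteratedDeriv k F θ‖ ^ 2 := by
  obtain ⟨ι, _, c, d, ν, h, rfl, rfl⟩ := h
  have e : ∀ i, (d i : ℂ) * ((ν i : ℂ) * I) ^ k = ((d i * (ν i : ℝ) ^ k : ℝ) : ℂ) * I ^ k :=
    fun i => by push_cast; rw [mul_pow]; ring
  have h1 : ∫ θ in (-Real.pi)..Real.pi, ‖iteratedDeriv k (trigSum (fun i => (d i : ℂ)) ν) θ‖ ^ 2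
      = ∑ i, ∑ j, (d i * |(ν i : ℝ)| ^ k) * (d j * |(ν j : ℝ)| ^ k)
          * if ν i = ν j then 2 * Real.pi else 0 := by
    rw [iteratedDeriv_trigSum]
    simp only [e]
    have h2 : trigSum (fun i => ((d i * (ν i : ℝ) ^ k : ℝ) : ℂ) * I ^ k) ν
        = fun θ => I ^ k * trigSum (fun i => ((d i * (ν i : ℝ) ^ k : ℝ) : ℂ)) ν θ := by
      funext θ
      simp only [trigSum, Finset.mul_sum]
      exact Finset.sum_congr rfl fun i _ => by ring
    simp only [h2, norm_mul, norm_pow, Complex.norm_I, one_pow, one_mul]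
    rw [integral_normSq_trigSum_of_nonneg]
    refine Finset.sum_congr rfl fun i _ => Finset.sum_congr rfl fun j _ => ?_
    split_ifs with hij
    · have h3 : ((ν j : ℝ)) ^ k * (ν j : ℝ) ^ k = |(ν j : ℝ)| ^ k * |(ν j : ℝ)| ^ k := by
        rw [← mul_pow, ← mul_pow, abs_mul_abs_self]
      rw [hij]
      linear_combination d i * d j * (2 * Real.pi) * h3
    · simp
  rw [h1, iteratedDeriv_trigSum]
  refine integral_normSq_trigSum_le _ _ fun i => ?_
  rw [norm_mul, norm_pow, norm_mul, Complex.norm_I, mul_one, Complex.norm_intCast]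
  exact mul_le_mul_of_nonneg_right (h i) (by positivity)

theorem BddH.of_maj {ι : Type*} {k : ℕ} {f F : ι → ℝ → ℂ} (hF : BddH k F)
    (h : ∀ i, Maj (f i) (F i)) : BddH k f :=
  ⟨fun i => (h i).contDiff, fun i => (h i).periodic, fun j hj =>
    (hF.2.2 j hj).imp fun _ hC i => ((h i).integral_le j).trans (hC i)⟩

end

/-! ### Weak limits and membership in `H^k`. -/

theorem integral_iteratedDeriv_mul {f φ : ℝ → ℂ} (hf : ContDiff ℝ ∞ f)
    (hfp : Function.Periodic f (2 * Real.pi)) (hφ : ContDiff ℝ ∞ φ)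
    (hφp : Function.Periodic φ (2 * Real.pi)) (α : ℕ) :
    ∫ θ in (-Real.pi)..Real.pi, f θ * iteratedDeriv α φ θ
      = (-1) ^ α * ∫ θ in (-Real.pi)..Real.pi, iteratedDeriv α f θ * φ θ := by
  induction α generalizing f with
  | zero => simp
  | succ α ih =>
    have hα : ((α : ℕ∞) : WithTop ℕ∞) < ∞ := by exact_mod_cast ENat.natCast_lt_top α
    have hα' : (((α + 1 : ℕ) : ℕ∞) : WithTop ℕ∞) ≤ ∞ := by exact_mod_cast le_top
    have hper : ∀ n, Function.Periodic (iteratedDeriv n φ) (2 * Real.pi) := fun n => by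
      induction n with
      | zero => simpa using hφp
      | succ n ih => rw [iteratedDeriv_succ]; exact periodic_deriv ih
    have h1 := intervalIntegral.integral_mul_deriv_eq_deriv_mul (a := -Real.pi) (b := Real.pi)
      (u := f) (v := iteratedDeriv α φ) (u' := deriv f) (v' := iteratedDeriv (α + 1) φ)
      (fun x _ => (hf.differentiable (by simp) x).hasDerivAt)
      (fun x _ => by
        rw [iteratedDeriv_succ]
        exact (hφ.differentiable_iteratedDeriv α hα x).hasDerivAt)
      ((contDiff_deriv hf).continuous.intervalIntegrable _ _)
      ((hφ.continuous_iteratedDeriv (α + 1) hα').intervalIntegrable _ _)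
    have e : ∀ u : ℝ → ℂ, Function.Periodic u (2 * Real.pi) → u (-Real.pi) = u Real.pi :=
      fun u hu => by
        have := hu (-Real.pi)
        rwa [show -Real.pi + 2 * Real.pi = Real.pi by ring, eq_comm] at this
    rw [h1, e f hfp, e _ (hper α), sub_self, zero_sub,
      ih (contDiff_deriv hf) (periodic_deriv hfp), iteratedDeriv_succ', pow_succ]
    ring

/-- Bounded sequences in `L²` have weak limits along ultrafilters. -/
theorem exists_weak_limit {X : Type*} [MeasurableSpace X] {μ : Measure X} (U : Ultrafilter ℕ)
    {f : ℕ → X → ℂ} (hf : ∀ N, MemLp (f N) 2 μ) {C : ℝ} (hC : ∀ N, ∫ x, ‖f N x‖ ^ 2 ∂μ ≤ C) :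
    ∃ g : X → ℂ, MemLp g 2 μ ∧ ∀ φ : X → ℂ, MemLp φ 2 μ →
      Tendsto (fun N => ∫ x, f N x * φ x ∂μ) U (𝓝 (∫ x, g x * φ x ∂μ)) := by
  have hstar : ∀ u : X → ℂ, MemLp u 2 μ → MemLp (fun x => (starRingEnd ℂ) (u x)) 2 μ :=
    fun u hu => hu.star
  set x : ℕ → Lp ℂ 2 μ := fun N => (hstar _ (hf N)).toLp _ with hx
  have hinner : ∀ N (φ : X → ℂ) (hφ : MemLp φ 2 μ),
      inner ℂ (x N) (hφ.toLp φ) = ∫ y, f N y * φ y ∂μ := fun N φ hφ => by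
    rw [L2.inner_def]
    refine integral_congr_ae ?_
    filter_upwards [(hstar _ (hf N)).coeFn_toLp, hφ.coeFn_toLp] with y h1 h2
    rw [h1, h2, RCLike.inner_apply, Complex.conj_conj, mul_comm]
  have hnorm : ∀ N, ‖x N‖ ≤ √C := fun N => by
    refine Real.le_sqrt_of_sq_le ((le_of_eq ?_).trans (hC N))
    rw [← Complex.ofReal_inj]
    have h1 := inner_self_eq_norm_sq_to_K (𝕜 := ℂ) (x N)
    have h2 := hinner N _ (hstar _ (hf N))
    rw [h1] at h2
    rw [← integral_complex_ofReal]
    push_cast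
    refine h2.trans (integral_congr_ae (Eventually.of_forall fun y => ?_))
    simp only [Complex.mul_conj, Complex.normSq_eq_norm_sq]
    push_cast
    rfl
  -- Riesz duality turns the bounded sequence into a sequence in a weak-* compact ball
  -- (Banach–Alaoglu), where every ultrafilter converges.
  set F : ℕ → WeakDual ℂ (Lp ℂ 2 μ) := fun N =>
    StrongDual.toWeakDual (InnerProductSpace.toDual ℂ (Lp ℂ 2 μ) (x N)) with hF
  have hmem : ∀ N, F N ∈ WeakDual.toStrongDual ⁻¹' Metric.closedBall
      (0 : StrongDual ℂ (Lp ℂ 2 μ)) √C := fun N => by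
    have : ‖InnerProductSpace.toDual ℂ (Lp ℂ 2 μ) (x N)‖ ≤ √C := by
      rw [LinearIsometryEquiv.norm_map]; exact hnorm N
    simpa [hF] using this
  obtain ⟨ℓ, -, hℓ⟩ := (WeakDual.isCompact_closedBall (𝕜 := ℂ)
    (0 : StrongDual ℂ (Lp ℂ 2 μ)) √C).ultrafilter_le_nhds (U.map F)
    (le_principal_iff.2 (Eventually.of_forall hmem : ∀ᶠ N in (U : Filter ℕ), F N ∈ _))
  set y : Lp ℂ 2 μ := (InnerProductSpace.toDual ℂ (Lp ℂ 2 μ)).symm (WeakDual.toStrongDual ℓ) with hy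
  refine ⟨fun a => (starRingEnd ℂ) (y a), hstar _ (Lp.memLp y), fun φ hφ => ?_⟩
  have h1 : Tendsto (fun N => F N (hφ.toLp φ)) U (𝓝 (ℓ (hφ.toLp φ))) :=
    ((WeakDual.eval_continuous (hφ.toLp φ)).tendsto ℓ).comp (show Tendsto F U (𝓝 ℓ) from hℓ)
  have h2 : ℓ (hφ.toLp φ) = inner ℂ y (hφ.toLp φ) := by
    rw [hy, InnerProductSpace.toDual_symm_apply]; rfl
  have h3 : inner ℂ y (hφ.toLp φ) = ∫ a, (starRingEnd ℂ) (y a) * φ a ∂μ := by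
    rw [L2.inner_def]
    refine integral_congr_ae ?_
    filter_upwards [hφ.coeFn_toLp] with a h1
    rw [h1, RCLike.inner_apply, mul_comm]
  rw [← h3, ← h2]
  refine h1.congr fun N => ?_
  exact hinner N φ hφ

/-- The pointwise limit of a bounded sequence that is bounded in `H^k` lies in `H^k`. -/
theorem BddH.memHTheta {k : ℕ} {f : ℕ → ℝ → ℂ} (hf : BddH k f) {B : ℝ} (hB : ∀ N θ, ‖f N θ‖ ≤ B)
    {r : ℝ → ℂ} (hr : ∀ θ, Tendsto (fun N => f N θ) atTop (𝓝 (r θ))) : MemHTheta k r := by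
  have hπ : -Real.pi ≤ Real.pi := by linarith [Real.pi_pos]
  have hmeas : Measurable r := measurable_of_tendsto_metrizable
    (fun N => (hf.1 N).continuous.measurable) (tendsto_pi_nhds.2 hr)
  have hrB : ∀ θ, ‖r θ‖ ≤ B := fun θ => le_of_tendsto' (hr θ).norm fun N => hB N θ
  have hcont : ∀ u : ℝ → ℂ, Continuous u →
      MemLp u 2 (volume.restrict (Set.Ioc (-Real.pi) Real.pi)) := fun u hu => by
    obtain ⟨D, hD⟩ := isCompact_Icc.exists_bound_of_continuousOn
      (s := Set.Icc (-Real.pi) Real.pi) hu.continuousOn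
    refine MemLp.of_bound hu.aestronglyMeasurable D ?_
    filter_upwards [ae_restrict_mem measurableSet_Ioc] with x hx
    exact hD x (Set.Ioc_subset_Icc_self hx)
  refine ⟨fun θ => tendsto_nhds_unique (hr _) ((hr θ).congr fun N => (hf.2.1 N θ).symm),
    MemLp.of_bound hmeas.aestronglyMeasurable B (Eventually.of_forall hrB), fun α _ hα => ?_⟩
  have hα' : ((α : ℕ∞) : WithTop ℕ∞) ≤ ∞ := by exact_mod_cast le_top
  obtain ⟨C, hC⟩ := hf.2.2 α hα
  -- A nonprincipal ultrafilter replaces the choice of a subsequence. It refines `atTop`, so the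
  -- pointwise limit `r` is also the limit along it.
  obtain ⟨g, hg, hlim⟩ := exists_weak_limit (hyperfilter ℕ)
    (fun N => hcont _ ((hf.1 N).continuous_iteratedDeriv α hα')) (C := C) fun N => by
      have := hC N
      rwa [intervalIntegral.integral_of_le hπ] at this
  refine ⟨g, hg, fun φ hφ hφp => ?_⟩
  have h1 := (hlim φ (hcont φ hφ.continuous)).const_mul ((-1 : ℂ) ^ α)
  have hφc := hφ.continuous_iteratedDeriv α hα'
  have h2 : Tendsto (fun N => ∫ θ in (-Real.pi)..Real.pi, f N θ * iteratedDeriv α φ θ) atTop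
      (𝓝 (∫ θ in (-Real.pi)..Real.pi, r θ * iteratedDeriv α φ θ)) := by
    refine intervalIntegral.tendsto_integral_filter_of_dominated_convergence
      (fun θ => B * ‖iteratedDeriv α φ θ‖) (Eventually.of_forall fun N =>
        ((hf.1 N).continuous.mul hφc).aestronglyMeasurable)
      (Eventually.of_forall fun N => Eventually.of_forall fun θ _ => ?_)
      ((continuous_const.mul hφc.norm).intervalIntegrable _ _)
      (Eventually.of_forall fun θ _ => (hr θ).mul_const _)
    rw [norm_mul]
    exact mul_le_mul_of_nonneg_right (hB N θ) (norm_nonneg _)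
  have h3 := h2.mono_left Nat.hyperfilter_le_atTop
  refine (tendsto_nhds_unique h3 (h1.congr fun N => ?_)).trans ?_
  · rw [integral_iteratedDeriv_mul (hf.1 N) (hf.2.1 N) hφ hφp, intervalIntegral.integral_of_le hπ]
  · rw [intervalIntegral.integral_of_le hπ]

/-! ### Sobolev regularity of the reflection coefficient. -/

/-- The function `2 c cos((2j+1)θ)`, as a trigonometric polynomial. -/
noncomputable def twoCos (c : ℝ) (j : ℤ) (θ : ℝ) : ℂ :=
  (c : ℂ) * circlePt θ ^ (2 * j + 1) + (c : ℂ) * circlePt θ ^ (-(2 * j + 1))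

/-- The majorant of the entries of `transfer`. -/
noncomputable def majProd (q : ℤ → ℂ) (m : ℤ) : ℕ → ℝ → ℂ
  | 0 => fun _ => 1
  | n + 1 => fun θ => (1 + twoCos ‖q (m + n)‖ (m + n) θ) * majProd q m n θ

/-- The majorant of the logarithmic derivative of `majProd`. -/
noncomputable def majSum (q : ℤ → ℂ) (m : ℤ) : ℕ → ℝ → ℂ
  | 0 => fun _ => 0
  | n + 1 => fun θ => majSum q m n θ +
      twoCos (|(2 * (m + n) + 1 : ℝ)| * ‖q (m + n)‖) (m + n) θ

theorem maj_one : Maj (fun _ => 1) (fun _ => 1) := by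
  simpa using Maj.monomial (c := 1) (d := 1) (by simp) 0

theorem maj_zero : Maj (fun _ => 0) (fun _ => 0) := by
  simpa using Maj.monomial (c := 0) (d := 0) (by simp) 0

theorem maj_twoCos {c : ℝ} (hc : 0 ≤ c) (j : ℤ) : Maj (twoCos c j) (twoCos c j) := by
  have h : ‖(c : ℂ)‖ ≤ c := by rw [Complex.norm_real, Real.norm_of_nonneg hc]
  exact (Maj.monomial h _).add (Maj.monomial h _)

theorem maj_majProd (q : ℤ → ℂ) (m : ℤ) (n : ℕ) : Maj (majProd q m n) (majProd q m n) := by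
  induction n with
  | zero => exact maj_one
  | succ n ih => exact (maj_one.add (maj_twoCos (norm_nonneg _) _)).mul ih

/-- A step adds to one entry of a column `q_j z^{∓(2j+1)}` times the other. If both have the
majorant `Q`, then both new entries have the majorant `(1 + |q_j| z^{2j+1} + |q_j| z^{-(2j+1)}) Q`,
the unused frequency being padding. The matrix product is thereby reduced to a scalar one. -/
theorem maj_transfer (q : ℤ → ℂ) (m : ℤ) (n : ℕ) (a b : Fin 2) :
    Maj (fun θ => transfer q (circlePt θ) m n a b) (majProd q m n) := by
  induction n generalizing a with
  | zero =>
    simp only [transfer, majProd]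
    by_cases h : a = b
    · subst h
      simp only [Matrix.one_apply_eq]
      exact maj_one
    · simp only [Matrix.one_apply_ne h]
      exact maj_one.zero_left
  | succ n ih =>
    set j : ℤ := m + n with hj
    have hp : ‖(starRingEnd ℂ) (q j)‖ ≤ ‖q j‖ := by rw [RCLike.norm_conj]
    fin_cases a
    · have h := (ih 0).add (((Maj.monomial (le_refl ‖q j‖) (-(2 * j + 1))).mul (ih 1)).add
        ((Maj.monomial (le_refl ‖q j‖) (2 * j + 1)).mul (ih 1)).zero_left)
      convert h using 1
      · funext θ
        simp [transfer, stepMat, Matrix.mul_apply, Fin.sum_univ_two, ← hj]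
      · funext θ
        simp only [majProd, twoCos, ← hj]
        ring
    · have h := (ih 1).add (((Maj.monomial hp (2 * j + 1)).mul (ih 0)).add
        ((Maj.monomial (le_refl ‖q j‖) (-(2 * j + 1))).mul (ih 0)).zero_left)
      convert h using 1
      · funext θ
        simp [transfer, stepMat, Matrix.mul_apply, Fin.sum_univ_two, ← hj, add_comm]
      · funext θ
        simp only [majProd, twoCos, ← hj]
        ring

theorem maj_deriv_twoCos {c : ℝ} (hc : 0 ≤ c) (j : ℤ) :
    Maj (deriv (twoCos c j)) (twoCos (|(2 * j + 1 : ℝ)| * c) j) := by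
  have e : deriv (twoCos c j) = fun θ =>
      ((c : ℂ) * (((2 * j + 1 : ℤ) : ℂ) * I)) * circlePt θ ^ (2 * j + 1)
        + ((c : ℂ) * (((-(2 * j + 1) : ℤ) : ℂ) * I)) * circlePt θ ^ (-(2 * j + 1)) := by
    funext θ
    have h := ((hasDerivAt_circlePt_zpow (2 * j + 1) θ).const_mul (c : ℂ)).add
      ((hasDerivAt_circlePt_zpow (-(2 * j + 1)) θ).const_mul (c : ℂ))
    exact h.deriv.trans (by ring)
  rw [e]
  have h1 : ‖(c : ℂ) * (((2 * j + 1 : ℤ) : ℂ) * I)‖ ≤ |(2 * j + 1 : ℝ)| * c := by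
    rw [norm_mul, norm_mul, Complex.norm_I, mul_one, Complex.norm_intCast, Complex.norm_real,
      Real.norm_of_nonneg hc, mul_comm]
    push_cast
    rfl
  have h2 : ‖(c : ℂ) * (((-(2 * j + 1) : ℤ) : ℂ) * I)‖ ≤ |(2 * j + 1 : ℝ)| * c := by
    rw [Int.cast_neg, neg_mul, mul_neg, norm_neg]; exact h1
  exact (Maj.monomial h1 _).add (Maj.monomial h2 _)

/-- With `c` the new cosine term and `g` the majorant of `c'`, `((1 + c)Q)' = c'Q + (1 + c)Q'` is
dominated by `gQ + (1 + c)SQ`. Padding by `gcQ` completes this to `(S + g)(1 + c)Q`. -/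
theorem maj_deriv_majProd (q : ℤ → ℂ) (m : ℤ) (n : ℕ) :
    Maj (deriv (majProd q m n)) (fun θ => majSum q m n θ * majProd q m n θ) := by
  induction n with
  | zero => simpa [majProd, majSum] using maj_zero
  | succ n ih =>
    set j : ℤ := m + n with hj
    have hQ := maj_majProd q m n
    have hc := maj_twoCos (norm_nonneg (q j)) j
    have hg : Maj (twoCos (|(2 * j + 1 : ℝ)| * ‖q j‖) j) (twoCos (|(2 * j + 1 : ℝ)| * ‖q j‖) j) :=
      maj_twoCos (by positivity) j
    have h := (((maj_deriv_twoCos (norm_nonneg (q j)) j).mul hQ).add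
      ((maj_one.add hc).mul ih)).add ((hg.mul hc).mul hQ).zero_left
    have hd : ∀ {u : ℝ → ℂ}, Maj u u → Differentiable ℝ u := fun hu =>
      hu.contDiff.differentiable (by simp)
    convert h using 1
    · funext θ
      have h1 := (((hd hc θ).hasDerivAt.const_add 1).mul (hd hQ θ).hasDerivAt).deriv
      rw [add_zero]
      exact h1
    · funext θ
      simp only [majProd, majSum, ← hj]
      have : ((m : ℝ) + (n : ℝ)) = (j : ℝ) := by rw [hj]; push_cast; rfl
      rw [this]
      ring

theorem norm_majProd_le (q : ℤ → ℂ) (m : ℤ) (n : ℕ) (θ : ℝ) :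
    ‖majProd q m n θ‖ ≤ Real.exp (2 * ∑ j ∈ Finset.range n, ‖q (m + j)‖) := by
  induction n with
  | zero => simp [majProd]
  | succ n ih =>
    rw [Finset.sum_range_succ, mul_add, Real.exp_add, mul_comm (Real.exp _), majProd, norm_mul]
    refine mul_le_mul ?_ ih (norm_nonneg _) (Real.exp_pos _).le
    refine le_trans ?_ (Real.add_one_le_exp _)
    have h := norm_add_le (1 : ℂ) (twoCos ‖q (m + n)‖ (m + n) θ)
    have h2 : ‖twoCos ‖q (m + n)‖ (m + n) θ‖ ≤ ‖q (m + n)‖ + ‖q (m + n)‖ := by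
      refine (norm_add_le _ _).trans (le_of_eq ?_)
      simp only [norm_mul, norm_zpow, norm_circlePt, one_zpow, mul_one, Complex.norm_real,
        norm_norm]
    rw [norm_one] at h
    linarith

/-- Within each half the frequencies are distinct, so Parseval applies to the halves separately
without cross terms. -/
theorem majSum_eq (q : ℤ → ℂ) (m : ℤ) (n : ℕ) (s : ℕ → ℂ)
    (hs : ∀ j : ℕ, s j = ((|(2 * (m + j) + 1 : ℝ)| * ‖q (m + j)‖ : ℝ) : ℂ)) :
    majSum q m n = fun θ => trigSum (fun j : Fin n => s j) (fun j => 2 * (m + j) + 1) θ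
      + trigSum (fun j : Fin n => s j) (fun j => -(2 * (m + j) + 1)) θ := by
  induction n with
  | zero => funext θ; simp [majSum, trigSum]
  | succ n ih =>
    funext θ
    rw [majSum, ih]
    simp only [trigSum, Fin.sum_univ_castSucc, twoCos, Fin.val_castSucc, Fin.val_last, hs n]
    ring

/-- Parseval's bound for the two halves of `majSum`. -/
theorem bddH_half {k : ℕ} {q : ℤ → ℂ} (hq : MemL2k (k + 1) q) (ν : ℤ → ℤ)
    (hν : Function.Injective ν) (hν' : ∀ j, |(ν j : ℝ)| = |(2 * j + 1 : ℝ)|) :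
    BddH k (fun (p : ℤ × ℕ) => trigSum
      (fun j : Fin p.2 => ((|(2 * (p.1 + (j : ℕ)) + 1 : ℝ)| * ‖q (p.1 + (j : ℕ))‖ : ℝ) : ℂ))
      (fun j => ν (p.1 + (j : ℕ)))) := by
  refine ⟨fun _ => contDiff_trigSum _ _, fun _ => periodic_trigSum _ _, fun l hl => ?_⟩
  -- Here `2π` comes from Parseval and `6` from `(2x + 1)² ≤ 6(1 + x²)`. The power is `l + 1`: `l`
  -- derivatives and the factor `|2j + 1|` already in the coefficients.
  refine ⟨2 * Real.pi * (6 ^ (l + 1) * ∑' n : ℤ, (1 + (n : ℝ) ^ 2) ^ (k + 1) * ‖q n‖ ^ 2),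
    fun p => ?_⟩
  obtain ⟨m, n⟩ := p
  simp only
  rw [iteratedDeriv_trigSum]
  refine (integral_normSq_trigSum_le _ _ fun i => le_rfl).trans ?_
  have hinj : ∀ i j : Fin n, ν (m + (i : ℕ)) = ν (m + (j : ℕ)) ↔ i = j := fun i j =>
    ⟨fun h => Fin.ext (by simpa using hν h), fun h => by rw [h]⟩
  simp only [hinj, mul_ite, mul_zero, Finset.sum_ite_eq, Finset.mem_univ, if_true]
  rw [← Finset.sum_mul, mul_comm]
  refine mul_le_mul_of_nonneg_left ?_ (by positivity)
  have hterm : ∀ i : Fin n,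
      ‖((|(2 * (m + (i : ℕ)) + 1 : ℝ)| * ‖q (m + (i : ℕ))‖ : ℝ) : ℂ)
        * ((ν (m + (i : ℕ)) : ℂ) * I) ^ l‖ *
      ‖((|(2 * (m + (i : ℕ)) + 1 : ℝ)| * ‖q (m + (i : ℕ))‖ : ℝ) : ℂ)
        * ((ν (m + (i : ℕ)) : ℂ) * I) ^ l‖
      ≤ 6 ^ (l + 1) * ((1 + ((m + (i : ℕ) : ℤ) : ℝ) ^ 2) ^ (k + 1) * ‖q (m + (i : ℕ))‖ ^ 2) := by
    intro i
    have hv := hν' (m + (i : ℕ))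
    rw [norm_mul, norm_pow, norm_mul, Complex.norm_I, mul_one, Complex.norm_intCast,
      Complex.norm_real, hv, Real.norm_of_nonneg (by positivity)]
    push_cast
    set x : ℝ := (m : ℝ) + ((i : ℕ) : ℝ)
    have h1 : |2 * x + 1| ^ 2 ≤ 6 * (1 + x ^ 2) := by
      rw [sq_abs]; nlinarith [sq_nonneg (x - 1)]
    have h2 : (|2 * x + 1| ^ 2) ^ (l + 1) ≤ (6 * (1 + x ^ 2)) ^ (l + 1) :=
      pow_le_pow_left₀ (by positivity) h1 _
    have h3 : (1 + x ^ 2) ^ (l + 1) ≤ (1 + x ^ 2) ^ (k + 1) :=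
      pow_le_pow_right₀ (by nlinarith [sq_nonneg x]) (by omega)
    calc _ = (|2 * x + 1| ^ 2) ^ (l + 1) * ‖q (m + (i : ℕ))‖ ^ 2 := by ring
      _ ≤ (6 ^ (l + 1) * (1 + x ^ 2) ^ (k + 1)) * ‖q (m + (i : ℕ))‖ ^ 2 := by
          rw [mul_pow] at h2
          exact mul_le_mul_of_nonneg_right (h2.trans
            (mul_le_mul_of_nonneg_left h3 (by positivity))) (sq_nonneg _)
      _ = _ := by ring
  refine (Finset.sum_le_sum fun i _ => hterm i).trans ?_
  rw [← Finset.mul_sum]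
  refine mul_le_mul_of_nonneg_left ?_ (by positivity)
  have hemb : Function.Injective fun i : Fin n => m + ((i : ℕ) : ℤ) := fun i j h =>
    Fin.ext (by simpa using h)
  rw [← Finset.sum_image (f := fun n : ℤ => (1 + (n : ℝ) ^ 2) ^ (k + 1) * ‖q n‖ ^ 2)
    (g := fun i : Fin n => m + ((i : ℕ) : ℤ)) hemb.injOn]
  exact hq.sum_le_tsum _ fun _ _ => by positivity

theorem bddH_majSum {k : ℕ} {q : ℤ → ℂ} (hq : MemL2k (k + 1) q) :
    BddH k (fun (p : ℤ × ℕ) => majSum q p.1 p.2) := by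
  have h := (bddH_half hq (fun j => 2 * j + 1) (fun a b h => by simpa using h)
    (fun j => by push_cast; rfl)).add
    (bddH_half hq (fun j => -(2 * j + 1)) (fun a b h => by simpa using h)
    (fun j => by push_cast; rw [abs_neg]))
  convert h using 2 with p
  exact majSum_eq q p.1 p.2 _ fun j => rfl

/-- A bootstrap: if `Q` is bounded in `H^i` with `i ≤ k`, so is `S Q`, which dominates `Q'`, and
hence `Q` is bounded in `H^{i+1}`. The bounds are uniform over all finite stretches of the lattice.
-/
theorem bddH_majProd {k : ℕ} {q : ℤ → ℂ} (hs : Summable fun n => ‖q n‖) (hq : MemL2k (k + 1) q) :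
    BddH (k + 1) (fun (p : ℤ × ℕ) => majProd q p.1 p.2) := by
  have hC : ∀ (p : ℤ × ℕ) θ, ‖majProd q p.1 p.2 θ‖ ≤ Real.exp (2 * ∑' n, ‖q n‖) := fun p θ =>
    (norm_majProd_le q p.1 p.2 θ).trans (Real.exp_le_exp.2
      (mul_le_mul_of_nonneg_left (sum_range_norm_le hs p.1 p.2) zero_le_two))
  have hsm : ∀ p : ℤ × ℕ, ContDiff ℝ ∞ (majProd q p.1 p.2) := fun p => (maj_majProd q _ _).contDiff
  have hpe : ∀ p : ℤ × ℕ, Function.Periodic (majProd q p.1 p.2) (2 * Real.pi) := fun p =>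
    (maj_majProd q _ _).periodic
  have h0 : BddH 0 (fun (p : ℤ × ℕ) => majProd q p.1 p.2) := bddH_zero_of_bounded hsm hpe hC
  have hS := bddH_majSum hq
  suffices h : ∀ i ≤ k + 1, BddH i (fun (p : ℤ × ℕ) => majProd q p.1 p.2) from h _ le_rfl
  intro i hi
  induction i with
  | zero => exact h0
  | succ i ih =>
    refine bddH_succ.2 ⟨h0, BddH.of_maj (F := fun (p : ℤ × ℕ) θ =>
      majSum q p.1 p.2 θ * majProd q p.1 p.2 θ) ?_ fun p => maj_deriv_majProd q p.1 p.2⟩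
    have h1 := hS.mono (show i ≤ k by omega)
    simp only [mul_comm (majSum _ _ _ _)]
    -- `L²` is not an algebra, so the first round uses the uniform bound on `Q` instead.
    rcases i with _ | i
    · exact bddH_zero_mul hsm hpe hC h1
    · exact (ih (by omega)).mul h1

/-- The reflection coefficient of a sequence in `l^{2,k}` lies in `H^k`. -/
theorem IsReflectionCoeff.memHTheta {k : ℕ} (hk : 1 ≤ k) {q : ℤ → ℂ} {r : ℝ → ℂ}
    (hs : Summable fun n => ‖q n‖) (hsup : SupNormLtOne q) (hq : MemL2k k q)
    (hr : IsReflectionCoeff q r) : MemHTheta k r := by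
  obtain ⟨k, rfl⟩ : ∃ l, k = l + 1 := ⟨k - 1, by omega⟩
  obtain ⟨δ, hδ, hprod⟩ := exists_pos_le_prod_range hs hsup
  have hQ := bddH_majProd hs hq
  have hentry : ∀ a, BddH (k + 1) (fun (N : ℕ) θ => fullTransfer q (circlePt θ) N a 0) := fun a =>
    BddH.of_maj (F := fun N : ℕ => majProd q (-N) (2 * N))
      ⟨fun N => hQ.1 (-N, 2 * N), fun N => hQ.2.1 (-N, 2 * N), fun j hj =>
        (hQ.2.2 j hj).imp fun _ h N => h (-N, 2 * N)⟩
      fun N => maj_transfer q _ _ a 0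
  have hdiff : ∀ (N : ℕ) θ, δ ≤ ‖fullTransfer q (circlePt θ) N 0 0‖ ^ 2
      - ‖fullTransfer q (circlePt θ) N 1 0‖ ^ 2 := fun N θ =>
    (hprod _ _).trans_eq (transfer_normSq_sub q (norm_circlePt θ) _ _).symm
  have hlow : ∀ (N : ℕ) θ, √δ ≤ ‖fullTransfer q (circlePt θ) N 0 0‖ := fun N θ => by
    rw [Real.sqrt_le_left (norm_nonneg _)]
    nlinarith [hdiff N θ, sq_nonneg ‖fullTransfer q (circlePt θ) N 1 0‖]
  have hsδ := Real.sqrt_pos.2 hδ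
  -- The finite quotients `b_N / a_N` are bounded in `H^k` because `|a_N| ≥ √δ`; they are bounded by
  -- `1` and converge pointwise to `r`.
  have hH := (hentry 1).mul ((hentry 0).inv hsδ hlow)
  refine hH.memHTheta (B := 1) (fun N θ => ?_) fun θ => ?_
  · have hpos := hsδ.trans_le (hlow N θ)
    rw [norm_mul, norm_inv, ← div_eq_mul_inv, div_le_one hpos]
    refine le_of_sq_le_sq ?_ hpos.le
    linarith [hdiff N θ]
  · obtain ⟨S, hS, h0, hrθ⟩ := hr θ
    have hT := hS.tendsto (circlePt_ne_zero θ)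
    have hT' : ∀ a, Tendsto (fun N => fullTransfer q (circlePt θ) N a 0) atTop (𝓝 (S a 0)) :=
      fun a => tendsto_pi_nhds.1 (tendsto_pi_nhds.1 hT a) 0
    rw [hrθ, div_eq_mul_inv]
    exact (hT' 1).mul ((hT' 0).inv₀ h0)

/-! ### Assembly. -/

theorem MemL2k.summable_norm {k : ℕ} (hk : 1 ≤ k) {q : ℤ → ℂ} (hq : MemL2k k q) :
    Summable fun n => ‖q n‖ := by
  refine (decayBound_of_hasSum hk (A := ∑' n : ℤ, weight k n ^ 2 * ‖q n‖ ^ 2) ?_).2.1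
  exact (hq.congr fun n => by rw [weight_sq]).hasSum

theorem SupNormLtOne.lt_one {ι : Type*} {f : ι → ℂ} (h : SupNormLtOne f) (i : ι) : ‖f i‖ < 1 :=
  h.elim fun _ hρ => (hρ.2 i).trans_lt hρ.1

end AblowitzLadik

theorem mainTheorem3 (k : ℕ) (hk : 1 ≤ k) (q₀ : ℤ → ℂ)
    (hq₀ : AblowitzLadik.MemL2k k q₀) (hq₀_sup : AblowitzLadik.SupNormLtOne q₀) :
    (∃! r₀ : ℝ → ℂ, AblowitzLadik.IsReflectionCoeff q₀ r₀) ∧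
    (∃! q : ℝ → ℤ → ℂ, AblowitzLadik.IsSolution q₀ q) ∧
    ∀ (r₀ : ℝ → ℂ) (q : ℝ → ℤ → ℂ),
      AblowitzLadik.IsReflectionCoeff q₀ r₀ → AblowitzLadik.IsSolution q₀ q →
      ∀ t : ℝ,
        -- the reflection coefficient of `q(t)`
        (∀ r : ℝ → ℂ,
          AblowitzLadik.IsReflectionCoeff (q t) r ↔ r = AblowitzLadik.evolve r₀ t) ∧
        AblowitzLadik.MemHTheta k (AblowitzLadik.evolve r₀ t) ∧
        AblowitzLadik.SupNormLtOne (AblowitzLadik.evolve r₀ t) ∧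
        -- recovery of `q(t)` from the evolved reflection coefficient
        (∀ n : ℤ, ∃ M : ℂ → Matrix (Fin 2) (Fin 2) ℂ,
          AblowitzLadik.IsRHSolution (AblowitzLadik.evolve r₀ t) (n + 1) M ∧
          (∀ M' : ℂ → Matrix (Fin 2) (Fin 2) ℂ,
            AblowitzLadik.IsRHSolution (AblowitzLadik.evolve r₀ t) (n + 1) M' →
            Set.EqOn M' M {z | ‖z‖ ≠ 1}) ∧
          Filter.Tendsto (fun z => M z 0 1 / z) (nhdsWithin 0 {0}ᶜ) (nhds (q t n))) ∧
        AblowitzLadik.MemL2k k (q t) ∧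
        AblowitzLadik.SupNormLtOne (q t) := by
  have hs₀ := hq₀.summable_norm hk
  obtain ⟨q, hq, hq_mem, hq_sup, hq_dec⟩ := AblowitzLadik.exists_solution hk hq₀ hq₀_sup
  refine ⟨⟨_, AblowitzLadik.exists_isReflectionCoeff hs₀ hq₀_sup.lt_one, fun r hr => hr.unique
    (AblowitzLadik.exists_isReflectionCoeff hs₀ hq₀_sup.lt_one)⟩, ⟨q, hq, fun p hp =>
    hp.unique hq⟩, fun r₀ p hr₀ hp t => ?_⟩
  -- By uniqueness the given solution is the constructed one, so it inherits the bound in the disc,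
  -- the weighted summability and the locally uniform decay.
  obtain rfl : p = q := hp.unique hq
  have hs := (hq_mem t).summable_norm hk
  have hlt := (hq_sup t).lt_one
  -- A scattering matrix of the potential at time `t` is supplied by the Jost theory; its first
  -- column is then compared with the one at time `0`.
  have hrt : AblowitzLadik.IsReflectionCoeff (p t) (AblowitzLadik.evolve r₀ t) := fun θ => by
    obtain ⟨S₀, hS₀, h0, hrθ⟩ := hr₀ θ
    obtain ⟨S, hS, h1, -⟩ := AblowitzLadik.exists_isReflectionCoeff hs hlt θ
    obtain ⟨ha, hb⟩ := AblowitzLadik.scattering_evolution hq hq_dec θ t hS₀ hS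
    refine ⟨S, hS, h1, ?_⟩
    rw [AblowitzLadik.evolve, hrθ, ha, hb]
    ring
  refine ⟨fun r => ⟨fun hr => hr.unique hrt, fun h => h ▸ hrt⟩,
    hrt.memHTheta hk hs (hq_sup t) (hq_mem t), hrt.supNormLtOne hs (hq_sup t), fun n => ?_,
    hq_mem t, hq_sup t⟩
  obtain ⟨M, hM, hlim⟩ := AblowitzLadik.exists_isRHSolution hs hlt hrt n
  exact ⟨M, hM, fun M' hM' => hM.eqOn hM', hlim⟩
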